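/- **Proposition.** Let $(M,g)$ be a globally hyperbolic spacetime with volume measure $d\mathrm{Vol}_g$, and let $V_0,V_1$ be finite-rank complex vector bundles over $M$. For a bundle $V$ let $\Gamma(M;V)$ and $\Gamma_{\rm c}(M;V)$ denote its smooth, respectively smooth compactly supported, sections. A hermitian structure on $V$ is a smooth, fiberwise non-degenerate (not necessarily positive) hermitian form $(\cdot,\cdot)_V$; put $(u|v)_V=\int_M (u(x),v(x))_V\,d\mathrm{Vol}_g$ (antilinear in $u$) and let $A^*$ denote the formal adjoint of a differential operator $A$. A differential operator $D$ on $V$ is *Green hyperbolic* if both $D$ and $D^*$ possess retarded and advanced propagators; those of $D$ are linear maps $G_D^\pm:\Gamma_{\rm c}(M;V)\to\Gamma(M;V)$ with $DG_D^\pm f=f=G_D^\pm Df$ and $\operatorname{supp}G_D^\pm f\subset J^\pm(\operatorname{supp}f)$. Put $G_D=G_D^+-G_D^-$. *Subsidiary-condition hypotheses with $T=K$:* $V_0,V_1$ carry hermitian structures; $P\in\mathrm{Diff}(M;V_1)$ satisfies $P^*=P$; $0\neq K\in\mathrm{Diff}(M;V_0,V_1)$ satisfies $PK=0$; and $Q=K^*K$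 and $D=P+KK^*$ are Green hyperbolic. The associated phase space is $$\mathcal V_P=\frac{\operatorname{Ker}K^*|_{\Gamma_{\rm c}}}{\operatorname{Ran}P|_{\Gamma_{\rm c}}},\qquad q_P([u],[v])={\rm i}^{-1}(u|G_Dv)_{V_1}.$$ *BRST hypotheses on a pair $(L,\gamma)$:* $V=V_{[-1]}\oplus V_{[0]}\oplus V_{[1]}$ is a graded bundle with hermitian structure for which the summands are mutually orthogonal ($V_{[i]}=0$ for all other $i\in\mathbb Z$); $\gamma\in\mathrm{Diff}(M;V)$ satisfies $\gamma^2=0$ and $\gamma\,\Gamma(M;V_{[i]})\subset\Gamma(M;V_{[i-1]})$, and its homology on compactly supported sections vanishes in degree $-1$, i.e. $\operatorname{Ker}\gamma|_{\Gamma_{\rm c}}\cap\Gamma(M;V_{[-1]})=\operatorname{Ran}\gamma|_{\Gamma_{\rm c}}\cap\Gamma(M;V_{[-1]})$; $L\in\mathrm{Diff}(M;V)$ is Green hyperbolic, $L^*=L$, $\gamma^*L=L\gamma$, and $L\,\Gamma(M;V_{[i]})\subset\Gamma(M;V_{[-i]})$ for $i\in\{-1,0,1\}$. The associated phase space is $$\mathcal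 V=\frac{\operatorname{Ker}\gamma^*|_{\Gamma_{\rm c}}}{\operatorname{Ran}\gamma^*|_{\Gamma_{\rm c}}+(\operatorname{Ran}L|_{\Gamma_{\rm c}}\cap\operatorname{Ker}\gamma^*|_{\Gamma_{\rm c}})}\Big|_{[0]},\qquad q([u],[v])={\rm i}^{-1}(u|G_Lv)_V,$$ where $E/F|_{[0]}=(E\cap\Gamma(M;V_{[0]}))/(F\cap\Gamma(M;V_{[0]}))$. For $\alpha\in\mathbb R$ define on $V=V_1\oplus V_0^{\oplus3}$, with the direct sum hermitian structure, $$L=\begin{pmatrix}P&K&0&0\\K^*&-\alpha\mathbf 1&0&0\\0&0&0&K^*K\\0&0&K^*K&0\end{pmatrix},\qquad \gamma=\begin{pmatrix}0&0&K&0\\0&0&0&0\\0&0&0&0\\0&\mathbf 1&0&0\end{pmatrix},$$ and grade $V$ by ghost number: $V_{[0]}$ is the sum of the first two summands $V_1\oplus V_0$, $V_{[1]}$ the third and $V_{[-1]}$ the fourth summand. 1. Suppose $V_0,V_1$ carry hermitian structures, $P^*=P$, $K\neq0$, $PK=0$, and $L$ is Green hyperbolic for the given $\alpha$. Then $(L,\gamma)$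 satisfies the BRST hypotheses. 2. Suppose $P$ and $K$ satisfy the subsidiary-condition hypotheses with $T=K$. Then for every $\alpha\in\mathbb R$ the pair $(L,\gamma)$ satisfies the BRST hypotheses, the forms $q$ and $q_P$ are well defined on $\mathcal V$ and $\mathcal V_P$, and $f=(f_a,f_b,f_c,f_{\overline c})\mapsto f_a$ induces a linear isomorphism $\mathcal V\to\mathcal V_P$ that carries $q$ to $q_P$. -/

import Mathlib

open scoped Manifold ContDiff ComplexConjugate
open Bundle MeasureTheory

namespace GaugeBRST

noncomputable section

/-! ### Lorentzian geometry -/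

/-- A time-oriented Lorentzian metric, of signature `(-,+,…,+)`, on a smooth `n`-manifold.
The time orientation is given by a smooth timelike vector field. -/
structure LorentzStructure (n : ℕ) (M : Type*) [TopologicalSpace M]
    [ChartedSpace (EuclideanSpace ℝ (Fin n)) M] [IsManifold (𝓡 n) ∞ M] where
  metric : ∀ x : M, TangentSpace (𝓡 n) x →L[ℝ] TangentSpace (𝓡 n) x →L[ℝ] ℝ
  metric_smooth : ContMDiff (𝓡 n)
    ((𝓡 n).prod 𝓘(ℝ, EuclideanSpace ℝ (Fin n) →L[ℝ] EuclideanSpace ℝ (Fin n) →L[ℝ] ℝ)) ∞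
    (fun x ↦ TotalSpace.mk'
      (EuclideanSpace ℝ (Fin n) →L[ℝ] EuclideanSpace ℝ (Fin n) →L[ℝ] ℝ) x (metric x))
  metric_symm : ∀ x v w, metric x v w = metric x w v
  /-- a timelike vector field, which defines the future -/
  time : ∀ x : M, TangentSpace (𝓡 n) x
  time_smooth : ContMDiff (𝓡 n) ((𝓡 n).prod 𝓘(ℝ, EuclideanSpace ℝ (Fin n))) ∞
    (fun x ↦ TotalSpace.mk' (EuclideanSpace ℝ (Fin n)) x (time x))
  time_timelike : ∀ x, metric x (time x) (time x) < 0
  /-- the metric is positive definite on the orthogonal complement of a timelike vector -/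
  metric_pos : ∀ x v, v ≠ 0 → metric x (time x) v = 0 → 0 < metric x v v

section Geometry

variable {n : ℕ} {M : Type*} [TopologicalSpace M]
  [ChartedSpace (EuclideanSpace ℝ (Fin n)) M] [IsManifold (𝓡 n) ∞ M]

/-- Nonzero causal (timelike or lightlike) tangent vectors pointing to the future. -/
def IsFutureCausal (g : LorentzStructure n M) (x : M) (v : TangentSpace (𝓡 n) x) : Prop :=
  v ≠ 0 ∧ g.metric x v v ≤ 0 ∧ g.metric x (g.time x) v < 0

/-- There is a future-directed causal `C¹` curve, defined on a nondegenerate compact interval,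
from `p` to `q`. -/
def CausalStep (g : LorentzStructure n M) (p q : M) : Prop :=
  ∃ (c : ℝ → M) (a b : ℝ), a < b ∧ ContMDiffOn 𝓘(ℝ, ℝ) (𝓡 n) 1 c (Set.Icc a b) ∧
    c a = p ∧ c b = q ∧ ∀ t ∈ Set.Icc a b, IsFutureCausal g (c t)
      (mfderivWithin 𝓘(ℝ, ℝ) (𝓡 n) c (Set.Icc a b) t (1 : ℝ))

/-- `p ≤ q`: either `p = q`, or there is a future-directed causal piecewise `C¹` curve
from `p` to `q`. -/
def CausalLE (g : LorentzStructure n M) : M → M → Prop := Relation.ReflTransGen (CausalStep g)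

/-- The causal future `J⁺(A)`. -/
def causalFuture (g : LorentzStructure n M) (A : Set M) : Set M := {y | ∃ x ∈ A, CausalLE g x y}

/-- The causal past `J⁻(A)`. -/
def causalPast (g : LorentzStructure n M) (A : Set M) : Set M := {y | ∃ x ∈ A, CausalLE g y x}

/-- Global hyperbolicity: there is no closed causal curve, and all the causal diamonds
`J⁺(p) ∩ J⁻(q)` are compact. -/
structure GloballyHyperbolic (g : LorentzStructure n M) : Prop where
  causal : ∀ p : M, ¬ Relation.TransGen (CausalStep g) p p
  isCompact_diamond : ∀ p q : M, IsCompact (causalFuture g {p} ∩ causalPast g {q})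

/-- The density `√|det gᵢⱼ|` of the metric in the chart `e`, as a function of the coordinates. -/
def chartDensity (g : LorentzStructure n M)
    (e : OpenPartialHomeomorph M (EuclideanSpace ℝ (Fin n))) (y : EuclideanSpace ℝ (Fin n)) : ℝ :=
  √|(Matrix.of fun i j : Fin n ↦ g.metric (e.symm y)
    (mfderiv 𝓘(ℝ, EuclideanSpace ℝ (Fin n)) (𝓡 n) e.symm y (EuclideanSpace.single i (1 : ℝ)))
    (mfderiv 𝓘(ℝ, EuclideanSpace ℝ (Fin n)) (𝓡 n) e.symm y
      (EuclideanSpace.single j (1 : ℝ)))).det|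

variable [MeasurableSpace M] [BorelSpace M]

/-- The measure on the domain of the chart `e` given in coordinates by `√|det gᵢⱼ| dy`
(and zero outside of this domain). -/
def chartMeasure (g : LorentzStructure n M)
    (e : OpenPartialHomeomorph M (EuclideanSpace ℝ (Fin n))) : Measure M :=
  (((volume : Measure (EuclideanSpace ℝ (Fin n))).restrict e.target).withDensity
    fun y ↦ ENNReal.ofReal (chartDensity g e y)).map e.symm

variable [T2Space M] [SigmaCompactSpace M]

/-- A smooth partition of unity subordinate to the cover by the domains of the preferred charts. -/
def chartPartition (n : ℕ) (M : Type*) [TopologicalSpace M]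
    [ChartedSpace (EuclideanSpace ℝ (Fin n)) M] [IsManifold (𝓡 n) ∞ M]
    [T2Space M] [SigmaCompactSpace M] : SmoothPartitionOfUnity M (𝓡 n) M Set.univ :=
  Classical.choose (SmoothPartitionOfUnity.exists_isSubordinate_chartAt_source (𝓡 n) M)

/-- The volume measure `dVol_g`, glued from the charts by a partition of unity in the usual way
(the result does not depend on the choices, by the change of variables formula). -/
def volumeMeasure (g : LorentzStructure n M) : Measure M :=
  Measure.sum fun i : M ↦
    (chartMeasure g (chartAt (EuclideanSpace ℝ (Fin n)) i)).withDensity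
      fun x ↦ ENNReal.ofReal (chartPartition n M i x)

end Geometry

/-! ### Sections of complex vector bundles -/

section Sections

variable (n : ℕ) {M : Type*} [TopologicalSpace M] [ChartedSpace (EuclideanSpace ℝ (Fin n)) M]
  (F : Type*) [NormedAddCommGroup F] [NormedSpace ℂ F]
  (V : M → Type*) [TopologicalSpace (TotalSpace F V)] [∀ x, AddCommGroup (V x)]
  [∀ x, Module ℂ (V x)] [∀ x, TopologicalSpace (V x)] [FiberBundle F V] [VectorBundle ℂ F V]

variable {n F V} in
theorem contMDiff_smul_section {f : M → ℂ} {s : ∀ x, V x} (hf : ContMDiff (𝓡 n) 𝓘(ℝ, ℂ) ∞ f)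
    (hs : ContMDiff (𝓡 n) ((𝓡 n).prod 𝓘(ℝ, F)) ∞ fun x ↦ TotalSpace.mk' F x (s x)) :
    ContMDiff (𝓡 n) ((𝓡 n).prod 𝓘(ℝ, F)) ∞ fun x ↦ TotalSpace.mk' F x (f x • s x) := by
  intro x
  have hs := (Bundle.contMDiffAt_section x).1 (hs x)
  rw [Bundle.contMDiffAt_section]
  have hm : ContDiff ℝ ∞ (fun p : ℂ × F ↦ p.1 • p.2) := contDiff_fst.smul contDiff_snd
  refine (hm.contMDiff.contMDiffAt.comp x
    ((hf x).prodMk_space hs)).congr_of_eventuallyEq ?_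
  filter_upwards [(trivializationAt F V x).open_baseSet.mem_nhds
    (mem_baseSet_trivializationAt F V x)] with y hy
  exact ((trivializationAt F V x).linear ℂ hy).2 (f y) (s y)

/-- The smooth sections of `V`, as a subspace of the space of all sections. -/
def smoothSubmodule : Submodule ℂ (∀ x, V x) where
  carrier := {s | ContMDiff (𝓡 n) ((𝓡 n).prod 𝓘(ℝ, F)) ∞ fun x ↦ TotalSpace.mk' F x (s x)}
  zero_mem' := by
    intro x
    rw [Bundle.contMDiffAt_section]
    refine (contMDiffAt_const (c := (0 : F))).congr_of_eventuallyEq ?_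
    filter_upwards [(trivializationAt F V x).open_baseSet.mem_nhds
      (mem_baseSet_trivializationAt F V x)] with y hy
    exact congrArg Prod.snd ((trivializationAt F V x).zeroSection ℂ hy)
  add_mem' := by
    intro s t hs ht x
    have hs := (Bundle.contMDiffAt_section x).1 (hs x)
    have ht := (Bundle.contMDiffAt_section x).1 (ht x)
    rw [Bundle.contMDiffAt_section]
    refine (hs.add ht).congr_of_eventuallyEq ?_
    filter_upwards [(trivializationAt F V x).open_baseSet.mem_nhds
      (mem_baseSet_trivializationAt F V x)] with y hy
    exact ((trivializationAt F V x).linear ℂ hy).1 (s y) (t y)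
  smul_mem' := fun c _ hs ↦ contMDiff_smul_section (f := fun _ ↦ c) contMDiff_const hs

/-- `Γ(M;V)`: the complex vector space of smooth sections of `V`. -/
def SmoothSections := ↥(smoothSubmodule n F V)

instance : AddCommGroup (SmoothSections n F V) :=
  inferInstanceAs (AddCommGroup ↥(smoothSubmodule n F V))

instance : Module ℂ (SmoothSections n F V) :=
  inferInstanceAs (Module ℂ ↥(smoothSubmodule n F V))

variable {n F V}

/-- The support of a section. -/
def secSupport (s : SmoothSections n F V) : Set M := closure {x | s.1 x ≠ 0}

variable (n F V) in
/-- `Γ_c(M;V)`: the smooth sections with compact support. -/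
def CompactSections : Submodule ℂ (SmoothSections n F V) where
  carrier := {s | IsCompact (secSupport s)}
  zero_mem' := by
    have h : {x | (0 : SmoothSections n F V).1 x ≠ 0} = ∅ := by
      ext x
      exact ⟨fun hx ↦ hx rfl, fun hx ↦ hx.elim⟩
    change IsCompact (closure _)
    rw [h, closure_empty]
    exact isCompact_empty
  add_mem' := by
    intro s t hs ht
    refine (IsCompact.union hs ht).of_isClosed_subset isClosed_closure ?_
    rw [secSupport, secSupport, secSupport, ← closure_union]
    refine closure_mono fun x hx ↦ ?_
    by_contra h
    simp only [Set.mem_union, Set.mem_ofPred_eq, not_or, not_not] at h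
    refine hx ?_
    change s.1 x + t.1 x = 0
    rw [h.1, h.2, add_zero]
  smul_mem' := by
    intro c s hs
    refine IsCompact.of_isClosed_subset hs isClosed_closure (closure_mono fun x hx h ↦ hx ?_)
    change c • s.1 x = 0
    rw [h, smul_zero]

/-- Multiplication of sections by a smooth function. -/
def mulSection (f : M → ℂ) (hf : ContMDiff (𝓡 n) 𝓘(ℝ, ℂ) ∞ f) :
    SmoothSections n F V →ₗ[ℂ] SmoothSections n F V where
  toFun s := ⟨fun x ↦ f x • s.1 x, contMDiff_smul_section hf s.2⟩
  map_add' s t := Subtype.ext (funext fun x ↦ smul_add (f x) (s.1 x) (t.1 x))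
  map_smul' c s := Subtype.ext (funext fun x ↦ smul_comm (f x) c (s.1 x))

end Sections

section Operators

variable {n : ℕ} {M : Type*} [TopologicalSpace M] [ChartedSpace (EuclideanSpace ℝ (Fin n)) M]
  {F : Type*} [NormedAddCommGroup F] [NormedSpace ℂ F]
  {V : M → Type*} [TopologicalSpace (TotalSpace F V)] [∀ x, AddCommGroup (V x)]
  [∀ x, Module ℂ (V x)] [∀ x, TopologicalSpace (V x)] [FiberBundle F V] [VectorBundle ℂ F V]
  {F' : Type*} [NormedAddCommGroup F'] [NormedSpace ℂ F']
  {W : M → Type*} [TopologicalSpace (TotalSpace F' W)] [∀ x, AddCommGroup (W x)]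
  [∀ x, Module ℂ (W x)] [∀ x, TopologicalSpace (W x)] [FiberBundle F' W] [VectorBundle ℂ F' W]

/-! ### Differential operators -/

/-- `Diff^m(M;V,W)`: linear differential operators of order at most `m`, in the standard algebraic
form: operators of order `0` are those that commute with the multiplication by smooth functions
(bundle morphisms), and `A` has order at most `m + 1` if `[A, f]` has order at most `m` for every
smooth function `f`. -/
def IsDiffOpOfOrder : ℕ → (SmoothSections n F V →ₗ[ℂ] SmoothSections n F' W) → Prop
  | 0, A => ∀ (f : M → ℂ) (hf : ContMDiff (𝓡 n) 𝓘(ℝ, ℂ) ∞ f),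
      A ∘ₗ mulSection f hf - mulSection f hf ∘ₗ A = 0
  | m + 1, A => ∀ (f : M → ℂ) (hf : ContMDiff (𝓡 n) 𝓘(ℝ, ℂ) ∞ f),
      IsDiffOpOfOrder m (A ∘ₗ mulSection f hf - mulSection f hf ∘ₗ A)

/-- `Diff(M;V,W)`: linear differential operators with smooth coefficients. -/
def IsDiffOp (A : SmoothSections n F V →ₗ[ℂ] SmoothSections n F' W) : Prop :=
  ∃ m, IsDiffOpOfOrder m A

/-! ### Hermitian structures and formal adjoints -/

/-- A sesquilinear form on each fiber, antilinear in the first argument. -/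
abbrev FiberForm (V : M → Type*) [∀ x, AddCommGroup (V x)] [∀ x, Module ℂ (V x)] :=
  ∀ x, V x →ₗ⋆[ℂ] V x →ₗ[ℂ] ℂ

variable (n F) in
/-- Hermitian structures: smooth fiberwise non-degenerate hermitian forms, not necessarily
positive. -/
structure IsHermitianStructure (h : FiberForm V) : Prop where
  hermitian : ∀ x (v w : V x), h x v w = conj (h x w v)
  nondegenerate : ∀ x (v : V x), (∀ w, h x v w = 0) → v = 0
  smooth : ∀ u v : SmoothSections n F V,
    ContMDiff (𝓡 n) 𝓘(ℝ, ℂ) ∞ fun x ↦ h x (u.1 x) (v.1 x)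

variable [IsManifold (𝓡 n) ∞ M] [T2Space M] [SigmaCompactSpace M] [MeasurableSpace M]
  [BorelSpace M]

/-- `(u|v)_V = ∫ (u(x), v(x))_V dVol_g`. -/
def pairing (g : LorentzStructure n M) (h : FiberForm V) (u v : SmoothSections n F V) : ℂ :=
  ∫ x, h x (u.1 x) (v.1 x) ∂(volumeMeasure g)

/-- `(A u|v) = (u|B v)` for all compactly supported `u`, `v`. -/
def IsFormalAdjoint (g : LorentzStructure n M) (hV : FiberForm V) (hW : FiberForm W)
    (A : SmoothSections n F V →ₗ[ℂ] SmoothSections n F' W)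
    (B : SmoothSections n F' W →ₗ[ℂ] SmoothSections n F V) : Prop :=
  ∀ u ∈ CompactSections n F V, ∀ v ∈ CompactSections n F' W,
    pairing g hW (A u) v = pairing g hV u (B v)

open Classical in
/-- The formal adjoint `A*` of a differential operator: the differential operator
that satisfies `(A u|v) = (u|A* v)` for all compactly supported `u`, `v` (for hermitian structures,
there is exactly one). -/
def formalAdjoint (g : LorentzStructure n M) (hV : FiberForm V) (hW : FiberForm W)
    (A : SmoothSections n F V →ₗ[ℂ] SmoothSections n F' W) :
    SmoothSections n F' W →ₗ[ℂ] SmoothSections n F V :=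
  if H : ∃ B, IsDiffOp B ∧ IsFormalAdjoint g hV hW A B then Classical.choose H else 0

/-! ### Propagators -/

/-- `G : Γ_c → Γ` is a propagator of `D` with `supp G f ⊆ J (supp f)`: it is a two-sided inverse
of `D` on compactly supported sections. -/
structure IsPropagator (J : Set M → Set M)
    (D : SmoothSections n F V →ₗ[ℂ] SmoothSections n F V)
    (G : CompactSections n F V →ₗ[ℂ] SmoothSections n F V) : Prop where
  right_inv : ∀ f : CompactSections n F V, D (G f) = f
  left_inv : ∀ f k : CompactSections n F V, D f = k → G k = f
  support : ∀ f : CompactSections n F V, secSupport (G f) ⊆ J (secSupport f.1)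

/-- `D` has a retarded propagator (support in the causal future) and an advanced one
(support in the causal past). -/
def HasPropagators (g : LorentzStructure n M)
    (D : SmoothSections n F V →ₗ[ℂ] SmoothSections n F V) : Prop :=
  (∃ G, IsPropagator (causalFuture g) D G) ∧ (∃ G, IsPropagator (causalPast g) D G)

/-- Green hyperbolic operators: differential operators `D` such that `D` and `D*` have retarded
and advanced propagators. -/
structure GreenHyperbolic (g : LorentzStructure n M) (h : FiberForm V)
    (D : SmoothSections n F V →ₗ[ℂ] SmoothSections n F V) : Prop where
  isDiffOp : IsDiffOp D
  propagators : HasPropagators g D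
  propagators_adjoint : HasPropagators g (formalAdjoint g h h D)

open Classical in
/-- The causal propagator `G_D = G_D⁺ - G_D⁻`, for operators with retarded and advanced
propagators `G_D⁺`, `G_D⁻` (these are unique for Green hyperbolic operators). -/
def causalPropagator (g : LorentzStructure n M)
    (D : SmoothSections n F V →ₗ[ℂ] SmoothSections n F V) :
    CompactSections n F V →ₗ[ℂ] SmoothSections n F V :=
  if H : HasPropagators g D then Classical.choose H.1 - Classical.choose H.2 else 0

/-- `q` is the form `q([u],[v]) = i⁻¹ (u|G_D v)` on the quotient of a space `A` of compactly
supported sections by (the intersection with `A` of) `B`; in particular this expression does not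
depend on the choice of representatives. -/
def IsInducedForm (g : LorentzStructure n M) (h : FiberForm V)
    (D : SmoothSections n F V →ₗ[ℂ] SmoothSections n F V)
    {A B : Submodule ℂ (SmoothSections n F V)} (hA : A ≤ CompactSections n F V)
    (q : (↥A ⧸ B.submoduleOf A) →ₗ⋆[ℂ] (↥A ⧸ B.submoduleOf A) →ₗ[ℂ] ℂ) : Prop :=
  ∀ u v : A, q (Submodule.Quotient.mk u) (Submodule.Quotient.mk v) =
    Complex.I⁻¹ * pairing g h u.1 (causalPropagator g D (Submodule.inclusion hA v))

/-! ### The subsidiary condition framework -/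

/-- The hypotheses of Hack and Schenkel on `P ∈ Diff(M;V₁)`, `K, T ∈ Diff(M;V₀,V₁)`, where `V = V₀`
and `W = V₁`. -/
structure HackSchenkel (g : LorentzStructure n M) (h₀ : FiberForm V) (h₁ : FiberForm W)
    (P : SmoothSections n F' W →ₗ[ℂ] SmoothSections n F' W)
    (K T : SmoothSections n F V →ₗ[ℂ] SmoothSections n F' W) : Prop where
  hermitian₀ : IsHermitianStructure n F h₀
  hermitian₁ : IsHermitianStructure n F' h₁
  P_diffOp : IsDiffOp P
  P_selfAdjoint : IsFormalAdjoint g h₁ h₁ P P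
  K_diffOp : IsDiffOp K
  K_ne_zero : K ≠ 0
  P_comp_K : P ∘ₗ K = 0
  R_green : GreenHyperbolic g h₀ (formalAdjoint g h₀ h₁ K ∘ₗ K)
  T_diffOp : IsDiffOp T
  D_green : GreenHyperbolic g h₁ (P + T ∘ₗ formalAdjoint g h₀ h₁ K)
  Q_green : GreenHyperbolic g h₀ (formalAdjoint g h₀ h₁ K ∘ₗ T)

/-- `Ker K*|_{Γ_c}`. -/
def subsidiaryKer (g : LorentzStructure n M) (h₀ : FiberForm V) (h₁ : FiberForm W)
    (K : SmoothSections n F V →ₗ[ℂ] SmoothSections n F' W) :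
    Submodule ℂ (SmoothSections n F' W) :=
  CompactSections n F' W ⊓ LinearMap.ker (formalAdjoint g h₀ h₁ K)

/-- `𝒱_P = Ker K*|_{Γ_c} / Ran P|_{Γ_c}`. -/
abbrev SubsidiaryPhaseSpace (g : LorentzStructure n M) (h₀ : FiberForm V) (h₁ : FiberForm W)
    (P : SmoothSections n F' W →ₗ[ℂ] SmoothSections n F' W)
    (K : SmoothSections n F V →ₗ[ℂ] SmoothSections n F' W) :=
  ↥(subsidiaryKer g h₀ h₁ K) ⧸
    ((CompactSections n F' W).map P).submoduleOf (subsidiaryKer g h₀ h₁ K)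

/-! ### The BRST framework -/

/-- A grading by `{-1, 0, 1}` of a hermitian bundle: a fiberwise decomposition
`V = V_[-1] ⊕ V_[0] ⊕ V_[1]` into mutually orthogonal smooth subbundles (smoothness: the components
of a smooth section are smooth). -/
structure IsHermitianGrading (h : FiberForm V) (gr : ℤ → ∀ x, Submodule ℂ (V x)) : Prop where
  isInternal : ∀ x, DirectSum.IsInternal fun i ↦ gr i x
  index : ∀ i, i ∉ ({-1, 0, 1} : Set ℤ) → ∀ x, gr i x = ⊥
  smooth : ∀ s : SmoothSections n F V, ∃ t : ℤ → SmoothSections n F V,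
    (∀ i x, (t i).1 x ∈ gr i x) ∧ s = t (-1) + t 0 + t 1
  orthogonal : ∀ i j, i ≠ j → ∀ x, ∀ u ∈ gr i x, ∀ v ∈ gr j x, h x u v = 0

variable (n F) in
/-- `Γ(M;V_[i])`, as a subspace of `Γ(M;V)`. -/
def GradedSections (gr : ℤ → ∀ x, Submodule ℂ (V x)) (i : ℤ) :
    Submodule ℂ (SmoothSections n F V) where
  carrier := {s | ∀ x, s.1 x ∈ gr i x}
  zero_mem' x := (gr i x).zero_mem
  add_mem' hs ht x := (gr i x).add_mem (hs x) (ht x)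
  smul_mem' c _ hs x := (gr i x).smul_mem c (hs x)

/-- `E/B |_[i] = (E ∩ Γ(M;V_[i])) / (B ∩ Γ(M;V_[i]))`. -/
abbrev GradedQuotient (gr : ℤ → ∀ x, Submodule ℂ (V x)) (E B : Submodule ℂ (SmoothSections n F V))
    (i : ℤ) :=
  ↥(E ⊓ GradedSections n F gr i) ⧸
    (B ⊓ GradedSections n F gr i).submoduleOf (E ⊓ GradedSections n F gr i)

/-- The hypotheses of the BRST framework on the hermitian graded bundle `V` and the operators
`L, γ ∈ Diff(M;V)`. -/
structure BRSTHypotheses [∀ x, Module ℝ (V x)] [∀ x, IsScalarTower ℝ ℂ (V x)]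
    [VectorBundle ℝ F V]
    [ContMDiffVectorBundle ∞ F V (𝓡 n)]
    (g : LorentzStructure n M) (h : FiberForm V)
    (gr : ℤ → ∀ x, Submodule ℂ (V x))
    (L γ : SmoothSections n F V →ₗ[ℂ] SmoothSections n F V) : Prop where
  hermitian : IsHermitianStructure n F h
  grading : IsHermitianGrading (n := n) (F := F) h gr
  γ_diffOp : IsDiffOp γ
  γ_sq : γ ∘ₗ γ = 0
  γ_grading : ∀ i, ∀ s ∈ GradedSections n F gr i, γ s ∈ GradedSections n F gr (i - 1)
  /-- `H_{-1,c}(γ) = (Ker γ|_{Γ_c} / Ran γ|_{Γ_c})|_[-1] = {0}` -/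
  homology : Subsingleton (GradedQuotient gr (CompactSections n F V ⊓ LinearMap.ker γ)
    ((CompactSections n F V).map γ) (-1))
  L_green : GreenHyperbolic g h L
  L_selfAdjoint : IsFormalAdjoint g h h L L
  γ_L_comm : formalAdjoint g h h γ ∘ₗ L = L ∘ₗ γ
  L_grading : ∀ i ∈ ({-1, 0, 1} : Set ℤ), ∀ s ∈ GradedSections n F gr i,
    L s ∈ GradedSections n F gr (-i)

/-- `Ker γ*|_{Γ_c}`. -/
def brstKer (g : LorentzStructure n M) (h : FiberForm V)
    (γ : SmoothSections n F V →ₗ[ℂ] SmoothSections n F V) : Submodule ℂ (SmoothSections n F V) :=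
  CompactSections n F V ⊓ LinearMap.ker (formalAdjoint g h h γ)

/-- `Ran γ*|_{Γ_c} + (Ran L|_{Γ_c} ∩ Ker γ*|_{Γ_c})`. -/
def brstRan (g : LorentzStructure n M) (h : FiberForm V)
    (L γ : SmoothSections n F V →ₗ[ℂ] SmoothSections n F V) :
    Submodule ℂ (SmoothSections n F V) :=
  (CompactSections n F V).map (formalAdjoint g h h γ) ⊔
    ((CompactSections n F V).map L ⊓ brstKer g h γ)

/-- The BRST phase space
`𝒱 = Ker γ*|_{Γ_c} / (Ran γ*|_{Γ_c} + (Ran L|_{Γ_c} ∩ Ker γ*|_{Γ_c})) |_[0]`. -/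
abbrev BRSTPhaseSpace (g : LorentzStructure n M) (h : FiberForm V)
    (gr : ℤ → ∀ x, Submodule ℂ (V x))
    (L γ : SmoothSections n F V →ₗ[ℂ] SmoothSections n F V) :=
  GradedQuotient gr (brstKer g h γ) (brstRan g h L γ) 0

theorem subsidiaryKer_le (g : LorentzStructure n M) (h₀ : FiberForm V) (h₁ : FiberForm W)
    (K : SmoothSections n F V →ₗ[ℂ] SmoothSections n F' W) :
    subsidiaryKer g h₀ h₁ K ≤ CompactSections n F' W := inf_le_left

theorem brstKer_graded_le (g : LorentzStructure n M) (h : FiberForm V)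
    (gr : ℤ → ∀ x, Submodule ℂ (V x)) (γ : SmoothSections n F V →ₗ[ℂ] SmoothSections n F V)
    (i : ℤ) : brstKer g h γ ⊓ GradedSections n F gr i ≤ CompactSections n F V :=
  inf_le_left.trans inf_le_left

end Operators

/-! ### Direct sums of bundles -/

section Sums

variable {n : ℕ} {M : Type*} [TopologicalSpace M] [ChartedSpace (EuclideanSpace ℝ (Fin n)) M]
  {F : Type*} [NormedAddCommGroup F] [NormedSpace ℂ F]
  {V : M → Type*} [TopologicalSpace (TotalSpace F V)] [∀ x, AddCommGroup (V x)]
  [∀ x, Module ℂ (V x)] [∀ x, TopologicalSpace (V x)] [FiberBundle F V] [VectorBundle ℂ F V]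
  {F' : Type*} [NormedAddCommGroup F'] [NormedSpace ℂ F']
  {W : M → Type*} [TopologicalSpace (TotalSpace F' W)] [∀ x, AddCommGroup (W x)]
  [∀ x, Module ℂ (W x)] [∀ x, TopologicalSpace (W x)] [FiberBundle F' W] [VectorBundle ℂ F' W]

/-- First component of a section of `V ⊕ W`. -/
def secFst : SmoothSections n (F × F') (V ×ᵇ W) →ₗ[ℂ] SmoothSections n F V where
  toFun s := ⟨fun x ↦ (s.1 x).1, fun x ↦ (Bundle.contMDiffAt_section x).2
    ((contDiff_fst (𝕜 := ℝ) (E := F) (F := F')).contMDiff.contMDiffAt.comp x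
      ((Bundle.contMDiffAt_section x).1 (s.2 x)))⟩
  map_add' _ _ := rfl
  map_smul' _ _ := rfl

/-- Second component of a section of `V ⊕ W`. -/
def secSnd : SmoothSections n (F × F') (V ×ᵇ W) →ₗ[ℂ] SmoothSections n F' W where
  toFun s := ⟨fun x ↦ (s.1 x).2, fun x ↦ (Bundle.contMDiffAt_section x).2
    ((contDiff_snd (𝕜 := ℝ) (E := F) (F := F')).contMDiff.contMDiffAt.comp x
      ((Bundle.contMDiffAt_section x).1 (s.2 x)))⟩
  map_add' _ _ := rfl
  map_smul' _ _ := rfl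

/-- The map `u ↦ A u ⊕ B u` into the sections of `V ⊕ W`. -/
def secPair {X : Type*} [AddCommGroup X] [Module ℂ X] (A : X →ₗ[ℂ] SmoothSections n F V)
    (B : X →ₗ[ℂ] SmoothSections n F' W) : X →ₗ[ℂ] SmoothSections n (F × F') (V ×ᵇ W) where
  toFun u := ⟨fun x ↦ ((A u).1 x, (B u).1 x), fun x ↦ (Bundle.contMDiffAt_section x).2
    (((Bundle.contMDiffAt_section x).1 ((A u).2 x)).prodMk_space
      ((Bundle.contMDiffAt_section x).1 ((B u).2 x)))⟩
  map_add' u v := by rw [map_add, map_add]; rfl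
  map_smul' c u := by rw [map_smul, map_smul]; rfl

end Sums

/-! ### The operators `L` and `γ` on `V₁ ⊕ V₀ ⊕ V₀ ⊕ V₀` -/

section Blocks

variable {n : ℕ} {M : Type*} [TopologicalSpace M] [ChartedSpace (EuclideanSpace ℝ (Fin n)) M]
  {F₁ : Type*} [NormedAddCommGroup F₁] [NormedSpace ℂ F₁]
  {V₁ : M → Type*} [TopologicalSpace (TotalSpace F₁ V₁)] [∀ x, AddCommGroup (V₁ x)]
  [∀ x, Module ℂ (V₁ x)] [∀ x, TopologicalSpace (V₁ x)] [FiberBundle F₁ V₁] [VectorBundle ℂ F₁ V₁]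
  {F₀ : Type*} [NormedAddCommGroup F₀] [NormedSpace ℂ F₀]
  {V₀ : M → Type*} [TopologicalSpace (TotalSpace F₀ V₀)] [∀ x, AddCommGroup (V₀ x)]
  [∀ x, Module ℂ (V₀ x)] [∀ x, TopologicalSpace (V₀ x)] [FiberBundle F₀ V₀] [VectorBundle ℂ F₀ V₀]

/-- The bundle `V₁ ⊕ V₀ ⊕ V₀ ⊕ V₀`. -/
abbrev TotalBundle (V₁ V₀ : M → Type*) := V₁ ×ᵇ (V₀ ×ᵇ (V₀ ×ᵇ V₀))

variable (n F₁ V₁ F₀ V₀) in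
/-- Sections `f = (f_a, f_b, f_c, f_d)` of `V₁ ⊕ V₀ ⊕ V₀ ⊕ V₀`
(where `d` stands for the antighost index). -/
abbrev TotalSections := SmoothSections n (F₁ × (F₀ × (F₀ × F₀))) (TotalBundle V₁ V₀)

/-- `f ↦ f_a`, the field component. -/
def compA : TotalSections n F₁ V₁ F₀ V₀ →ₗ[ℂ] SmoothSections n F₁ V₁ := secFst

/-- `f ↦ f_b`, the Lagrange multiplier component. -/
def compB : TotalSections n F₁ V₁ F₀ V₀ →ₗ[ℂ] SmoothSections n F₀ V₀ := secFst ∘ₗ secSnd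

/-- `f ↦ f_c`, the ghost component. -/
def compC : TotalSections n F₁ V₁ F₀ V₀ →ₗ[ℂ] SmoothSections n F₀ V₀ :=
  secFst ∘ₗ secSnd ∘ₗ secSnd

/-- `f ↦ f_d`, the antighost component. -/
def compD : TotalSections n F₁ V₁ F₀ V₀ →ₗ[ℂ] SmoothSections n F₀ V₀ :=
  secSnd ∘ₗ secSnd ∘ₗ secSnd

/-- The operator with the four given rows. -/
def ofRows {X : Type*} [AddCommGroup X] [Module ℂ X] (A : X →ₗ[ℂ] SmoothSections n F₁ V₁)
    (B C D : X →ₗ[ℂ] SmoothSections n F₀ V₀) : X →ₗ[ℂ] TotalSections n F₁ V₁ F₀ V₀ :=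
  secPair A (secPair B (secPair C D))

/-- The direct sum of the forms of `V₁`, `V₀`, `V₀`, `V₀`. -/
def totalForm (h₁ : FiberForm V₁) (h₀ : FiberForm V₀) : FiberForm (TotalBundle V₁ V₀) :=
  fun x ↦ LinearMap.mk₂'ₛₗ (starRingEnd ℂ) (RingHom.id ℂ)
    (fun u v ↦ h₁ x u.1 v.1 + h₀ x u.2.1 v.2.1 + h₀ x u.2.2.1 v.2.2.1 + h₀ x u.2.2.2 v.2.2.2)
    (by intro u u' v; simp; ring) (by intro c u v; simp; ring)
    (by intro u v v'; simp; ring) (by intro c u v; simp; ring)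

/-- The grading by the ghost number: `V_[0] = V₁ ⊕ V₀ ⊕ 0 ⊕ 0`, `V_[1] = 0 ⊕ 0 ⊕ V₀ ⊕ 0`,
`V_[-1] = 0 ⊕ 0 ⊕ 0 ⊕ V₀`. -/
def ghostGrading (V₁ V₀ : M → Type*) [∀ x, AddCommGroup (V₀ x)] [∀ x, Module ℂ (V₀ x)]
    [∀ x, AddCommGroup (V₁ x)] [∀ x, Module ℂ (V₁ x)] (i : ℤ) (x : M) :
    Submodule ℂ (TotalBundle V₁ V₀ x) where
  carrier := {v | (i ≠ 0 → v.1 = 0 ∧ v.2.1 = 0) ∧ (i ≠ 1 → v.2.2.1 = 0) ∧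
    (i ≠ -1 → v.2.2.2 = 0)}
  zero_mem' := ⟨fun _ ↦ ⟨rfl, rfl⟩, fun _ ↦ rfl, fun _ ↦ rfl⟩
  add_mem' := by
    rintro u v ⟨h1, h2, h3⟩ ⟨k1, k2, k3⟩
    refine ⟨fun h ↦ ⟨?_, ?_⟩, fun h ↦ ?_, fun h ↦ ?_⟩
    · simp [(h1 h).1, (k1 h).1]
    · simp [(h1 h).2, (k1 h).2]
    · simp [h2 h, k2 h]
    · simp [h3 h, k3 h]
  smul_mem' := by
    rintro c v ⟨h1, h2, h3⟩
    refine ⟨fun h ↦ ⟨?_, ?_⟩, fun h ↦ ?_, fun h ↦ ?_⟩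
    · simp [(h1 h).1]
    · simp [(h1 h).2]
    · simp [h2 h]
    · simp [h3 h]

/-- The operator
`γ = [[0, 0, K, 0], [0, 0, 0, 0], [0, 0, 0, 0], [0, 1, 0, 0]]`. -/
def gammaOp (K : SmoothSections n F₀ V₀ →ₗ[ℂ] SmoothSections n F₁ V₁) :
    TotalSections n F₁ V₁ F₀ V₀ →ₗ[ℂ] TotalSections n F₁ V₁ F₀ V₀ :=
  ofRows (K ∘ₗ compC) 0 0 compB

variable [IsManifold (𝓡 n) ∞ M] [T2Space M] [SigmaCompactSpace M] [MeasurableSpace M]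
  [BorelSpace M]

/-- The operator
`L = [[P, K, 0, 0], [K*, -α, 0, 0], [0, 0, 0, K*K], [0, 0, K*K, 0]]`. -/
def bigL (g : LorentzStructure n M) (h₀ : FiberForm V₀) (h₁ : FiberForm V₁)
    (P : SmoothSections n F₁ V₁ →ₗ[ℂ] SmoothSections n F₁ V₁)
    (K : SmoothSections n F₀ V₀ →ₗ[ℂ] SmoothSections n F₁ V₁) (α : ℝ) :
    TotalSections n F₁ V₁ F₀ V₀ →ₗ[ℂ] TotalSections n F₁ V₁ F₀ V₀ :=
  ofRows (P ∘ₗ compA + K ∘ₗ compB)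
    (formalAdjoint g h₀ h₁ K ∘ₗ compA - (α : ℂ) • compB)
    (formalAdjoint g h₀ h₁ K ∘ₗ K ∘ₗ compD)
    (formalAdjoint g h₀ h₁ K ∘ₗ K ∘ₗ compC)

/-- The modified hypotheses, on `P` and `K` only: instead of `K*K` and `P + T K*`, the operator `L`
with parameter `α` is assumed to be Green hyperbolic. -/
structure ModifiedSubsidiary (g : LorentzStructure n M) (h₀ : FiberForm V₀) (h₁ : FiberForm V₁)
    (P : SmoothSections n F₁ V₁ →ₗ[ℂ] SmoothSections n F₁ V₁)
    (K : SmoothSections n F₀ V₀ →ₗ[ℂ] SmoothSections n F₁ V₁) (α : ℝ) : Prop where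
  hermitian₀ : IsHermitianStructure n F₀ h₀
  hermitian₁ : IsHermitianStructure n F₁ h₁
  P_diffOp : IsDiffOp P
  P_selfAdjoint : IsFormalAdjoint g h₁ h₁ P P
  K_diffOp : IsDiffOp K
  K_ne_zero : K ≠ 0
  P_comp_K : P ∘ₗ K = 0
  L_green : GreenHyperbolic g (totalForm h₁ h₀) (bigL g h₀ h₁ P K α)

end Blocks

end

end GaugeBRST

open GaugeBRST

namespace GaugeBRST

noncomputable section

/-! ### Supports, cutoff functions and differential operators -/

section Basic

open Filter Topology

variable {n : ℕ} {M : Type*} [TopologicalSpace M] [ChartedSpace (EuclideanSpace ℝ (Fin n)) M]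
  {F : Type*} [NormedAddCommGroup F] [NormedSpace ℂ F]
  {V : M → Type*} [TopologicalSpace (TotalSpace F V)] [∀ x, AddCommGroup (V x)]
  [∀ x, Module ℂ (V x)] [∀ x, TopologicalSpace (V x)] [FiberBundle F V] [VectorBundle ℂ F V]
  {F' : Type*} [NormedAddCommGroup F'] [NormedSpace ℂ F']
  {W : M → Type*} [TopologicalSpace (TotalSpace F' W)] [∀ x, AddCommGroup (W x)]
  [∀ x, Module ℂ (W x)] [∀ x, TopologicalSpace (W x)] [FiberBundle F' W] [VectorBundle ℂ F' W]
  {F'' : Type*} [NormedAddCommGroup F''] [NormedSpace ℂ F'']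
  {X : M → Type*} [TopologicalSpace (TotalSpace F'' X)] [∀ x, AddCommGroup (X x)]
  [∀ x, Module ℂ (X x)] [∀ x, TopologicalSpace (X x)] [FiberBundle F'' X] [VectorBundle ℂ F'' X]

/-! The BRST conditions are matrix identities. The adjoint `γ*` sends `(a, b, c, d)` to `(0, d, K*
a, 0)`, and `γ* L = L γ` reduces to `P K = 0` and its adjoint `K* P = 0`. The homology in degree
`-1` is killed by the entry `1` of `γ`, since `(0, 0, 0, d) = γ (0, d, 0, 0)`. One point is not
formal. `formalAdjoint` takes the value zero when no adjoint exists, so the existence of `K*` has to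
be extracted from the hypotheses: were `K*` zero, then `K* K` would vanish and could have no right
inverse on a nonzero test section, and one exists because `K ≠ 0`.

For the second claim, put `Q = K* K` and `D = P + K K*`. From `K* P = 0` and `P K = 0` one gets `K*
D = Q K*` and `D K = K Q`, hence `K* G_D = G_Q K*` and `P G_D = 1 - K G_Q K* = G_D P` on test
sections, for each time direction separately. The equation `L u = f` is then solved by elimination:
`K*` applied to the first row gives `Q u_b = K* f_a`, then `u_a` follows
(`PropagatorPair.exists_isPropagator_bigL`). For `α ≠ 1` this requires solving `Q e = G_Q K* f_a`,
whose source is not compactly supported, so propagators must be extended to sources supported in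
`J⁺(C)` with `C` compact (`IsPropagator.exists_solution`).

Uniqueness of such solutions comes from self-adjointness: if `D v = 0`, then `(f|v) = (D G⁻ f|v) =
(G⁻ f|D v) = 0` for every test section `f` (`IsPropagator.uniquelySolvable_rev`). The integration by
parts is legitimate because `J⁺(C) ∩ J⁻(C')` is compact, which is where global hyperbolicity enters
(`IsCausalRelation.isCompact_inter`). The conclusion `v = 0` needs the pairing to be non-degenerate,
hence a volume measure that is finite on compact sets and positive on open ones.

For the phase spaces, degree-zero elements of `Ker γ*` are the `(a, b, 0, 0)` with `K* a = 0`. The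
trivial ones among them are those with `a = P w` for a test section `w`: `Ran γ*` absorbs every `b`,
and if `L v` lies in `Ker γ*`, then `Q v_b = 0` forces `v_b = 0`. So `f ↦ f_a` is bijective on
classes. On these elements `G_L (a, b, 0, 0) = (G_D a + K G_Q b, 0, 0, 0)`, and the summand `K G_Q
b` is orthogonal to `Ker K*`, so the two forms agree. -/

@[ext] theorem SmoothSections.ext {s t : SmoothSections n F V} (h : ∀ x, s.1 x = t.1 x) : s = t :=
  Subtype.ext (funext h)

@[simp] theorem coe_add_section (s t : SmoothSections n F V) (x : M) :
    (s + t).1 x = s.1 x + t.1 x := rfl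

@[simp] theorem coe_sub_section (s t : SmoothSections n F V) (x : M) :
    (s - t).1 x = s.1 x - t.1 x := rfl

@[simp] theorem coe_neg_section (s : SmoothSections n F V) (x : M) : (-s).1 x = -s.1 x := rfl

@[simp] theorem coe_zero_section (x : M) : (0 : SmoothSections n F V).1 x = 0 := rfl

@[simp] theorem coe_smul_section (c : ℂ) (s : SmoothSections n F V) (x : M) :
    (c • s).1 x = c • s.1 x := rfl

@[simp] theorem coe_mulSection (f : M → ℂ) (hf : ContMDiff (𝓡 n) 𝓘(ℝ, ℂ) ∞ f)
    (s : SmoothSections n F V) (x : M) : (mulSection f hf s).1 x = f x • s.1 x := rfl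

theorem isClosed_secSupport (s : SmoothSections n F V) : IsClosed (secSupport s) := isClosed_closure

theorem notMem_secSupport_iff {s : SmoothSections n F V} {x : M} :
    x ∉ secSupport s ↔ ∀ᶠ y in 𝓝 x, s.1 y = 0 := by
  rw [secSupport, mem_closure_iff_frequently, not_frequently]
  simp

theorem eq_zero_of_notMem_secSupport {s : SmoothSections n F V} {x : M} (h : x ∉ secSupport s) :
    s.1 x = 0 := (notMem_secSupport_iff.1 h).self_of_nhds

theorem mem_secSupport_of_ne {s : SmoothSections n F V} {x : M} (h : s.1 x ≠ 0) :
    x ∈ secSupport s := subset_closure h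

theorem secSupport_subset_of_isClosed {s : SmoothSections n F V} {C : Set M} (hC : IsClosed C)
    (h : ∀ x, s.1 x ≠ 0 → x ∈ C) : secSupport s ⊆ C := closure_minimal h hC

theorem secSupport_add (s t : SmoothSections n F V) :
    secSupport (s + t) ⊆ secSupport s ∪ secSupport t := by
  refine secSupport_subset_of_isClosed
    ((isClosed_secSupport s).union (isClosed_secSupport t)) fun x hx ↦ ?_
  by_contra h
  rw [Set.mem_union, not_or] at h
  exact hx (by simp [eq_zero_of_notMem_secSupport h.1, eq_zero_of_notMem_secSupport h.2])

theorem secSupport_smul (c : ℂ) (s : SmoothSections n F V) :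
    secSupport (c • s) ⊆ secSupport s :=
  closure_mono fun x hx h ↦ hx (by simp [h])

theorem secSupport_neg (s : SmoothSections n F V) : secSupport (-s) ⊆ secSupport s :=
  closure_mono fun x hx h ↦ hx (by simp [h])

theorem secSupport_sub (s t : SmoothSections n F V) :
    secSupport (s - t) ⊆ secSupport s ∪ secSupport t := by
  rw [sub_eq_add_neg]
  exact (secSupport_add _ _).trans (Set.union_subset_union_right _ (secSupport_neg t))

theorem secSupport_zero : secSupport (0 : SmoothSections n F V) = ∅ := by
  simp [secSupport]

theorem secSupport_mulSection_left (f : M → ℂ) (hf : ContMDiff (𝓡 n) 𝓘(ℝ, ℂ) ∞ f)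
    (s : SmoothSections n F V) : secSupport (mulSection f hf s) ⊆ tsupport f :=
  closure_mono fun x hx h ↦ hx (by simp [h])

theorem secSupport_mulSection_right (f : M → ℂ) (hf : ContMDiff (𝓡 n) 𝓘(ℝ, ℂ) ∞ f)
    (s : SmoothSections n F V) : secSupport (mulSection f hf s) ⊆ secSupport s :=
  closure_mono fun x hx h ↦ hx (by simp [h])

theorem mem_compactSections_of_subset {s : SmoothSections n F V} {C : Set M} (hC : IsCompact C)
    (h : secSupport s ⊆ C) : s ∈ CompactSections n F V :=
  hC.of_isClosed_subset (isClosed_secSupport s) h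

theorem contMDiff_ofReal_comp {f : M → ℝ} (hf : ContMDiff (𝓡 n) 𝓘(ℝ, ℝ) ∞ f) :
    ContMDiff (𝓡 n) 𝓘(ℝ, ℂ) ∞ fun x ↦ (f x : ℂ) :=
  (Complex.ofRealCLM.contDiff (n := ∞)).contMDiff.comp hf

/-! ### Cutoff functions and locality of differential operators. -/

section Cutoff

variable [IsManifold (𝓡 n) ∞ M] [T2Space M] [SigmaCompactSpace M]

/-- Smooth cutoff functions. -/
theorem exists_cutoff {C U : Set M} (hC : IsCompact C) (hU : IsOpen U) (hCU : C ⊆ U) :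
    ∃ χ : M → ℝ, ContMDiff (𝓡 n) 𝓘(ℝ, ℝ) ∞ χ ∧ (∀ᶠ x in 𝓝ˢ C, χ x = 1) ∧
      HasCompactSupport χ ∧ tsupport χ ⊆ U ∧ ∀ x, 0 ≤ χ x := by
  have : LocallyCompactSpace M := Manifold.locallyCompact_of_finiteDimensional (𝓡 n)
  obtain ⟨L, hL, hCL, hLU⟩ := exists_compact_between hC hU hCU
  obtain ⟨f, h1, h0, h01⟩ :=
    exists_contMDiffMap_one_nhds_of_subset_interior (n := ⊤) (𝓡 n) hC.isClosed hCL
  have hs : tsupport f ⊆ L := closure_minimal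
    (fun x hx ↦ by by_contra h; exact hx (h0 x h)) hL.isClosed
  exact ⟨f, f.contMDiff, h1, hL.of_isClosed_subset (isClosed_tsupport _) hs, hs.trans hLU,
    fun x ↦ (h01 x).1⟩

/-- Complex-valued smooth cutoff functions. -/
theorem exists_complex_cutoff {C U : Set M} (hC : IsCompact C) (hU : IsOpen U) (hCU : C ⊆ U) :
    ∃ χ : M → ℂ, ContMDiff (𝓡 n) 𝓘(ℝ, ℂ) ∞ χ ∧ (∀ x ∈ C, ∀ᶠ y in 𝓝 x, χ y = 1) ∧
      IsCompact (tsupport χ) ∧ tsupport χ ⊆ U := by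
  obtain ⟨f, hf, h1, hc, hs, -⟩ := exists_cutoff (n := n) hC hU hCU
  have : tsupport (fun x ↦ (f x : ℂ)) ⊆ tsupport f := closure_mono fun x hx h ↦ hx (by simp [h])
  refine ⟨fun x ↦ f x, contMDiff_ofReal_comp hf, fun x hx ↦ ?_,
    hc.isCompact.of_isClosed_subset (isClosed_tsupport _) this, this.trans hs⟩
  filter_upwards [eventually_nhdsSet_iff_forall.1 h1 x hx] with y hy
  simp [hy]

/-- Differential operators do not increase supports. -/
theorem IsDiffOpOfOrder.local_of_order {m : ℕ} {A : SmoothSections n F V →ₗ[ℂ] SmoothSections n F' W}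
    (hA : IsDiffOpOfOrder m A) {s : SmoothSections n F V} {x : M} (hs : ∀ᶠ y in 𝓝 x, s.1 y = 0) :
    (A s).1 x = 0 := by
  induction m generalizing A with
  | zero =>
    obtain ⟨U, hU, hUo, hxU⟩ := eventually_nhds_iff.1 hs
    obtain ⟨χ, hχ, h1, -, hsub⟩ := exists_complex_cutoff (n := n) (isCompact_singleton (x := x))
      hUo (by simpa using hxU)
    have h0 : mulSection χ hχ s = 0 := by
      ext y
      by_cases hy : y ∈ U
      · simp [hU y hy]
      · simp [image_eq_zero_of_notMem_tsupport fun h ↦ hy (hsub h)]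
    -- Evaluate `[A, χ] s = 0` at `x`: since `χ s = 0` and `χ x = 1`, only `-(A s) x` remains.
    have := congrArg (fun t : SmoothSections n F' W ↦ t.1 x) (LinearMap.congr_fun (hA χ hχ) s)
    simpa [h0, (h1 x rfl).self_of_nhds] using this
  | succ m ih =>
    obtain ⟨U, hU, hUo, hxU⟩ := eventually_nhds_iff.1 hs
    obtain ⟨χ, hχ, h1, -, hsub⟩ := exists_complex_cutoff (n := n) (isCompact_singleton (x := x))
      hUo (by simpa using hxU)
    have h0 : mulSection χ hχ s = 0 := by
      ext y
      by_cases hy : y ∈ U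
      · simp [hU y hy]
      · simp [image_eq_zero_of_notMem_tsupport fun h ↦ hy (hsub h)]
    -- The commutator `[A, χ]` has smaller order, so it is local by induction; as `χ s = 0`, its
    -- value on `s` at `x` is `-(A s) x`.
    have := ih (hA χ hχ)
    simpa [h0, (h1 x rfl).self_of_nhds] using this

theorem IsDiffOp.apply_eq_zero {A : SmoothSections n F V →ₗ[ℂ] SmoothSections n F' W}
    (hA : IsDiffOp A) {s : SmoothSections n F V} {x : M} (hs : ∀ᶠ y in 𝓝 x, s.1 y = 0) :
    (A s).1 x = 0 := hA.choose_spec.local_of_order hs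

theorem IsDiffOp.apply_congr {A : SmoothSections n F V →ₗ[ℂ] SmoothSections n F' W}
    (hA : IsDiffOp A) {s t : SmoothSections n F V} {x : M} (h : ∀ᶠ y in 𝓝 x, s.1 y = t.1 y) :
    (A s).1 x = (A t).1 x := by
  have := hA.apply_eq_zero (s := s - t) (x := x) (by
    filter_upwards [h] with y hy
    simp [hy])
  rwa [map_sub, coe_sub_section, sub_eq_zero] at this

theorem IsDiffOp.secSupport_apply {A : SmoothSections n F V →ₗ[ℂ] SmoothSections n F' W}
    (hA : IsDiffOp A) (s : SmoothSections n F V) : secSupport (A s) ⊆ secSupport s := by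
  refine secSupport_subset_of_isClosed (isClosed_secSupport s) fun x hx ↦ ?_
  by_contra h
  exact hx (hA.apply_eq_zero (notMem_secSupport_iff.1 h))

theorem IsDiffOp.mem_compactSections {A : SmoothSections n F V →ₗ[ℂ] SmoothSections n F' W}
    (hA : IsDiffOp A) {s : SmoothSections n F V} (hs : s ∈ CompactSections n F V) :
    A s ∈ CompactSections n F' W :=
  mem_compactSections_of_subset hs (hA.secSupport_apply s)

/-- Multiplication of a local section by a cutoff function. -/
theorem contMDiff_cutoff_smul {χ : M → ℂ} (hχ : ContMDiff (𝓡 n) 𝓘(ℝ, ℂ) ∞ χ) {s : ∀ x, V x}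
    (hs : ∀ x ∈ tsupport χ, ContMDiffAt (𝓡 n) ((𝓡 n).prod 𝓘(ℝ, F)) ∞
      (fun y ↦ TotalSpace.mk' F y (s y)) x) :
    ContMDiff (𝓡 n) ((𝓡 n).prod 𝓘(ℝ, F)) ∞ fun x ↦ TotalSpace.mk' F x (χ x • s x) := by
  intro x
  by_cases hx : x ∈ tsupport χ
  · have hs := (Bundle.contMDiffAt_section x).1 (hs x hx)
    rw [Bundle.contMDiffAt_section]
    have hm : ContDiff ℝ ∞ (fun p : ℂ × F ↦ p.1 • p.2) := contDiff_fst.smul contDiff_snd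
    refine (hm.contMDiff.contMDiffAt.comp x
      ((hχ x).prodMk_space hs)).congr_of_eventuallyEq ?_
    filter_upwards [(trivializationAt F V x).open_baseSet.mem_nhds
      (mem_baseSet_trivializationAt F V x)] with y hy
    exact ((trivializationAt F V x).linear ℂ hy).2 (χ y) (s y)
  · refine ((0 : SmoothSections n F V).2 x).congr_of_eventuallyEq ?_
    filter_upwards [(isClosed_tsupport χ).isOpen_compl.mem_nhds hx] with y hy
    rw [image_eq_zero_of_notMem_tsupport hy, zero_smul]
    rfl

variable (F) in
/-- Every vector extends to a compactly supported section. -/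
theorem exists_compactSection_eq [∀ x, Module ℝ (V x)] [VectorBundle ℝ F V]
    [ContMDiffVectorBundle ∞ F V (𝓡 n)] (x : M) (v : V x) :
    ∃ s ∈ CompactSections n F V, s.1 x = v := by
  obtain ⟨U, hU, hs⟩ := FiberBundle.exists_contMDiffOn_extend (k := ∞) (𝓡 n) F v
  -- The extension of `v` is smooth only near `x`, so the cutoff must be supported in the interior
  -- of that neighbourhood.
  obtain ⟨χ, hχ, h1, hc, hsub⟩ := exists_complex_cutoff (n := n) (isCompact_singleton (x := x))
      isOpen_interior (by simpa using mem_interior_iff_mem_nhds.2 hU)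
  refine ⟨⟨fun y ↦ χ y • FiberBundle.extend F v y, contMDiff_cutoff_smul hχ fun y hy ↦
    (hs y (interior_subset (hsub hy))).contMDiffAt (mem_interior_iff_mem_nhds.1 (hsub hy))⟩,
    mem_compactSections_of_subset hc (closure_mono fun y hy h ↦ hy ?_), ?_⟩
  · simp [h]
  · simp [(h1 x rfl).self_of_nhds]

theorem exists_compactSection_ne_zero {s : SmoothSections n F V} (hs : s ≠ 0) :
    ∃ t ∈ CompactSections n F V, t ≠ 0 := by
  obtain ⟨x, hx⟩ : ∃ x, s.1 x ≠ 0 := by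
    by_contra! h
    exact hs (SmoothSections.ext h)
  obtain ⟨χ, hχ, h1, hc, -⟩ := exists_complex_cutoff (n := n) (isCompact_singleton (x := x))
      isOpen_univ (Set.subset_univ _)
  refine ⟨mulSection χ hχ s,
    mem_compactSections_of_subset hc (secSupport_mulSection_left χ hχ s), fun h ↦ hx ?_⟩
  simpa [(h1 x rfl).self_of_nhds] using congrArg (fun t : SmoothSections n F V ↦ t.1 x) h

end Cutoff

/-! ### The filtered algebra of differential operators. -/

section Algebra

variable {A A' : SmoothSections n F V →ₗ[ℂ] SmoothSections n F' W}
  {B : SmoothSections n F' W →ₗ[ℂ] SmoothSections n F'' X}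

theorem IsDiffOpOfOrder.succ {m : ℕ} (h : IsDiffOpOfOrder m A) : IsDiffOpOfOrder (m + 1) A := by
  induction m generalizing A with
  | zero =>
    intro f hf
    rw [h f hf]
    intro f' hf'
    simp
  | succ m ih => exact fun f hf ↦ ih (h f hf)

theorem IsDiffOpOfOrder.mono {m k : ℕ} (h : IsDiffOpOfOrder m A) (hk : m ≤ k) :
    IsDiffOpOfOrder k A := by
  induction k, hk using Nat.le_induction with
  | base => exact h
  | succ k _ ih => exact ih.succ

theorem IsDiffOpOfOrder.add {m : ℕ} (h : IsDiffOpOfOrder m A) (h' : IsDiffOpOfOrder m A') :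
    IsDiffOpOfOrder m (A + A') := by
  have key : ∀ (A A' : SmoothSections n F V →ₗ[ℂ] SmoothSections n F' W) (f : M → ℂ)
      (hf : ContMDiff (𝓡 n) 𝓘(ℝ, ℂ) ∞ f),
      (A + A') ∘ₗ mulSection f hf - mulSection f hf ∘ₗ (A + A') =
      (A ∘ₗ mulSection f hf - mulSection f hf ∘ₗ A) +
        (A' ∘ₗ mulSection f hf - mulSection f hf ∘ₗ A') := by
    intro A A' f hf
    rw [LinearMap.add_comp, LinearMap.comp_add]
    abel
  induction m generalizing A A' with
  | zero =>
    intro f hf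
    rw [key, h f hf, h' f hf, add_zero]
  | succ m ih =>
    intro f hf
    rw [key]
    exact ih (h f hf) (h' f hf)

theorem IsDiffOpOfOrder.smul {m : ℕ} (c : ℂ) (h : IsDiffOpOfOrder m A) :
    IsDiffOpOfOrder m (c • A) := by
  have key : ∀ (A : SmoothSections n F V →ₗ[ℂ] SmoothSections n F' W) (f : M → ℂ)
      (hf : ContMDiff (𝓡 n) 𝓘(ℝ, ℂ) ∞ f),
      (c • A) ∘ₗ mulSection f hf - mulSection f hf ∘ₗ (c • A) =
      c • (A ∘ₗ mulSection f hf - mulSection f hf ∘ₗ A) := by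
    intro A f hf
    rw [LinearMap.smul_comp, LinearMap.comp_smul, smul_sub]
  induction m generalizing A with
  | zero =>
    intro f hf
    rw [key, h f hf, smul_zero]
  | succ m ih =>
    intro f hf
    rw [key]
    exact ih (h f hf)

theorem isDiffOpOfOrder_zero (m : ℕ) :
    IsDiffOpOfOrder m (0 : SmoothSections n F V →ₗ[ℂ] SmoothSections n F' W) :=
  IsDiffOpOfOrder.mono (m := 0) (fun f hf ↦ by simp) (Nat.zero_le m)

/-- Leibniz rule `[B A, f] = [B, f] A + B [A, f]`, with induction on the total order: each summand
has one factor of lower order. -/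
theorem IsDiffOpOfOrder.comp {m k : ℕ} (hB : IsDiffOpOfOrder m B) (hA : IsDiffOpOfOrder k A) :
    IsDiffOpOfOrder (m + k) (B ∘ₗ A) := by
  have key : ∀ (B : SmoothSections n F' W →ₗ[ℂ] SmoothSections n F'' X)
      (A : SmoothSections n F V →ₗ[ℂ] SmoothSections n F' W) (f : M → ℂ)
      (hf : ContMDiff (𝓡 n) 𝓘(ℝ, ℂ) ∞ f),
      (B ∘ₗ A) ∘ₗ mulSection f hf - mulSection f hf ∘ₗ (B ∘ₗ A) =
      (B ∘ₗ mulSection f hf - mulSection f hf ∘ₗ B) ∘ₗ A +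
        B ∘ₗ (A ∘ₗ mulSection f hf - mulSection f hf ∘ₗ A) := by
    intro B A f hf
    simp only [LinearMap.sub_comp, LinearMap.comp_sub, LinearMap.comp_assoc]
    abel
  induction hN : m + k using Nat.strong_induction_on generalizing m k A B with
  | _ N ih =>
  subst hN
  -- The definition recurses on the order, and `m + k` may be a successor through either factor, so
  -- order zero and positive order are prepared separately.
  have step : ∀ (f : M → ℂ) (hf : ContMDiff (𝓡 n) 𝓘(ℝ, ℂ) ∞ f),
      (m + k = 0 → (B ∘ₗ A) ∘ₗ mulSection f hf - mulSection f hf ∘ₗ (B ∘ₗ A) = 0) ∧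
      ∀ N, m + k = N + 1 → IsDiffOpOfOrder N
        ((B ∘ₗ A) ∘ₗ mulSection f hf - mulSection f hf ∘ₗ (B ∘ₗ A)) := by
    intro f hf
    rw [key]
    constructor
    · intro h
      obtain ⟨rfl, rfl⟩ : m = 0 ∧ k = 0 := by omega
      rw [hA f hf, hB f hf]
      simp
    · intro N h
      refine IsDiffOpOfOrder.add ?_ ?_
      · cases m with
        | zero =>
          rw [hB f hf, LinearMap.zero_comp]
          exact isDiffOpOfOrder_zero N
        | succ m => exact ih N (by omega) (hB f hf) hA (by omega)
      · cases k with
        | zero =>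
          rw [hA f hf, LinearMap.comp_zero]
          exact isDiffOpOfOrder_zero N
        | succ k => exact ih N (by omega) hB (hA f hf) (by omega)
  rcases h : m + k with _ | N
  · exact fun f hf ↦ (step f hf).1 h
  · exact fun f hf ↦ (step f hf).2 N h

theorem IsDiffOp.add (h : IsDiffOp A) (h' : IsDiffOp A') : IsDiffOp (A + A') := by
  obtain ⟨m, h⟩ := h
  obtain ⟨k, h'⟩ := h'
  exact ⟨max m k, (h.mono (le_max_left m k)).add (h'.mono (le_max_right m k))⟩

theorem IsDiffOp.smul (c : ℂ) (h : IsDiffOp A) : IsDiffOp (c • A) := h.imp fun _ h ↦ h.smul c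

theorem IsDiffOp.sub (h : IsDiffOp A) (h' : IsDiffOp A') : IsDiffOp (A - A') := by
  have := h.add (h'.smul (-1))
  rwa [neg_one_smul, ← sub_eq_add_neg] at this

theorem isDiffOp_zero : IsDiffOp (0 : SmoothSections n F V →ₗ[ℂ] SmoothSections n F' W) :=
  ⟨0, isDiffOpOfOrder_zero 0⟩

theorem IsDiffOp.comp (hB : IsDiffOp B) (hA : IsDiffOp A) : IsDiffOp (B ∘ₗ A) :=
  ⟨_, hB.choose_spec.comp hA.choose_spec⟩

theorem isDiffOp_secFst :
    IsDiffOp (secFst : SmoothSections n (F × F') (V ×ᵇ W) →ₗ[ℂ] SmoothSections n F V) :=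
  ⟨0, fun f hf ↦ by ext s x; exact sub_self _⟩

theorem isDiffOp_secSnd :
    IsDiffOp (secSnd : SmoothSections n (F × F') (V ×ᵇ W) →ₗ[ℂ] SmoothSections n F' W) :=
  ⟨0, fun f hf ↦ by ext s x; exact sub_self _⟩

theorem IsDiffOpOfOrder.secPair {m : ℕ} {A : SmoothSections n F'' X →ₗ[ℂ] SmoothSections n F V}
    {B : SmoothSections n F'' X →ₗ[ℂ] SmoothSections n F' W} (hA : IsDiffOpOfOrder m A)
    (hB : IsDiffOpOfOrder m B) : IsDiffOpOfOrder m (secPair A B) := by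
  have key : ∀ (A : SmoothSections n F'' X →ₗ[ℂ] SmoothSections n F V)
      (B : SmoothSections n F'' X →ₗ[ℂ] SmoothSections n F' W) (f : M → ℂ)
      (hf : ContMDiff (𝓡 n) 𝓘(ℝ, ℂ) ∞ f),
      GaugeBRST.secPair A B ∘ₗ mulSection f hf - mulSection f hf ∘ₗ GaugeBRST.secPair A B =
      GaugeBRST.secPair (A ∘ₗ mulSection f hf - mulSection f hf ∘ₗ A)
        (B ∘ₗ mulSection f hf - mulSection f hf ∘ₗ B) := fun A B f hf ↦ rfl
  induction m generalizing A B with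
  | zero =>
    intro f hf
    rw [key, hA f hf, hB f hf]
    rfl
  | succ m ih =>
    intro f hf
    rw [key]
    exact ih (hA f hf) (hB f hf)

theorem IsDiffOp.secPair {A : SmoothSections n F'' X →ₗ[ℂ] SmoothSections n F V}
    {B : SmoothSections n F'' X →ₗ[ℂ] SmoothSections n F' W} (hA : IsDiffOp A)
    (hB : IsDiffOp B) : IsDiffOp (secPair A B) := by
  obtain ⟨m, hA⟩ := hA
  obtain ⟨k, hB⟩ := hB
  exact ⟨max m k, (hA.mono (le_max_left m k)).secPair (hB.mono (le_max_right m k))⟩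

end Algebra

end Basic

/-! ### Local Lorentzian geometry -/

section Geometry

open Filter Topology

variable {n : ℕ} {M : Type*} [TopologicalSpace M] [ChartedSpace (EuclideanSpace ℝ (Fin n)) M]
  [IsManifold (𝓡 n) ∞ M]

/-- The derivative of the inverse of the preferred chart at `i`. -/
def chartFrame (n : ℕ) {M : Type*} [TopologicalSpace M] [ChartedSpace (EuclideanSpace ℝ (Fin n)) M]
    (i : M) (z : EuclideanSpace ℝ (Fin n)) : EuclideanSpace ℝ (Fin n) →L[ℝ]
      TangentSpace (𝓡 n) ((chartAt (EuclideanSpace ℝ (Fin n)) i).symm z) :=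
  mfderiv 𝓘(ℝ, EuclideanSpace ℝ (Fin n)) (𝓡 n) (chartAt (EuclideanSpace ℝ (Fin n)) i).symm z

/-- This is the tangent map of the inverse chart in the trivialisation of the model tangent bundle.
Class `C⁰` suffices: it serves only to make metric coefficients continuous in base point and
vectors. -/
theorem contMDiffOn_chartFrame (i : M) {X : Type*} [NormedAddCommGroup X] [NormedSpace ℝ X]
    {z v : X → EuclideanSpace ℝ (Fin n)} {S : Set X} (hz : ContinuousOn z S)
    (hv : ContinuousOn v S) (hS : ∀ p ∈ S, z p ∈ (chartAt (EuclideanSpace ℝ (Fin n)) i).target) :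
    ContMDiffOn 𝓘(ℝ, X) ((𝓡 n).prod 𝓘(ℝ, EuclideanSpace ℝ (Fin n))) 0
      (fun p ↦ TotalSpace.mk' (EuclideanSpace ℝ (Fin n)) (E := fun x : M ↦ TangentSpace (𝓡 n) x)
        ((chartAt (EuclideanSpace ℝ (Fin n)) i).symm (z p)) (chartFrame n i (z p) (v p))) S := by
  unfold chartFrame
  set e := chartAt (EuclideanSpace ℝ (Fin n)) i
  have h1 : ContMDiffOn (𝓡 n) (𝓡 n) ∞ e.symm e.target := contMDiffOn_chart_symm
  have h2 := h1.continuousOn_tangentMapWithin (by simp) e.open_target.uniqueMDiffOn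
  rw [contMDiffOn_zero_iff]
  have h3 : ContinuousOn (fun p ↦ (tangentBundleModelSpaceHomeomorph (𝓡 n)).symm (z p, v p)) S :=
    (Homeomorph.continuous _).comp_continuousOn (hz.prodMk hv)
  refine (h2.comp h3 fun p hp ↦ hS p hp).congr fun p hp ↦ ?_
  have : mfderivWithin (𝓡 n) (𝓡 n) e.symm e.target (z p) = mfderiv (𝓡 n) (𝓡 n) e.symm (z p) :=
    mfderivWithin_of_isOpen e.open_target (hS p hp)
  simp [tangentMapWithin, Function.comp]
  rw [← this]
  rfl

theorem continuousOn_metric_apply (g : LorentzStructure n M) {X : Type*} [NormedAddCommGroup X]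
    [NormedSpace ℝ X] {S : Set X} {b : X → M} {v w : ∀ p, TangentSpace (𝓡 n) (b p)}
    (hb : ContinuousOn b S)
    (hv : ContMDiffOn 𝓘(ℝ, X) ((𝓡 n).prod 𝓘(ℝ, EuclideanSpace ℝ (Fin n))) 0
      (fun p ↦ TotalSpace.mk' (EuclideanSpace ℝ (Fin n)) (E := fun x : M ↦ TangentSpace (𝓡 n) x)
        (b p) (v p)) S)
    (hw : ContMDiffOn 𝓘(ℝ, X) ((𝓡 n).prod 𝓘(ℝ, EuclideanSpace ℝ (Fin n))) 0
      (fun p ↦ TotalSpace.mk' (EuclideanSpace ℝ (Fin n)) (E := fun x : M ↦ TangentSpace (𝓡 n) x)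
        (b p) (w p)) S) :
    ContinuousOn (fun p ↦ g.metric (b p) (v p) (w p)) S := by
  have h0 : ContMDiffOn 𝓘(ℝ, X) (𝓡 n) 0 b S := contMDiffOn_zero_iff.2 hb
  have h1 := ContMDiff.comp_contMDiffOn (g.metric_smooth.of_le (m := 0) (by simp)) h0
  have h2 := ContMDiffOn.clm_bundle_apply₂ (F₃ := ℝ) (E₃ := Bundle.Trivial M ℝ) (b := b)
    (ψ := fun p ↦ g.metric (b p)) h1 hv hw
  exact fun p hp ↦ ((contMDiffWithinAt_totalSpace.1 (h2 p hp)).2).continuousWithinAt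

theorem mdifferentiableAt_chart_symm (i : M) {z : EuclideanSpace ℝ (Fin n)}
    (hz : z ∈ (chartAt (EuclideanSpace ℝ (Fin n)) i).target) :
    MDifferentiableAt (𝓡 n) (𝓡 n) (chartAt (EuclideanSpace ℝ (Fin n)) i).symm z :=
  mdifferentiableAt_atlas_symm (I := 𝓡 n) (chart_mem_atlas _ i) hz

theorem chartFrame_bijective (i : M) {z : EuclideanSpace ℝ (Fin n)}
    (hz : z ∈ (chartAt (EuclideanSpace ℝ (Fin n)) i).target) :
    Function.Bijective (chartFrame n i z) := by
  have h := mdifferentiable_of_mem_atlas (I := 𝓡 n) (chart_mem_atlas (EuclideanSpace ℝ (Fin n)) i)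
  exact (h.symm.mfderiv hz).bijective

theorem causalStep_chart (g : LorentzStructure n M) (i : M) {z v : EuclideanSpace ℝ (Fin n)} {δ : ℝ}
    (hδ : 0 < δ)
    (h : ∀ t ∈ Set.Icc 0 δ, z + t • v ∈ (chartAt (EuclideanSpace ℝ (Fin n)) i).target ∧
      IsFutureCausal g _ (chartFrame n i (z + t • v) v)) :
    CausalStep g ((chartAt (EuclideanSpace ℝ (Fin n)) i).symm z)
      ((chartAt (EuclideanSpace ℝ (Fin n)) i).symm (z + δ • v)) := by
  set e := chartAt (EuclideanSpace ℝ (Fin n)) i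
  have hl : ∀ t : ℝ, HasDerivAt (fun t : ℝ ↦ z + t • v) v t := fun t ↦ by
    simpa using ((hasDerivAt_id t).smul_const v).const_add z
  refine ⟨fun t ↦ e.symm (z + t • v), 0, δ, hδ, ?_, by simp, rfl, fun t ht ↦ ?_⟩
  · have h1 : ContMDiffOn (𝓡 n) (𝓡 n) 1 e.symm e.target := contMDiffOn_chart_symm
    refine h1.comp (t := e.target) ?_ fun t ht ↦ (h t ht).1
    have : ContDiff ℝ 1 fun t : ℝ ↦ z + t • v := by fun_prop
    exact this.contMDiff.contMDiffOn
  · have h1 : HasMFDerivAt 𝓘(ℝ, ℝ) (𝓡 n) (fun t ↦ e.symm (z + t • v)) t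
        ((chartFrame n i (z + t • v)).comp (ContinuousLinearMap.toSpanSingleton ℝ v)) :=
      HasMFDerivAt.comp t (mdifferentiableAt_chart_symm i (h t ht).1).hasMFDerivAt
        (hl t).hasFDerivAt.hasMFDerivAt
    have h2 := h1.hasMFDerivWithinAt (s := Set.Icc 0 δ)
    rw [h2.mfderivWithin (uniqueDiffOn_Icc hδ t ht).uniqueMDiffWithinAt]
    change IsFutureCausal g _ (chartFrame n i (z + t • v) ((1 : ℝ) • v))
    rw [one_smul]
    exact (h t ht).2

/-- In a small ball of the chart at `x`, straight lines with velocity near a suitable vector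
are future causal curves. -/
theorem exists_ball_causalStep (g : LorentzStructure n M) (x : M) :
    ∃ T : EuclideanSpace ℝ (Fin n), ∃ ε > 0,
      Metric.ball (chartAt (EuclideanSpace ℝ (Fin n)) x x) ε ⊆
        (chartAt (EuclideanSpace ℝ (Fin n)) x).target ∧
      ∀ z ∈ Metric.ball (chartAt (EuclideanSpace ℝ (Fin n)) x x) ε, ∀ δ > (0 : ℝ),
        ∀ v ∈ Metric.ball T ε, z + δ • v ∈ Metric.ball (chartAt (EuclideanSpace ℝ (Fin n)) x x) ε →
          CausalStep g ((chartAt (EuclideanSpace ℝ (Fin n)) x).symm z)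
            ((chartAt (EuclideanSpace ℝ (Fin n)) x).symm (z + δ • v)) := by
  set e := chartAt (EuclideanSpace ℝ (Fin n)) x with he
  have hx : e x ∈ e.target := mem_chart_target _ x
  -- `T` is the coordinate expression at `x` of the time direction. Both inequalities defining
  -- future causal vectors are strict there, so they persist for base points and velocities near `(e
  -- x, T)`.
  obtain ⟨T, hT⟩ := (chartFrame_bijective x hx).2 (g.time (e.symm (e x)))
  let S : Set (EuclideanSpace ℝ (Fin n) × EuclideanSpace ℝ (Fin n)) := e.target ×ˢ Set.univ
  have hSo : IsOpen S := e.open_target.prod isOpen_univ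
  have hb : ContinuousOn (fun p : EuclideanSpace ℝ (Fin n) × EuclideanSpace ℝ (Fin n) ↦
      e.symm p.1) S := e.continuousOn_symm.comp continuousOn_fst fun p hp ↦ hp.1
  have hF := contMDiffOn_chartFrame x (S := S) continuousOn_fst continuousOn_snd fun p hp ↦ hp.1
  have hτ := (g.time_smooth.of_le (m := 0) (by simp)).comp_contMDiffOn
    (contMDiffOn_zero_iff (I := 𝓘(ℝ, EuclideanSpace ℝ (Fin n) × EuclideanSpace ℝ (Fin n)))
      (I' := 𝓡 n).2 hb)
  have h1 := continuousOn_metric_apply g hb hF hF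
  have h2 := continuousOn_metric_apply g hb hτ hF
  have hm : S ∈ 𝓝 (e x, T) := hSo.mem_nhds ⟨hx, trivial⟩
  have e1 := (h1.continuousAt hm).eventually_lt_const (u := 0)
    (by simpa [hT] using g.time_timelike _)
  have e2 := (h2.continuousAt hm).eventually_lt_const (u := 0)
    (by simpa [hT] using g.time_timelike _)
  obtain ⟨ε, hε, hball⟩ := Metric.eventually_nhds_iff_ball.1 ((e1.and e2).and hm)
  have key : ∀ z ∈ Metric.ball (e x) ε, ∀ v ∈ Metric.ball T ε,
      z ∈ e.target ∧ IsFutureCausal g _ (chartFrame n x z v) := by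
    intro z hz v hv
    obtain ⟨⟨k1, k2⟩, k3⟩ := hball (z, v) (by
      rw [← ball_prod_same]
      exact ⟨hz, hv⟩)
    -- A zero vector would contradict the strict inequality against the time field.
    refine ⟨k3.1, fun h0 ↦ ?_, k1.le, k2⟩
    simp only [h0, map_zero] at k2
    exact lt_irrefl _ k2
  refine ⟨T, ε, hε, fun z hz ↦ (key z hz T (Metric.mem_ball_self hε)).1,
    fun z hz δ hδ v hv hy ↦ ?_⟩
  refine causalStep_chart g x (z := z) (v := v) hδ fun t ht ↦ key (z + t • v) ?_ v hv
  -- The whole segment stays in the ball by convexity; `t / δ` rescales the parameter to `[0, 1]`.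
  have := (convex_ball (e x) ε).add_smul_sub_mem hz hy
    (t := t / δ) ⟨div_nonneg ht.1 hδ.le, (div_le_one hδ).2 ht.2⟩
  rwa [add_sub_cancel_left, smul_smul, div_mul_cancel₀ _ hδ.ne'] at this

/-- In the chart take `p = x - δ T` and `q = x + δ T`. A point `y` near `x` is joined to them by a
straight line with velocity `T ± (y - x) / δ`, close to `T` once `y` is close enough to `x`. This
replaces the usual openness of chronological futures. -/
theorem exists_causalLE_below (g : LorentzStructure n M) (x : M) {U : Set M} (hU : U ∈ 𝓝 x) :
    (∃ p ∈ U, ∀ᶠ y in 𝓝 x, CausalLE g p y) ∧ ∃ q ∈ U, ∀ᶠ y in 𝓝 x, CausalLE g y q := by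
  obtain ⟨T, ε, hε, hsub, h⟩ := exists_ball_causalStep g x
  set e := chartAt (EuclideanSpace ℝ (Fin n)) x with he
  have hx : e x ∈ e.target := mem_chart_target _ x
  have hxs : x ∈ e.source := mem_chart_source _ x
  have hc : Tendsto e.symm (𝓝 (e x)) (𝓝 x) := by
    simpa [e.left_inv hxs] using (e.continuousAt_symm hx).tendsto
  have hl : ∀ w : EuclideanSpace ℝ (Fin n),
      Tendsto (fun δ : ℝ ↦ e x + δ • w) (𝓝[>] 0) (𝓝 (e x)) := fun w ↦ by
    have : Continuous fun δ : ℝ ↦ e x + δ • w := by fun_prop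
    simpa using (this.tendsto 0).mono_left nhdsWithin_le_nhds
  have hbx : Metric.ball (e x) ε ∈ 𝓝 (e x) := Metric.ball_mem_nhds _ hε
  have hey : ∀ δ > (0 : ℝ), ∀ᶠ y in 𝓝 x, y ∈ e.source ∧ e y ∈ Metric.ball (e x) ε ∧
      ‖δ⁻¹ • (e y - e x)‖ < ε := by
    intro δ hδ
    have hec : Tendsto e (𝓝 x) (𝓝 (e x)) := e.continuousAt hxs
    have hcy : Continuous fun w : EuclideanSpace ℝ (Fin n) ↦ ‖δ⁻¹ • (w - e x)‖ := by fun_prop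
    have hlt : ∀ᶠ w in 𝓝 (e x), ‖δ⁻¹ • (w - e x)‖ < ε :=
      (hcy.tendsto (e x)).eventually_lt_const (by simpa using hε)
    filter_upwards [e.open_source.mem_nhds hxs, hec.eventually hbx,
      hec.eventually hlt] with y h1 h2 h3
    exact ⟨h1, h2, h3⟩
  constructor
  · obtain ⟨δ, ⟨h1, h2⟩, hδ⟩ := (((hl (-T)).eventually (hc.eventually hU)).and
      ((hl (-T)).eventually hbx)).and self_mem_nhdsWithin |>.exists
    refine ⟨_, h1, ?_⟩
    filter_upwards [hey δ hδ] with y ⟨hys, hyb, hyn⟩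
    have hδ0 : δ ≠ 0 := ne_of_gt hδ
    have heq : e x + δ • -T + δ • (T + δ⁻¹ • (e y - e x)) = e y := by
      rw [smul_add, smul_smul, mul_inv_cancel₀ hδ0, one_smul, smul_neg]
      abel
    have := h _ h2 δ hδ (T + δ⁻¹ • (e y - e x)) (by simpa using hyn) (by rwa [heq])
    rw [heq, e.left_inv hys] at this
    exact Relation.ReflTransGen.single this
  · obtain ⟨δ, ⟨h1, h2⟩, hδ⟩ := (((hl T).eventually (hc.eventually hU)).and
      ((hl T).eventually hbx)).and self_mem_nhdsWithin |>.exists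
    refine ⟨_, h1, ?_⟩
    filter_upwards [hey δ hδ] with y ⟨hys, hyb, hyn⟩
    have hδ0 : δ ≠ 0 := ne_of_gt hδ
    have heq : e y + δ • (T - δ⁻¹ • (e y - e x)) = e x + δ • T := by
      rw [smul_sub, smul_smul, mul_inv_cancel₀ hδ0, one_smul]
      abel
    have := h _ hyb δ hδ (T - δ⁻¹ • (e y - e x)) (by simpa [dist_eq_norm] using hyn) (by rwa [heq])
    rw [heq, e.left_inv hys] at this
    exact Relation.ReflTransGen.single this

end Geometry

/-! ### Globally hyperbolic causal relations -/

section CausalRelation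

open Filter Topology

variable {M : Type*} [TopologicalSpace M]

/-- The properties of the causal relation of a globally hyperbolic spacetime that are used below.
They are symmetric under time reversal. -/
structure IsCausalRelation (r : M → M → Prop) : Prop where
  refl : ∀ x, r x x
  trans : ∀ x y z, r x y → r y z → r x z
  below : ∀ x, ∀ U ∈ 𝓝 x, ∃ p ∈ U, ∀ᶠ y in 𝓝 x, r p y
  above : ∀ x, ∀ U ∈ 𝓝 x, ∃ q ∈ U, ∀ᶠ y in 𝓝 x, r y q
  isCompact_diamond : ∀ p q, IsCompact {y | r p y ∧ r y q}

/-- The set of successors of the points of `A`. -/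
def relFuture (r : M → M → Prop) (A : Set M) : Set M := {y | ∃ x ∈ A, r x y}

/-- The reversed relation. -/
def rev (r : M → M → Prop) : M → M → Prop := fun x y ↦ r y x

variable {r : M → M → Prop}

theorem relFuture_mono {A B : Set M} (h : A ⊆ B) : relFuture r A ⊆ relFuture r B :=
  fun _ ⟨x, hx, hxy⟩ ↦ ⟨x, h hx, hxy⟩

namespace IsCausalRelation

theorem rev (h : IsCausalRelation r) : IsCausalRelation (rev r) where
  refl := h.refl
  trans x y z hxy hyz := h.trans z y x hyz hxy
  below := h.above
  above := h.below
  isCompact_diamond p q := by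
    have := h.isCompact_diamond q p
    rwa [show {y | r q y ∧ r y p} = {y | GaugeBRST.rev r p y ∧ GaugeBRST.rev r y q} from
      Set.ext fun y ↦ and_comm] at this

theorem subset_relFuture (h : IsCausalRelation r) (A : Set M) : A ⊆ relFuture r A :=
  fun x hx ↦ ⟨x, hx, h.refl x⟩

theorem relFuture_relFuture (h : IsCausalRelation r) (A : Set M) :
    relFuture r (relFuture r A) ⊆ relFuture r A :=
  fun z ⟨y, ⟨x, hx, hxy⟩, hyz⟩ ↦ ⟨x, hx, h.trans x y z hxy hyz⟩

variable [T2Space M]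

/-- Near a limit point `y`, all points precede a single `q`, so the future of `p` agrees there with
a diamond, which is compact and hence closed. -/
theorem isClosed_future (h : IsCausalRelation r) (p : M) : IsClosed {y | r p y} := by
  refine isClosed_of_closure_subset fun y hy ↦ ?_
  obtain ⟨q, -, hq⟩ := h.above y Set.univ univ_mem
  have hf : ∃ᶠ z in 𝓝 y, z ∈ {z | r p z ∧ r z q} :=
    (mem_closure_iff_frequently.1 hy).and_eventually hq
  have := mem_closure_iff_frequently.2 hf
  rw [(h.isCompact_diamond p q).isClosed.closure_eq] at this
  exact this.1

/-- Let `z → y` along an ultrafilter, with sources in `C` converging to `x`. Any `p` below a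
neighbourhood of `x` eventually precedes the sources, hence `z`, hence `y` in the limit. Such `p`
exist arbitrarily near `x`, and the past of `y` is closed, so `x` precedes `y`. -/
theorem isClosed_relFuture (h : IsCausalRelation r) {C : Set M} (hC : IsCompact C) :
    IsClosed (relFuture r C) := by
  refine isClosed_of_closure_subset fun y hy ↦ ?_
  obtain ⟨u, hu, huy⟩ := mem_closure_iff_ultrafilter.1 hy
  have hex : ∀ z : M, ∃ x : M, z ∈ relFuture r C → x ∈ C ∧ r x z := fun z ↦ by
    by_cases hz : z ∈ relFuture r C
    · exact ⟨hz.choose, fun _ ↦ hz.choose_spec⟩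
    · exact ⟨z, fun h ↦ (hz h).elim⟩
  choose f hf using hex
  have hfC : f ⁻¹' C ∈ u := mem_of_superset hu fun z hz ↦ (hf z hz).1
  obtain ⟨x, hxC, hx⟩ := hC.ultrafilter_le_nhds (u.map f) (le_principal_iff.2 hfC)
  refine ⟨x, hxC, ?_⟩
  have hcl : IsClosed {p | r p y} := h.rev.isClosed_future y
  have hxy : x ∈ closure {p | r p y} := by
    refine mem_closure_iff_nhds.2 fun U hU ↦ ?_
    obtain ⟨p, hpU, hp⟩ := h.below x U hU
    have hpy : y ∈ closure {y | r p y} := by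
      refine mem_closure_iff_ultrafilter.2 ⟨u, ?_, huy⟩
      have h1 : ∀ᶠ z in (u : Filter M), r p (f z) := hx hp
      filter_upwards [h1, hu] with z hz hzu
      exact h.trans _ _ _ hz (hf z hzu).2
    rw [(h.isClosed_future p).closure_eq] at hpy
    exact ⟨p, hpU, hpy⟩
  rwa [hcl.closure_eq] at hxy

theorem exists_finite_below (h : IsCausalRelation r) {C : Set M} (hC : IsCompact C) :
    ∃ T : Finset M, ∀ᶠ x in 𝓝ˢ C, x ∈ relFuture r (T : Set M) := by
  choose p _ hp using fun x ↦ h.below x Set.univ univ_mem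
  obtain ⟨T, -, hT⟩ := hC.elim_nhds_subcover (fun x ↦ interior {y | r (p x) y})
    fun x _ ↦ isOpen_interior.mem_nhds (mem_interior_iff_mem_nhds.2 (hp x))
  classical
  refine ⟨T.image p, mem_of_superset
    ((isOpen_biUnion fun x _ ↦ isOpen_interior).mem_nhdsSet.2 hT) fun y hy ↦ ?_⟩
  obtain ⟨x, hx, hy⟩ := Set.mem_iUnion₂.1 hy
  exact ⟨p x, by simpa using ⟨x, hx, rfl⟩, interior_subset hy⟩

/-- Cover `C` from below and `C'` from above by finitely many points; the closed intersection then
lies in a finite union of diamonds. -/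
theorem isCompact_inter (h : IsCausalRelation r) {C C' : Set M} (hC : IsCompact C)
    (hC' : IsCompact C') : IsCompact (relFuture r C ∩ relFuture (GaugeBRST.rev r) C') := by
  obtain ⟨T, hT⟩ := h.exists_finite_below hC
  obtain ⟨T', hT'⟩ := h.rev.exists_finite_below hC'
  refine (T.isCompact_biUnion (f := fun p ↦ ⋃ q ∈ T', {y | r p y ∧ r y q}) fun p _ ↦
    T'.isCompact_biUnion fun q _ ↦ h.isCompact_diamond p q).of_isClosed_subset
    ((h.isClosed_relFuture hC).inter (h.rev.isClosed_relFuture hC')) ?_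
  rintro y ⟨⟨x, hx, hxy⟩, x', hx', hxy'⟩
  obtain ⟨p, hp, hpx⟩ := hT.self_of_nhdsSet x hx
  obtain ⟨q, hq, hqx⟩ := hT'.self_of_nhdsSet x' hx'
  simp only [Set.mem_iUnion]
  exact ⟨p, hp, q, hq, h.trans _ _ _ hpx hxy, h.trans _ _ _ hxy' hqx⟩

end IsCausalRelation

variable {n : ℕ} [ChartedSpace (EuclideanSpace ℝ (Fin n)) M] [IsManifold (𝓡 n) ∞ M]

theorem GloballyHyperbolic.isCausalRelation {g : LorentzStructure n M} (hg : GloballyHyperbolic g) :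
    IsCausalRelation (CausalLE g) where
  refl _ := Relation.ReflTransGen.refl
  trans _ _ _ := Relation.ReflTransGen.trans
  below x _ hU := (exists_causalLE_below g x hU).1
  above x _ hU := (exists_causalLE_below g x hU).2
  isCompact_diamond p q := by
    simpa [causalFuture, causalPast, Set.inter_def] using hg.isCompact_diamond p q

end CausalRelation

/-! ### The volume measure -/

section Volume

open Filter Topology

variable {n : ℕ} {M : Type*} [TopologicalSpace M] [ChartedSpace (EuclideanSpace ℝ (Fin n)) M]
  [IsManifold (𝓡 n) ∞ M]

theorem continuousOn_chartDensity (g : LorentzStructure n M) (i : M) :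
    ContinuousOn (chartDensity g (chartAt (EuclideanSpace ℝ (Fin n)) i))
      (chartAt (EuclideanSpace ℝ (Fin n)) i).target := by
  set e := chartAt (EuclideanSpace ℝ (Fin n)) i
  have hm : ContinuousOn (fun y ↦ Matrix.of fun k l : Fin n ↦ g.metric (e.symm y)
      (chartFrame n i y (EuclideanSpace.single k (1 : ℝ)))
      (chartFrame n i y (EuclideanSpace.single l (1 : ℝ)))) e.target := by
    refine continuousOn_pi.2 fun k ↦ continuousOn_pi.2 fun l ↦ ?_
    exact continuousOn_metric_apply g e.continuousOn_symm
      (contMDiffOn_chartFrame i continuousOn_id continuousOn_const fun p hp ↦ hp)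
      (contMDiffOn_chartFrame i continuousOn_id continuousOn_const fun p hp ↦ hp)
  have hd : Continuous fun A : Matrix (Fin n) (Fin n) ℝ ↦ √|A.det| :=
    Real.continuous_sqrt.comp (continuous_id.matrix_det.abs)
  exact hd.comp_continuousOn hm

/-- Testing against the time vector puts `v` in the complement where the metric is positive; then
test `v` against itself. -/
theorem LorentzStructure.eq_zero_of_metric (g : LorentzStructure n M) {x : M}
    {v : TangentSpace (𝓡 n) x} (h : ∀ w, g.metric x w v = 0) : v = 0 := by
  by_contra hv
  exact (g.metric_pos x v hv (h _)).ne' (h v)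

/-- A kernel vector of the Gram matrix would give a combination of the frame orthogonal to the whole
tangent space, hence zero, contradicting linear independence of the frame. -/
theorem chartDensity_pos (g : LorentzStructure n M) (i : M) {y : EuclideanSpace ℝ (Fin n)}
    (hy : y ∈ (chartAt (EuclideanSpace ℝ (Fin n)) i).target) :
    0 < chartDensity g (chartAt (EuclideanSpace ℝ (Fin n)) i) y := by
  refine Real.sqrt_pos.2 (abs_pos.2 fun hdet ↦ ?_)
  obtain ⟨c, hc, h0⟩ := Matrix.exists_mulVec_eq_zero_iff.2 hdet
  have hb := chartFrame_bijective i hy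
  let v : EuclideanSpace ℝ (Fin n) := ∑ l, c l • EuclideanSpace.single l (1 : ℝ)
  have hv : chartFrame n i y v = 0 := by
    refine g.eq_zero_of_metric fun w ↦ ?_
    obtain ⟨u, rfl⟩ := hb.2 w
    have hu : u = ∑ k, u k • EuclideanSpace.single k (1 : ℝ) := by
      ext j
      simp [Pi.single_apply]
    have h1 : ∀ k, g.metric _ (chartFrame n i y (EuclideanSpace.single k (1 : ℝ)))
        (chartFrame n i y v) = 0 := fun k ↦ by
      have := congrFun h0 k
      simp only [Matrix.mulVec, dotProduct, Matrix.of_apply, Pi.zero_apply] at this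
      rw [← this]
      simp only [v, map_sum, map_smul, smul_eq_mul]
      exact Finset.sum_congr rfl fun l _ ↦ mul_comm _ _
    rw [hu, map_sum, map_sum, sum_apply]
    refine Finset.sum_eq_zero fun k _ ↦ ?_
    rw [map_smul, map_smul, smul_apply, h1 k, smul_zero]
  have hv0 : v = 0 := hb.1 (by rw [hv, map_zero])
  refine hc (funext fun l ↦ ?_)
  have := congrArg (fun w : EuclideanSpace ℝ (Fin n) ↦ w l) hv0
  simpa [v, Pi.single_apply] using this

variable [MeasurableSpace M] [BorelSpace M]

theorem aemeasurable_chart_symm (g : LorentzStructure n M) (i : M) :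
    AEMeasurable (chartAt (EuclideanSpace ℝ (Fin n)) i).symm
      (((volume : Measure (EuclideanSpace ℝ (Fin n))).restrict
        (chartAt (EuclideanSpace ℝ (Fin n)) i).target).withDensity
        fun y ↦ ENNReal.ofReal (chartDensity g (chartAt (EuclideanSpace ℝ (Fin n)) i) y)) :=
  ((chartAt (EuclideanSpace ℝ (Fin n)) i).continuousOn_symm.aemeasurable
    (chartAt (EuclideanSpace ℝ (Fin n)) i).open_target.measurableSet).mono_ac
    (withDensity_absolutelyContinuous _ _)

theorem aemeasurable_chartDensity (g : LorentzStructure n M) (i : M) :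
    AEMeasurable (fun y ↦ ENNReal.ofReal (chartDensity g (chartAt (EuclideanSpace ℝ (Fin n)) i) y))
      ((volume : Measure (EuclideanSpace ℝ (Fin n))).restrict
        (chartAt (EuclideanSpace ℝ (Fin n)) i).target) :=
  ((continuousOn_chartDensity g i).aemeasurable
    (chartAt (EuclideanSpace ℝ (Fin n)) i).open_target.measurableSet).ennreal_ofReal

theorem chartMeasure_lt_top [T2Space M] (g : LorentzStructure n M) (i : M) {C : Set M}
    (hC : IsCompact C) (hCi : C ⊆ (chartAt (EuclideanSpace ℝ (Fin n)) i).source) :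
    chartMeasure g (chartAt (EuclideanSpace ℝ (Fin n)) i) C < ⊤ := by
  have haem := aemeasurable_chart_symm g i
  have hdc := continuousOn_chartDensity g i
  unfold chartMeasure
  set e := chartAt (EuclideanSpace ℝ (Fin n)) i
  have hCm := hC.isClosed.measurableSet
  have hcomp : IsCompact (e '' C) := hC.image_of_continuousOn (e.continuousOn.mono hCi)
  have hsub : e '' C ⊆ e.target := by
    rintro _ ⟨x, hx, rfl⟩
    exact e.map_source (hCi hx)
  have hset : e.target ∩ e.symm ⁻¹' C = e '' C := by
    ext y
    constructor
    · rintro ⟨h1, h2⟩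
      exact ⟨e.symm y, h2, e.right_inv h1⟩
    · rintro ⟨x, hx, rfl⟩
      exact ⟨e.map_source (hCi hx), by simpa [e.left_inv (hCi hx)] using hx⟩
  obtain ⟨c, hc⟩ := hcomp.exists_bound_of_continuousOn (hdc.mono hsub)
  rw [Measure.map_apply_of_aemeasurable haem hCm]
  -- Restricting after inserting the density turns the preimage of `C`, which is only
  -- null-measurable, into the honest compact set `e '' C`.
  rw [← restrict_withDensity e.open_target.measurableSet]
  have hms : MeasurableSet (e '' C) := hcomp.isClosed.measurableSet
  have hnull : NullMeasurableSet (e.symm ⁻¹' C) ((volume.withDensity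
      fun y ↦ ENNReal.ofReal (chartDensity g e y)).restrict e.target) := by
    rw [restrict_withDensity e.open_target.measurableSet]
    exact haem.nullMeasurableSet_preimage hCm
  rw [Measure.restrict_apply₀ hnull, Set.inter_comm, hset, withDensity_apply _ hms]
  calc ∫⁻ y in e '' C, ENNReal.ofReal (chartDensity g e y)
      ≤ ∫⁻ _ in e '' C, ENNReal.ofReal c := by
        refine setLIntegral_mono' hms fun y hy ↦ ENNReal.ofReal_le_ofReal ?_
        exact (le_abs_self _).trans (hc y hy)
    _ < ⊤ := by
        rw [setLIntegral_const]
        exact ENNReal.mul_lt_top ENNReal.ofReal_lt_top hcomp.measure_lt_top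

theorem chartMeasure_pos (g : LorentzStructure n M) (i : M) {U : Set M}
    (hU : IsOpen U) {x : M} (hx : x ∈ U) (hxi : x ∈ (chartAt (EuclideanSpace ℝ (Fin n)) i).source) :
    chartMeasure g (chartAt (EuclideanSpace ℝ (Fin n)) i) U ≠ 0 := by
  have haem := aemeasurable_chart_symm g i
  have hdm := aemeasurable_chartDensity g i
  have hpos := fun y ↦ chartDensity_pos g i (y := y)
  unfold chartMeasure
  set e := chartAt (EuclideanSpace ℝ (Fin n)) i
  rw [Measure.map_apply_of_aemeasurable haem hU.measurableSet, Ne, withDensity_apply_eq_zero' hdm]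
  intro h
  have hO : IsOpen (e.target ∩ e.symm ⁻¹' U) := e.isOpen_inter_preimage_symm hU
  have h1 : volume (e.target ∩ e.symm ⁻¹' U) = 0 := by
    have := measure_mono_null (t := {y | ENNReal.ofReal (chartDensity g e y) ≠ 0} ∩ e.symm ⁻¹' U)
      (s := e.target ∩ e.symm ⁻¹' U) (fun y hy ↦ ⟨by simpa using hpos y hy.1, hy.2⟩) h
    rwa [Measure.restrict_apply hO.measurableSet, Set.inter_eq_left.2 Set.inter_subset_left] at this
  exact (hO.measure_pos volume ⟨e x, e.map_source hxi, by simpa [e.left_inv hxi] using hx⟩).ne' h1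

variable [T2Space M] [SigmaCompactSpace M]

theorem chartPartition_isSubordinate (i : M) :
    tsupport (chartPartition n M i) ⊆ (chartAt (EuclideanSpace ℝ (Fin n)) i).source :=
  Classical.choose_spec (SmoothPartitionOfUnity.exists_isSubordinate_chartAt_source (𝓡 n) M) i

/-- A compact set meets the support of finitely many partition functions, each at most `1` and
supported inside its chart. Continuous compactly supported integrands are therefore integrable. -/
instance isFiniteMeasureOnCompacts_volumeMeasure (g : LorentzStructure n M) :
    IsFiniteMeasureOnCompacts (volumeMeasure g) where
  lt_top_of_isCompact C hC := by
    classical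
    have hCm := hC.isClosed.measurableSet
    have hfin := (chartPartition n M).locallyFinite.finite_nonempty_inter_compact hC
    rw [volumeMeasure, Measure.sum_apply _ hCm, tsum_eq_sum (s := hfin.toFinset)]
    · refine ENNReal.sum_lt_top.2 fun i _ ↦ ?_
      rw [withDensity_apply _ hCm]
      have hK : IsCompact (C ∩ tsupport (chartPartition n M i)) :=
        hC.inter_right (isClosed_tsupport _)
      refine lt_of_le_of_lt ?_ (chartMeasure_lt_top g i hK
        (Set.inter_subset_right.trans (chartPartition_isSubordinate i)))
      rw [← setLIntegral_one, ← lintegral_indicator hCm, ← lintegral_indicator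
        hK.isClosed.measurableSet]
      refine lintegral_mono fun x ↦ ?_
      by_cases hx : x ∈ C
      · by_cases hx' : x ∈ tsupport (chartPartition n M i)
        · rw [Set.indicator_of_mem hx,
            Set.indicator_of_mem (Set.mem_inter hx hx')]
          exact ENNReal.ofReal_le_one.2 ((chartPartition n M).le_one i x)
        · simp [Set.indicator_of_mem hx, image_eq_zero_of_notMem_tsupport hx']
      · simp [Set.indicator_of_notMem hx]
    · intro i hi
      rw [withDensity_apply _ hCm]
      refine (setLIntegral_congr_fun hCm fun x hx ↦ ?_).trans lintegral_zero
      by_contra h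
      exact hi (hfin.mem_toFinset.2
        (show Set.Nonempty _ from ⟨x, fun h0 ↦ h (by simp [h0]), hx⟩))

/-- Some partition function is positive at `x`, hence on an open neighbourhood, to which its chart
measure gives positive mass. This underlies non-degeneracy of the pairing. -/
instance isOpenPosMeasure_volumeMeasure (g : LorentzStructure n M) :
    (volumeMeasure g).IsOpenPosMeasure where
  open_pos U hU := by
    rintro ⟨x, hx⟩ h
    obtain ⟨i, hi⟩ := (chartPartition n M).exists_pos_of_mem (Set.mem_univ x)
    rw [volumeMeasure, Measure.sum_apply _ hU.measurableSet, ENNReal.tsum_eq_zero] at h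
    have hc : Continuous (chartPartition n M i) := (chartPartition n M i).contMDiff.continuous
    have hm : Measurable fun x ↦ ENNReal.ofReal (chartPartition n M i x) :=
      hc.measurable.ennreal_ofReal
    have h1 := (withDensity_apply_eq_zero hm).1 (h i)
    refine chartMeasure_pos g i ((isOpen_lt continuous_const hc).inter hU) (x := x) ⟨hi, hx⟩
      (chartPartition_isSubordinate i (subset_tsupport _ hi.ne')) (measure_mono_null ?_ h1)
    exact fun y hy ↦ ⟨by simpa using hy.1, hy.2⟩

end Volume

/-! ### The pairing of sections and formal adjoints -/

section Pairing

open Filter Topology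

variable {n : ℕ} {M : Type*} [TopologicalSpace M] [ChartedSpace (EuclideanSpace ℝ (Fin n)) M]
  {F : Type*} [NormedAddCommGroup F] [NormedSpace ℂ F]
  {V : M → Type*} [TopologicalSpace (TotalSpace F V)] [∀ x, AddCommGroup (V x)]
  [∀ x, Module ℂ (V x)] [∀ x, TopologicalSpace (V x)] [FiberBundle F V] [VectorBundle ℂ F V]
  {F' : Type*} [NormedAddCommGroup F'] [NormedSpace ℂ F']
  {W : M → Type*} [TopologicalSpace (TotalSpace F' W)] [∀ x, AddCommGroup (W x)]
  [∀ x, Module ℂ (W x)] [∀ x, TopologicalSpace (W x)] [FiberBundle F' W] [VectorBundle ℂ F' W]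
  {F'' : Type*} [NormedAddCommGroup F''] [NormedSpace ℂ F'']
  {X : M → Type*} [TopologicalSpace (TotalSpace F'' X)] [∀ x, AddCommGroup (X x)]
  [∀ x, Module ℂ (X x)] [∀ x, TopologicalSpace (X x)] [FiberBundle F'' X] [VectorBundle ℂ F'' X]
  [IsManifold (𝓡 n) ∞ M] [T2Space M] [SigmaCompactSpace M] [MeasurableSpace M] [BorelSpace M]
  {g : LorentzStructure n M} {hV : FiberForm V} {hW : FiberForm W} {hX : FiberForm X}

theorem IsHermitianStructure.continuous (h : IsHermitianStructure n F hV)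
    (u v : SmoothSections n F V) : Continuous fun x ↦ hV x (u.1 x) (v.1 x) :=
  (h.smooth u v).continuous

/-- Only the intersection of the supports has to be compact, so that a section with support in a
future can be paired with one supported in a past. -/
theorem IsHermitianStructure.hasCompactSupport (hV : FiberForm V) {u v : SmoothSections n F V}
    (huv : IsCompact (secSupport u ∩ secSupport v)) :
    HasCompactSupport fun x ↦ hV x (u.1 x) (v.1 x) := by
  refine huv.of_isClosed_subset (isClosed_tsupport _)
    (closure_minimal (fun x hx ↦ ⟨mem_secSupport_of_ne fun h ↦ hx ?_,
      mem_secSupport_of_ne fun h ↦ hx ?_⟩) huv.isClosed)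
  · simp [h]
  · simp [h]

theorem IsHermitianStructure.integrable (h : IsHermitianStructure n F hV)
    (g : LorentzStructure n M) {u v : SmoothSections n F V}
    (huv : IsCompact (secSupport u ∩ secSupport v)) :
    Integrable (fun x ↦ hV x (u.1 x) (v.1 x)) (volumeMeasure g) :=
  (h.continuous u v).integrable_of_hasCompactSupport
    (IsHermitianStructure.hasCompactSupport hV huv)

theorem isCompact_inter_left {u : SmoothSections n F V} (hu : u ∈ CompactSections n F V)
    (v : SmoothSections n F' W) : IsCompact (secSupport u ∩ secSupport v) :=
  IsCompact.inter_right hu (isClosed_secSupport v)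

theorem isCompact_inter_right (u : SmoothSections n F V) {v : SmoothSections n F' W}
    (hv : v ∈ CompactSections n F' W) : IsCompact (secSupport u ∩ secSupport v) :=
  IsCompact.inter_left hv (isClosed_secSupport u)

theorem pairing_add_right (h : IsHermitianStructure n F hV) {u v w : SmoothSections n F V}
    (huv : IsCompact (secSupport u ∩ secSupport v))
    (huw : IsCompact (secSupport u ∩ secSupport w)) :
    pairing g hV u (v + w) = pairing g hV u v + pairing g hV u w := by
  simp only [pairing, coe_add_section, map_add]
  exact integral_add (h.integrable g huv) (h.integrable g huw)

theorem pairing_add_left (h : IsHermitianStructure n F hV) {u v w : SmoothSections n F V}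
    (huw : IsCompact (secSupport u ∩ secSupport w))
    (hvw : IsCompact (secSupport v ∩ secSupport w)) :
    pairing g hV (u + v) w = pairing g hV u w + pairing g hV v w := by
  simp only [pairing, coe_add_section, map_add, LinearMap.add_apply]
  exact integral_add (h.integrable g huw) (h.integrable g hvw)

theorem pairing_smul_right (c : ℂ) (u v : SmoothSections n F V) :
    pairing g hV u (c • v) = c * pairing g hV u v := by
  simp only [pairing, coe_smul_section, map_smul, smul_eq_mul]
  exact integral_const_mul _ _

theorem pairing_smul_left (c : ℂ) (u v : SmoothSections n F V) :
    pairing g hV (c • u) v = conj c * pairing g hV u v := by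
  simp only [pairing, coe_smul_section, map_smulₛₗ, LinearMap.smul_apply, smul_eq_mul]
  exact integral_const_mul _ _

@[simp] theorem pairing_zero_right (u : SmoothSections n F V) : pairing g hV u 0 = 0 := by
  simp [pairing]

@[simp] theorem pairing_zero_left (u : SmoothSections n F V) : pairing g hV 0 u = 0 := by
  simp [pairing]

theorem pairing_sub_right (h : IsHermitianStructure n F hV) {u v w : SmoothSections n F V}
    (huv : IsCompact (secSupport u ∩ secSupport v))
    (huw : IsCompact (secSupport u ∩ secSupport w)) :
    pairing g hV u (v - w) = pairing g hV u v - pairing g hV u w := by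
  simp only [pairing, coe_sub_section, map_sub]
  exact integral_sub (h.integrable g huv) (h.integrable g huw)

theorem pairing_conj (h : IsHermitianStructure n F hV) (u v : SmoothSections n F V) :
    conj (pairing g hV u v) = pairing g hV v u := by
  rw [pairing, ← integral_conj]
  exact integral_congr_ae (ae_of_all _ fun x ↦ (h.hermitian x _ _).symm)

theorem pairing_congr {u u' v v' : SmoothSections n F V}
    (h : ∀ x, hV x (u.1 x) (v.1 x) = hV x (u'.1 x) (v'.1 x)) :
    pairing g hV u v = pairing g hV u' v' := by
  simp only [pairing, h]

/-- The pairing is non-degenerate. -/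
theorem eq_zero_of_pairing [∀ x, Module ℝ (V x)] [VectorBundle ℝ F V]
    [ContMDiffVectorBundle ∞ F V (𝓡 n)] (h : IsHermitianStructure n F hV)
    {w : SmoothSections n F V} (hw : ∀ u ∈ CompactSections n F V, pairing g hV u w = 0) :
    w = 0 := by
  ext x
  by_contra hx
  obtain ⟨v, hv⟩ : ∃ v, hV x (w.1 x) v ≠ 0 := by
    by_contra! h0
    exact hx (h.nondegenerate x _ h0)
  obtain ⟨s, hs, rfl⟩ := exists_compactSection_eq (n := n) F x v
  -- Weighting the test section by `φ` itself turns the integrand into `|φ|²`, because the form is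
  -- antilinear in the first slot. This gives positivity even though the fibre form may be
  -- indefinite.
  let φ : M → ℂ := fun y ↦ hV y (s.1 y) (w.1 y)
  have hφ : ContMDiff (𝓡 n) 𝓘(ℝ, ℂ) ∞ φ := h.smooth s w
  have hφx : φ x ≠ 0 := fun h0 ↦ hv (by
    rw [h.hermitian]
    exact (map_eq_zero _).2 h0)
  have key := hw (mulSection φ hφ s)
    (mem_compactSections_of_subset hs (secSupport_mulSection_right φ hφ s))
  have hint : pairing g hV (mulSection φ hφ s) w =
      ((∫ y, Complex.normSq (φ y) ∂(volumeMeasure g) : ℝ) : ℂ) := by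
    refine (integral_congr_ae (ae_of_all _ fun y ↦ ?_)).trans integral_complex_ofReal
    change hV y (φ y • s.1 y) (w.1 y) = _
    rw [map_smulₛₗ, Complex.normSq_eq_conj_mul_self]
    rfl
  rw [hint, Complex.ofReal_eq_zero] at key
  have hc : Continuous fun y ↦ Complex.normSq (φ y) :=
    Complex.continuous_normSq.comp hφ.continuous
  have hcs : HasCompactSupport fun y ↦ Complex.normSq (φ y) :=
    (IsHermitianStructure.hasCompactSupport hV (isCompact_inter_left hs w)).comp_left
      (map_zero Complex.normSq)
  exact (hc.integral_pos_of_hasCompactSupport_nonneg_nonzero hcs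
    (fun y ↦ Complex.normSq_nonneg _) (x := x) (by simpa using hφx)).ne' key

theorem eq_of_pairing [∀ x, Module ℝ (V x)] [VectorBundle ℝ F V]
    [ContMDiffVectorBundle ∞ F V (𝓡 n)] (h : IsHermitianStructure n F hV)
    {v w : SmoothSections n F V}
    (hw : ∀ u ∈ CompactSections n F V, pairing g hV u v = pairing g hV u w) :
    v = w := by
  refine sub_eq_zero.1 (eq_zero_of_pairing (g := g) h fun u hu ↦ ?_)
  rw [pairing_sub_right h (isCompact_inter_left hu v) (isCompact_inter_left hu w), hw u hu, sub_self]

/-- The cutoff is `1` near `C`, so germs agree there and differential operators cannot distinguish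
the two sections on `C`. -/
theorem exists_compact_eventuallyEq {C : Set M} (hC : IsCompact C) (s : SmoothSections n F V) :
    ∃ t ∈ CompactSections n F V, (∀ x ∈ C, ∀ᶠ y in 𝓝 x, t.1 y = s.1 y) ∧
      secSupport t ⊆ secSupport s := by
  obtain ⟨χ, hχ, h1, hc, -⟩ := exists_complex_cutoff (n := n) hC isOpen_univ (Set.subset_univ _)
  refine ⟨mulSection χ hχ s,
    mem_compactSections_of_subset hc (secSupport_mulSection_left χ hχ s), fun x hx ↦ ?_,
    secSupport_mulSection_right χ hχ s⟩
  filter_upwards [h1 x hx] with y hy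
  simp [hy]

/-- Differential operators that agree on compactly supported sections are equal. -/
theorem IsDiffOp.ext_compact {A B : SmoothSections n F V →ₗ[ℂ] SmoothSections n F' W}
    (hA : IsDiffOp A) (hB : IsDiffOp B) (h : ∀ u ∈ CompactSections n F V, A u = B u) : A = B := by
  ext u x
  obtain ⟨t, ht, htu, -⟩ := exists_compact_eventuallyEq (isCompact_singleton (x := x)) u
  rw [← hA.apply_congr (htu x rfl), ← hB.apply_congr (htu x rfl), h t ht]

namespace IsFormalAdjoint

variable {A A' : SmoothSections n F V →ₗ[ℂ] SmoothSections n F' W}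
  {B B' : SmoothSections n F' W →ₗ[ℂ] SmoothSections n F V}

/-- Integration by parts beyond test sections: cut both off around their common support. Off that
set both integrands vanish because differential operators do not enlarge supports. -/
theorem pairing_eq (hAB : IsFormalAdjoint g hV hW A B) (hA : IsDiffOp A) (hB : IsDiffOp B)
    {u : SmoothSections n F V} {v : SmoothSections n F' W}
    (huv : IsCompact (secSupport u ∩ secSupport v)) :
    pairing g hW (A u) v = pairing g hV u (B v) := by
  obtain ⟨u', hu', hu, hsu⟩ := exists_compact_eventuallyEq huv u
  obtain ⟨v', hv', hv, hsv⟩ := exists_compact_eventuallyEq huv v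
  have h1 : pairing g hW (A u) v = pairing g hW (A u') v' := by
    refine pairing_congr fun x ↦ ?_
    by_cases hx : x ∈ secSupport u
    · by_cases hx' : x ∈ secSupport v
      · rw [hA.apply_congr (hu x ⟨hx, hx'⟩), (hv x ⟨hx, hx'⟩).self_of_nhds]
      · rw [eq_zero_of_notMem_secSupport hx', eq_zero_of_notMem_secSupport fun h ↦ hx' (hsv h),
          map_zero, map_zero]
    · rw [eq_zero_of_notMem_secSupport fun h ↦ hx (hA.secSupport_apply u h),
        eq_zero_of_notMem_secSupport fun h ↦ hx (hsu (hA.secSupport_apply u' h)), map_zero]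
      rfl
  have h2 : pairing g hV u (B v) = pairing g hV u' (B v') := by
    refine pairing_congr fun x ↦ ?_
    by_cases hx : x ∈ secSupport v
    · by_cases hx' : x ∈ secSupport u
      · rw [hB.apply_congr (hv x ⟨hx', hx⟩), (hu x ⟨hx', hx⟩).self_of_nhds]
      · rw [eq_zero_of_notMem_secSupport hx', eq_zero_of_notMem_secSupport fun h ↦ hx' (hsu h),
          map_zero]
        rfl
    · rw [eq_zero_of_notMem_secSupport fun h ↦ hx (hB.secSupport_apply v h),
        eq_zero_of_notMem_secSupport fun h ↦ hx (hsv (hB.secSupport_apply v' h)),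
        map_zero, map_zero]
  rw [h1, h2, hAB u' hu' v' hv']

theorem symm (hAB : IsFormalAdjoint g hV hW A B) (hhV : IsHermitianStructure n F hV)
    (hhW : IsHermitianStructure n F' hW) : IsFormalAdjoint g hW hV B A := fun u hu v hv ↦ by
  rw [← pairing_conj hhV, ← hAB v hv u hu, pairing_conj hhW]

theorem comp {C : SmoothSections n F' W →ₗ[ℂ] SmoothSections n F'' X}
    {D : SmoothSections n F'' X →ₗ[ℂ] SmoothSections n F' W}
    (hCD : IsFormalAdjoint g hW hX C D) (hAB : IsFormalAdjoint g hV hW A B)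
    (hA : IsDiffOp A) (hD : IsDiffOp D) :
    IsFormalAdjoint g hV hX (C ∘ₗ A) (B ∘ₗ D) := fun u hu v hv ↦
  (hCD (A u) (hA.mem_compactSections hu) v hv).trans
    (hAB u hu (D v) (hD.mem_compactSections hv))

theorem add (hAB : IsFormalAdjoint g hV hW A B) (hAB' : IsFormalAdjoint g hV hW A' B')
    (hhV : IsHermitianStructure n F hV) (hhW : IsHermitianStructure n F' hW) :
    IsFormalAdjoint g hV hW (A + A') (B + B') := fun u hu v hv ↦ by
  rw [LinearMap.add_apply, LinearMap.add_apply,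
    pairing_add_left hhW (isCompact_inter_right _ hv) (isCompact_inter_right _ hv),
    pairing_add_right hhV (isCompact_inter_left hu _) (isCompact_inter_left hu _),
    hAB u hu v hv, hAB' u hu v hv]

/-- Non-degeneracy gives equality on test sections, and locality extends it to all sections. This
identifies the adjoint selected by choice with any explicit candidate. -/
theorem unique [∀ x, Module ℝ (V x)] [VectorBundle ℝ F V]
    [ContMDiffVectorBundle ∞ F V (𝓡 n)] (hhV : IsHermitianStructure n F hV)
    (h : IsFormalAdjoint g hV hW A B) (h' : IsFormalAdjoint g hV hW A B')
    (hB : IsDiffOp B) (hB' : IsDiffOp B') : B = B' :=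
  hB.ext_compact hB' fun v hv ↦ eq_of_pairing (g := g) hhV fun u hu ↦
    (h u hu v hv).symm.trans (h' u hu v hv)

theorem formalAdjoint_eq [∀ x, Module ℝ (V x)] [VectorBundle ℝ F V]
    [ContMDiffVectorBundle ∞ F V (𝓡 n)] (hhV : IsHermitianStructure n F hV)
    (h : IsFormalAdjoint g hV hW A B) (hB : IsDiffOp B) : formalAdjoint g hV hW A = B := by
  have H : ∃ B, IsDiffOp B ∧ IsFormalAdjoint g hV hW A B := ⟨B, hB, h⟩
  rw [formalAdjoint, dif_pos H]
  exact unique hhV (Classical.choose_spec H).2 h (Classical.choose_spec H).1 hB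

end IsFormalAdjoint

/-- A formal adjoint that is not the default value zero has the defining properties. -/
theorem formalAdjoint_spec {A : SmoothSections n F V →ₗ[ℂ] SmoothSections n F' W}
    (h : formalAdjoint g hV hW A ≠ 0) : IsDiffOp (formalAdjoint g hV hW A) ∧
      IsFormalAdjoint g hV hW A (formalAdjoint g hV hW A) := by
  have H : ∃ B, IsDiffOp B ∧ IsFormalAdjoint g hV hW A B := by
    by_contra H
    exact h (dif_neg H)
  rw [formalAdjoint, dif_pos H]
  exact Classical.choose_spec H

end Pairing

/-! ### Propagators -/

section Propagators

open Filter Topology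

variable {n : ℕ} {M : Type*} [TopologicalSpace M] [ChartedSpace (EuclideanSpace ℝ (Fin n)) M]
  {F : Type*} [NormedAddCommGroup F] [NormedSpace ℂ F]
  {V : M → Type*} [TopologicalSpace (TotalSpace F V)] [∀ x, AddCommGroup (V x)]
  [∀ x, Module ℂ (V x)] [∀ x, TopologicalSpace (V x)] [FiberBundle F V] [VectorBundle ℂ F V]
  {r : M → M → Prop} {D : SmoothSections n F V →ₗ[ℂ] SmoothSections n F V}
  {G : CompactSections n F V →ₗ[ℂ] SmoothSections n F V}

/-- Uniqueness of solutions of `D u = f` supported in the future of a compact set. -/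
def UniquelySolvable (r : M → M → Prop)
    (D : SmoothSections n F V →ₗ[ℂ] SmoothSections n F V) : Prop :=
  ∀ C, IsCompact C → ∀ u, secSupport u ⊆ relFuture r C → D u = 0 → u = 0

theorem UniquelySolvable.eq (hU : UniquelySolvable r D) {C : Set M} (hC : IsCompact C)
    {u v : SmoothSections n F V} (hu : secSupport u ⊆ relFuture r C)
    (hv : secSupport v ⊆ relFuture r C) (h : D u = D v) : u = v :=
  sub_eq_zero.1 (hU C hC (u - v) ((secSupport_sub u v).trans (Set.union_subset hu hv))
    (by rw [map_sub, h, sub_self]))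

/-- To compute `G f` it is enough to guess a solution supported in the future of some compact set,
not necessarily the support of `f`: both candidates live in the future of the union. -/
theorem UniquelySolvable.eq_propagator (hU : UniquelySolvable r D)
    (hG : IsPropagator (relFuture r) D G) {C : Set M} (hC : IsCompact C)
    {u : SmoothSections n F V} (hu : secSupport u ⊆ relFuture r C) (f : CompactSections n F V)
    (h : D u = f) : G f = u := by
  refine hU.eq (IsCompact.union hC f.2) ((hG.support f).trans (relFuture_mono ?_))
    (hu.trans (relFuture_mono Set.subset_union_left)) (by rw [hG.right_inv, h])
  exact Set.subset_union_right

/-- Propagators from the existence and the uniqueness of solutions. -/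
theorem exists_isPropagator [IsManifold (𝓡 n) ∞ M] [T2Space M] [SigmaCompactSpace M]
    (hr : IsCausalRelation r) (hD : IsDiffOp D) (hU : UniquelySolvable r D)
    (hS : ∀ f ∈ CompactSections n F V, ∃ u, secSupport u ⊆ relFuture r (secSupport f) ∧ D u = f) :
    ∃ G, IsPropagator (relFuture r) D G := by
  -- Solutions are chosen arbitrarily; uniqueness then makes the choice linear and a left inverse.
  choose! G hG hDG using hS
  refine ⟨{ toFun := fun f ↦ G f, map_add' := fun f k ↦ ?_, map_smul' := fun c f ↦ ?_ },
    fun f ↦ hDG f f.2, fun f k hfk ↦ ?_, fun f ↦ hG f f.2⟩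
  · have hfk : secSupport (f + k).1 ⊆ secSupport f.1 ∪ secSupport k.1 := secSupport_add f.1 k.1
    refine hU.eq (IsCompact.union f.2 k.2) ((hG _ (f + k).2).trans (relFuture_mono hfk))
      ((secSupport_add _ _).trans (Set.union_subset
        ((hG _ f.2).trans (relFuture_mono Set.subset_union_left))
        ((hG _ k.2).trans (relFuture_mono Set.subset_union_right)))) ?_
    rw [map_add, hDG _ f.2, hDG _ k.2, hDG _ (f + k).2]
    rfl
  · have hcf : secSupport (c • f).1 ⊆ secSupport f.1 := secSupport_smul c f.1
    refine hU.eq f.2 ((hG _ (c • f).2).trans (relFuture_mono hcf))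
      ((secSupport_smul _ _).trans (hG _ f.2)) ?_
    rw [RingHom.id_apply, map_smul, hDG _ f.2, hDG _ (c • f).2]
    rfl
  · have hk : secSupport k.1 ⊆ secSupport f.1 := hfk ▸ hD.secSupport_apply f.1
    exact hU.eq f.2 ((hG _ k.2).trans (relFuture_mono hk)) (hr.subset_relFuture _)
      ((hDG _ k.2).trans hfk.symm)

/-- A retarded propagator extends to sections supported in the future of a compact set. -/
theorem IsPropagator.exists_solution [IsManifold (𝓡 n) ∞ M] [T2Space M] [SigmaCompactSpace M]
    [MeasurableSpace M] [BorelSpace M]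
    (hr : IsCausalRelation r) (hD : IsDiffOp D) (hG : IsPropagator (relFuture r) D G)
    {C : Set M} (hC : IsCompact C) {s : SmoothSections n F V}
    (hs : secSupport s ⊆ relFuture r C) :
    ∃ u, secSupport u ⊆ relFuture r C ∧ D u = s := by
  choose q _ hq using fun x ↦ hr.above x Set.univ univ_mem
  -- Replace `s` by a test section equal to it near `J(C) ∩ J⁻(q x)`, the only part of the source
  -- that can influence the past of `q x`.
  choose t htc hts htsupp using fun x ↦ exists_compact_eventuallyEq
    (hr.isCompact_inter hC (isCompact_singleton (x := q x))) s
  let c : M → SmoothSections n F V := fun x ↦ G ⟨t x, htc x⟩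
  -- Local solutions agree wherever both are relevant: a point of the support of the difference has,
  -- in its past, a source point `w` below both `q x` and `q y`, near which the two cut-off sources
  -- coincide.
  have hc : ∀ x y z, r z (q x) → r z (q y) → (c x).1 z = (c y).1 z := by
    intro x y z hx hy
    have hsub : (c x - c y).1 z = 0 := by
      have : c x - c y = G (⟨t x, htc x⟩ - ⟨t y, htc y⟩) := (map_sub G _ _).symm
      rw [this]
      refine eq_zero_of_notMem_secSupport fun hz ↦ ?_
      obtain ⟨w, hw, hwz⟩ := hG.support _ hz
      have hw' : w ∈ secSupport (t x - t y) := hw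
      have hwC : w ∈ relFuture r C :=
        hs (Set.union_subset (htsupp x) (htsupp y) (secSupport_sub _ _ hw'))
      refine notMem_secSupport_iff.2 ?_ hw'
      filter_upwards [hts x w ⟨hwC, q x, rfl, hr.trans _ _ _ hwz hx⟩,
        hts y w ⟨hwC, q y, rfl, hr.trans _ _ _ hwz hy⟩] with v h1 h2
      rw [coe_sub_section, h1, h2, sub_self]
    exact sub_eq_zero.1 hsub
  have hloc : ∀ x, ∀ᶠ y in 𝓝 x, (c y).1 y = (c x).1 y := fun x ↦ by
    filter_upwards [hq x] with y hy
    exact hc y x y (hq y).self_of_nhds hy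
  -- Glue along the diagonal; near `x` the result is the single section `c x`.
  let u : SmoothSections n F V := ⟨fun x ↦ (c x).1 x, fun x ↦ by
    refine ((c x).2 x).congr_of_eventuallyEq ?_
    filter_upwards [hloc x] with y hy
    rw [hy]⟩
  refine ⟨u, secSupport_subset_of_isClosed (hr.isClosed_relFuture hC) fun x hx ↦ ?_, ?_⟩
  · obtain ⟨w, hw, hwx⟩ := hG.support _ (mem_secSupport_of_ne (s := c x) hx)
    exact hr.relFuture_relFuture C ⟨w, hs (htsupp x hw), hwx⟩
  · ext x
    rw [hD.apply_congr (s := u) (t := c x) (hloc x), hG.right_inv]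
    by_cases hx : x ∈ relFuture r C
    · exact (hts x x ⟨hx, q x, rfl, (hq x).self_of_nhds⟩).self_of_nhds
    · have hx' : x ∉ secSupport s := fun h ↦ hx (hs h)
      rw [eq_zero_of_notMem_secSupport hx']
      exact eq_zero_of_notMem_secSupport fun h ↦ hx' (htsupp x h)

variable [IsManifold (𝓡 n) ∞ M] [T2Space M] [SigmaCompactSpace M] [MeasurableSpace M]
  [BorelSpace M] {g : LorentzStructure n M} {hV : FiberForm V}

/-- The compactness behind every integration by parts between an advanced and a retarded solution.
-/
theorem isCompact_secSupport_inter (hr : IsCausalRelation r) {C C' : Set M} (hC : IsCompact C)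
    (hC' : IsCompact C') {u v : SmoothSections n F V} (hu : secSupport u ⊆ relFuture (rev r) C')
    (hv : secSupport v ⊆ relFuture r C) : IsCompact (secSupport u ∩ secSupport v) :=
  (hr.isCompact_inter hC hC').of_isClosed_subset
    ((isClosed_secSupport u).inter (isClosed_secSupport v)) fun _ hx ↦ ⟨hv hx.2, hu hx.1⟩

/-- A self-adjoint operator with an advanced propagator is injective on sections with support
in the future of a compact set. -/
theorem IsPropagator.uniquelySolvable_rev [∀ x, Module ℝ (V x)] [VectorBundle ℝ F V]
    [ContMDiffVectorBundle ∞ F V (𝓡 n)] (hG : IsPropagator (relFuture (rev r)) D G)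
    (hr : IsCausalRelation r) (hD : IsDiffOp D) (hh : IsHermitianStructure n F hV)
    (hDD : IsFormalAdjoint g hV hV D D) : UniquelySolvable r D := by
  intro C hC v hv hDv
  refine eq_zero_of_pairing (g := g) hh fun f hf ↦ ?_
  have h := hDD.pairing_eq hD hD
    (isCompact_secSupport_inter hr hC hf (hG.support ⟨f, hf⟩) hv)
  rwa [hG.right_inv, hDv, pairing_zero_right] at h

end Propagators

/-! ### Sections of the total bundle -/

section Total

open Filter Topology

variable {n : ℕ} {M : Type*} [TopologicalSpace M] [ChartedSpace (EuclideanSpace ℝ (Fin n)) M]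
  {F₁ : Type*} [NormedAddCommGroup F₁] [NormedSpace ℂ F₁]
  {V₁ : M → Type*} [TopologicalSpace (TotalSpace F₁ V₁)] [∀ x, AddCommGroup (V₁ x)]
  [∀ x, Module ℂ (V₁ x)] [∀ x, TopologicalSpace (V₁ x)] [FiberBundle F₁ V₁] [VectorBundle ℂ F₁ V₁]
  {F₀ : Type*} [NormedAddCommGroup F₀] [NormedSpace ℂ F₀]
  {V₀ : M → Type*} [TopologicalSpace (TotalSpace F₀ V₀)] [∀ x, AddCommGroup (V₀ x)]
  [∀ x, Module ℂ (V₀ x)] [∀ x, TopologicalSpace (V₀ x)] [FiberBundle F₀ V₀] [VectorBundle ℂ F₀ V₀]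

theorem totalSections_ext {u v : TotalSections n F₁ V₁ F₀ V₀} (ha : compA u = compA v)
    (hb : compB u = compB v) (hc : compC u = compC v) (hd : compD u = compD v) : u = v := by
  ext x
  · exact congrArg (fun s : SmoothSections n F₁ V₁ ↦ s.1 x) ha
  · exact congrArg (fun s : SmoothSections n F₀ V₀ ↦ s.1 x) hb
  · exact congrArg (fun s : SmoothSections n F₀ V₀ ↦ s.1 x) hc
  · exact congrArg (fun s : SmoothSections n F₀ V₀ ↦ s.1 x) hd

section Rows

variable {X : Type*} [AddCommGroup X] [Module ℂ X] (A : X →ₗ[ℂ] SmoothSections n F₁ V₁)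
    (B C D : X →ₗ[ℂ] SmoothSections n F₀ V₀) (u : X)

@[simp] theorem compA_ofRows : compA (ofRows A B C D u) = A u := rfl
@[simp] theorem compB_ofRows : compB (ofRows A B C D u) = B u := rfl
@[simp] theorem compC_ofRows : compC (ofRows A B C D u) = C u := rfl
@[simp] theorem compD_ofRows : compD (ofRows A B C D u) = D u := rfl

end Rows

/-- The section `(a, b, c, d)` of `V₁ ⊕ V₀ ⊕ V₀ ⊕ V₀`. -/
def mkTotal (a : SmoothSections n F₁ V₁) (b c d : SmoothSections n F₀ V₀) :
    TotalSections n F₁ V₁ F₀ V₀ :=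
  ofRows (LinearMap.fst ℂ _ _) (LinearMap.fst ℂ _ _ ∘ₗ LinearMap.snd ℂ _ _)
    (LinearMap.fst ℂ _ _ ∘ₗ LinearMap.snd ℂ _ _ ∘ₗ LinearMap.snd ℂ _ _)
    (LinearMap.snd ℂ _ _ ∘ₗ LinearMap.snd ℂ _ _ ∘ₗ LinearMap.snd ℂ _ _) (a, b, c, d)

section Mk

variable (a : SmoothSections n F₁ V₁) (b c d : SmoothSections n F₀ V₀)

@[simp] theorem compA_mkTotal : compA (mkTotal a b c d) = a := rfl
@[simp] theorem compB_mkTotal : compB (mkTotal a b c d) = b := rfl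
@[simp] theorem compC_mkTotal : compC (mkTotal a b c d) = c := rfl
@[simp] theorem compD_mkTotal : compD (mkTotal a b c d) = d := rfl

end Mk

theorem isDiffOp_compA :
    IsDiffOp (compA : TotalSections n F₁ V₁ F₀ V₀ →ₗ[ℂ] SmoothSections n F₁ V₁) := isDiffOp_secFst

theorem isDiffOp_compB :
    IsDiffOp (compB : TotalSections n F₁ V₁ F₀ V₀ →ₗ[ℂ] SmoothSections n F₀ V₀) :=
  isDiffOp_secFst.comp isDiffOp_secSnd

theorem isDiffOp_compC :
    IsDiffOp (compC : TotalSections n F₁ V₁ F₀ V₀ →ₗ[ℂ] SmoothSections n F₀ V₀) :=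
  isDiffOp_secFst.comp (isDiffOp_secSnd.comp isDiffOp_secSnd)

theorem isDiffOp_compD :
    IsDiffOp (compD : TotalSections n F₁ V₁ F₀ V₀ →ₗ[ℂ] SmoothSections n F₀ V₀) :=
  isDiffOp_secSnd.comp (isDiffOp_secSnd.comp isDiffOp_secSnd)

theorem IsDiffOp.ofRows {F' : Type*} [NormedAddCommGroup F'] [NormedSpace ℂ F']
    {W : M → Type*} [TopologicalSpace (TotalSpace F' W)] [∀ x, AddCommGroup (W x)]
    [∀ x, Module ℂ (W x)] [∀ x, TopologicalSpace (W x)] [FiberBundle F' W] [VectorBundle ℂ F' W]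
    {A : SmoothSections n F' W →ₗ[ℂ] SmoothSections n F₁ V₁}
    {B C D : SmoothSections n F' W →ₗ[ℂ] SmoothSections n F₀ V₀}
    (hA : IsDiffOp A) (hB : IsDiffOp B) (hC : IsDiffOp C) (hD : IsDiffOp D) :
    IsDiffOp (ofRows A B C D) :=
  hA.secPair (hB.secPair (hC.secPair hD))

theorem secSupport_total (u : TotalSections n F₁ V₁ F₀ V₀) :
    secSupport u ⊆ secSupport (compA u) ∪ (secSupport (compB u) ∪
      (secSupport (compC u) ∪ secSupport (compD u))) := by
  refine secSupport_subset_of_isClosed ((isClosed_secSupport _).union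
    ((isClosed_secSupport _).union ((isClosed_secSupport _).union (isClosed_secSupport _))))
    fun x hx ↦ ?_
  by_contra h
  simp only [Set.mem_union, not_or] at h
  exact hx (Prod.ext (eq_zero_of_notMem_secSupport h.1)
    (Prod.ext (eq_zero_of_notMem_secSupport h.2.1) (Prod.ext (eq_zero_of_notMem_secSupport h.2.2.1)
      (eq_zero_of_notMem_secSupport h.2.2.2))))

theorem secSupport_mkTotal {S : Set M} {a : SmoothSections n F₁ V₁} {b c d : SmoothSections n F₀ V₀}
    (ha : secSupport a ⊆ S) (hb : secSupport b ⊆ S) (hc : secSupport c ⊆ S)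
    (hd : secSupport d ⊆ S) : secSupport (mkTotal a b c d) ⊆ S :=
  (secSupport_total _).trans (Set.union_subset ha (Set.union_subset hb (Set.union_subset hc hd)))

theorem mem_compactSections_mkTotal [T2Space M] {a : SmoothSections n F₁ V₁}
    {b c d : SmoothSections n F₀ V₀}
    (ha : a ∈ CompactSections n F₁ V₁) (hb : b ∈ CompactSections n F₀ V₀)
    (hc : c ∈ CompactSections n F₀ V₀) (hd : d ∈ CompactSections n F₀ V₀) :
    mkTotal a b c d ∈ CompactSections n (F₁ × (F₀ × (F₀ × F₀))) (TotalBundle V₁ V₀) :=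
  mem_compactSections_of_subset (IsCompact.union ha (IsCompact.union hb (IsCompact.union hc hd)))
    (secSupport_total _)

theorem mem_gradedSections_zero {u : TotalSections n F₁ V₁ F₀ V₀} :
    u ∈ GradedSections n (F₁ × (F₀ × (F₀ × F₀))) (ghostGrading V₁ V₀) 0 ↔
      compC u = 0 ∧ compD u = 0 := by
  constructor
  · intro h
    exact ⟨SmoothSections.ext fun x ↦ (h x).2.1 (by norm_num),
      SmoothSections.ext fun x ↦ (h x).2.2 (by norm_num)⟩
  · rintro ⟨hc, hd⟩ x
    exact ⟨fun h ↦ (h rfl).elim,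
      fun _ ↦ congrArg (fun s : SmoothSections n F₀ V₀ ↦ s.1 x) hc,
      fun _ ↦ congrArg (fun s : SmoothSections n F₀ V₀ ↦ s.1 x) hd⟩

theorem mem_gradedSections_iff {i : ℤ} {u : TotalSections n F₁ V₁ F₀ V₀} :
    u ∈ GradedSections n (F₁ × (F₀ × (F₀ × F₀))) (ghostGrading V₁ V₀) i ↔
      (i ≠ 0 → compA u = 0 ∧ compB u = 0) ∧ (i ≠ 1 → compC u = 0) ∧ (i ≠ -1 → compD u = 0) := by
  constructor
  · intro h
    exact ⟨fun hi ↦ ⟨SmoothSections.ext fun x ↦ ((h x).1 hi).1,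
      SmoothSections.ext fun x ↦ ((h x).1 hi).2⟩,
      fun hi ↦ SmoothSections.ext fun x ↦ (h x).2.1 hi,
      fun hi ↦ SmoothSections.ext fun x ↦ (h x).2.2 hi⟩
  · rintro ⟨h1, h2, h3⟩ x
    exact ⟨fun hi ↦ ⟨congrArg (fun s : SmoothSections n F₁ V₁ ↦ s.1 x) (h1 hi).1,
      congrArg (fun s : SmoothSections n F₀ V₀ ↦ s.1 x) (h1 hi).2⟩,
      fun hi ↦ congrArg (fun s : SmoothSections n F₀ V₀ ↦ s.1 x) (h2 hi),
      fun hi ↦ congrArg (fun s : SmoothSections n F₀ V₀ ↦ s.1 x) (h3 hi)⟩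

/-! ### The direct sum form, its grading and its pairing. -/

section Forms

variable {h₁ : FiberForm V₁} {h₀ : FiberForm V₀}

theorem totalForm_apply (x : M) (u v : TotalBundle V₁ V₀ x) : totalForm h₁ h₀ x u v =
    h₁ x u.1 v.1 + h₀ x u.2.1 v.2.1 + h₀ x u.2.2.1 v.2.2.1 + h₀ x u.2.2.2 v.2.2.2 := rfl

theorem isHermitianStructure_totalForm (hh₁ : IsHermitianStructure n F₁ h₁)
    (hh₀ : IsHermitianStructure n F₀ h₀) :
    IsHermitianStructure n (F₁ × (F₀ × (F₀ × F₀))) (totalForm h₁ h₀) where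
  hermitian x v w := by
    simp only [totalForm_apply, map_add, ← hh₁.hermitian, ← hh₀.hermitian]
  nondegenerate x v h := by
    refine Prod.ext (hh₁.nondegenerate x _ fun w ↦ ?_) (Prod.ext (hh₀.nondegenerate x _ fun w ↦ ?_)
      (Prod.ext (hh₀.nondegenerate x _ fun w ↦ ?_) (hh₀.nondegenerate x _ fun w ↦ ?_)))
    · simpa [totalForm_apply] using h (w, 0, 0, 0)
    · simpa [totalForm_apply] using h (0, w, 0, 0)
    · simpa [totalForm_apply] using h (0, 0, w, 0)
    · simpa [totalForm_apply] using h (0, 0, 0, w)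
  smooth u v := (((hh₁.smooth (compA u) (compA v)).add (hh₀.smooth (compB u) (compB v))).add
    (hh₀.smooth (compC u) (compC v))).add (hh₀.smooth (compD u) (compD v))

variable (V₁ V₀) in
/-- The projection to the summand of degree `i`. -/
def ghostProjection (i : ℤ) (x : M) : TotalBundle V₁ V₀ x →ₗ[ℂ] TotalBundle V₁ V₀ x where
  toFun v := (if i = 0 then v.1 else 0, if i = 0 then v.2.1 else 0,
    if i = 1 then v.2.2.1 else 0, if i = -1 then v.2.2.2 else 0)
  map_add' u v := by
    refine Prod.ext ?_ (Prod.ext ?_ (Prod.ext ?_ ?_)) <;> simp only [Prod.fst_add, Prod.snd_add] <;>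
      split_ifs <;> simp
  map_smul' c v := by
    refine Prod.ext ?_ (Prod.ext ?_ (Prod.ext ?_ ?_)) <;> simp

theorem ghostProjection_mem (i : ℤ) {x : M} (v : TotalBundle V₁ V₀ x) :
    ghostProjection V₁ V₀ i x v ∈ ghostGrading V₁ V₀ i x :=
  ⟨fun h ↦ ⟨if_neg h, if_neg h⟩, fun h ↦ if_neg h, fun h ↦ if_neg h⟩

theorem ghostProjection_of_mem {i j : ℤ} {x : M} {v : TotalBundle V₁ V₀ x}
    (hv : v ∈ ghostGrading V₁ V₀ j x) :
    ghostProjection V₁ V₀ i x v = if j = i then v else 0 := by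
  obtain ⟨h1, h2, h3⟩ := hv
  split_ifs with hij
  · subst hij
    refine Prod.ext ?_ (Prod.ext ?_ (Prod.ext ?_ ?_))
    · exact ite_eq_left_iff.2 fun h ↦ (h1 h).1.symm
    · exact ite_eq_left_iff.2 fun h ↦ (h1 h).2.symm
    · exact ite_eq_left_iff.2 fun h ↦ (h2 h).symm
    · exact ite_eq_left_iff.2 fun h ↦ (h3 h).symm
  · refine Prod.ext ?_ (Prod.ext ?_ (Prod.ext ?_ ?_))
    · exact ite_eq_right_iff.2 fun h ↦ (h1 (h ▸ hij)).1
    · exact ite_eq_right_iff.2 fun h ↦ (h1 (h ▸ hij)).2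
    · exact ite_eq_right_iff.2 fun h ↦ h2 (h ▸ hij)
    · exact ite_eq_right_iff.2 fun h ↦ h3 (h ▸ hij)

theorem isHermitianGrading_ghostGrading :
    IsHermitianGrading (n := n) (F := F₁ × (F₀ × (F₀ × F₀))) (totalForm h₁ h₀)
      (ghostGrading V₁ V₀) where
  isInternal x := by
    classical
    refine (DirectSum.isInternal_submodule_iff_iSupIndep_and_iSup_eq_top _).2 ⟨?_, ?_⟩
    · refine iSupIndep_def.2 fun i ↦ Submodule.disjoint_def.2 fun v hv hv' ↦ ?_
      have hle : ⨆ j, ⨆ (_ : j ≠ i), ghostGrading V₁ V₀ j x ≤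
          LinearMap.ker (ghostProjection V₁ V₀ i x) := by
        refine iSup₂_le fun j hj w hw ↦ ?_
        rw [LinearMap.mem_ker, ghostProjection_of_mem hw, if_neg hj]
      -- A vector of degree `i` is its own `i`-th projection, while the span of the other summands
      -- lies in the kernel of that projection.
      rw [← if_pos (c := i = i) (t := v) (e := 0) rfl, ← ghostProjection_of_mem hv]
      exact hle hv'
    · refine eq_top_iff.2 fun v _ ↦ ?_
      have hv : v = ghostProjection V₁ V₀ 0 x v + ghostProjection V₁ V₀ 1 x v +
          ghostProjection V₁ V₀ (-1) x v := by
        refine Prod.ext ?_ (Prod.ext ?_ (Prod.ext ?_ ?_)) <;> simp [ghostProjection]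
      have hm : ∀ i, ghostProjection V₁ V₀ i x v ∈ ⨆ i, ghostGrading V₁ V₀ i x := fun i ↦
        Submodule.mem_iSup_of_mem i (ghostProjection_mem i v)
      rw [hv]
      exact add_mem (add_mem (hm 0) (hm 1)) (hm (-1))
  index i hi x := by
    simp only [Set.mem_insert_iff, Set.mem_singleton_iff, not_or] at hi
    refine (Submodule.eq_bot_iff _).2 fun v hv ↦ ?_
    exact Prod.ext (hv.1 hi.2.1).1 (Prod.ext (hv.1 hi.2.1).2
      (Prod.ext (hv.2.1 hi.2.2) (hv.2.2 hi.1)))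
  smooth s := by
    refine ⟨fun i ↦ mkTotal (if i = 0 then compA s else 0) (if i = 0 then compB s else 0)
      (if i = 1 then compC s else 0) (if i = -1 then compD s else 0), fun i ↦ ?_, ?_⟩
    · refine mem_gradedSections_iff.2 ⟨fun hi ↦ ?_, fun hi ↦ ?_, fun hi ↦ ?_⟩ <;> simp [hi]
    · refine totalSections_ext ?_ ?_ ?_ ?_ <;> simp
  orthogonal i j hij x u hu v hv := by
    rw [totalForm_apply]
    have h1 : h₁ x u.1 v.1 = 0 := by
      by_cases hi : i = 0
      · rw [(hv.1 (hi ▸ hij.symm)).1, map_zero]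
      · rw [(hu.1 hi).1, map_zero, LinearMap.zero_apply]
    have h2 : h₀ x u.2.1 v.2.1 = 0 := by
      by_cases hi : i = 0
      · rw [(hv.1 (hi ▸ hij.symm)).2, map_zero]
      · rw [(hu.1 hi).2, map_zero, LinearMap.zero_apply]
    have h3 : h₀ x u.2.2.1 v.2.2.1 = 0 := by
      by_cases hi : i = 1
      · rw [hv.2.1 (hi ▸ hij.symm), map_zero]
      · rw [hu.2.1 hi, map_zero, LinearMap.zero_apply]
    have h4 : h₀ x u.2.2.2 v.2.2.2 = 0 := by
      by_cases hi : i = -1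
      · rw [hv.2.2 (hi ▸ hij.symm), map_zero]
      · rw [hu.2.2 hi, map_zero, LinearMap.zero_apply]
    rw [h1, h2, h3, h4]
    simp

variable [IsManifold (𝓡 n) ∞ M] [T2Space M] [SigmaCompactSpace M] [MeasurableSpace M]
  [BorelSpace M]

theorem IsDiffOp.isCompact_inter {F F' : Type*} [NormedAddCommGroup F] [NormedSpace ℂ F]
    {V : M → Type*} [TopologicalSpace (TotalSpace F V)] [∀ x, AddCommGroup (V x)]
    [∀ x, Module ℂ (V x)] [∀ x, TopologicalSpace (V x)] [FiberBundle F V] [VectorBundle ℂ F V]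
    [NormedAddCommGroup F'] [NormedSpace ℂ F']
    {W : M → Type*} [TopologicalSpace (TotalSpace F' W)] [∀ x, AddCommGroup (W x)]
    [∀ x, Module ℂ (W x)] [∀ x, TopologicalSpace (W x)] [FiberBundle F' W] [VectorBundle ℂ F' W]
    {T : SmoothSections n F V →ₗ[ℂ] SmoothSections n F' W} (hT : IsDiffOp T)
    {u v : SmoothSections n F V} (huv : IsCompact (secSupport u ∩ secSupport v)) :
    IsCompact (secSupport (T u) ∩ secSupport (T v)) :=
  huv.of_isClosed_subset ((isClosed_secSupport _).inter (isClosed_secSupport _))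
    (Set.inter_subset_inter (hT.secSupport_apply u) (hT.secSupport_apply v))

theorem pairing_total (g : LorentzStructure n M) (hh₁ : IsHermitianStructure n F₁ h₁)
    (hh₀ : IsHermitianStructure n F₀ h₀) {u v : TotalSections n F₁ V₁ F₀ V₀}
    (huv : IsCompact (secSupport u ∩ secSupport v)) :
    pairing g (totalForm h₁ h₀) u v = pairing g h₁ (compA u) (compA v) +
      pairing g h₀ (compB u) (compB v) + pairing g h₀ (compC u) (compC v) +
        pairing g h₀ (compD u) (compD v) := by
  have ia := hh₁.integrable g (isDiffOp_compA.isCompact_inter huv)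
  have ib := hh₀.integrable g (isDiffOp_compB.isCompact_inter huv)
  have ic := hh₀.integrable g (isDiffOp_compC.isCompact_inter huv)
  have id := hh₀.integrable g (isDiffOp_compD.isCompact_inter huv)
  exact (integral_add ((ia.add ib).add ic) id).trans (congrArg (· + _)
    ((integral_add (ia.add ib) ic).trans (congrArg (· + _) (integral_add ia ib))))

end Forms

end Total

/-! ### The BRST hypotheses for `L` and `γ` -/

section BRST

open Filter Topology

variable {n : ℕ} {M : Type*} [TopologicalSpace M] [ChartedSpace (EuclideanSpace ℝ (Fin n)) M]
  [IsManifold (𝓡 n) ∞ M] [T2Space M] [SigmaCompactSpace M] [MeasurableSpace M] [BorelSpace M]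
  {F₁ : Type*} [NormedAddCommGroup F₁] [NormedSpace ℂ F₁]
  {V₁ : M → Type*} [TopologicalSpace (TotalSpace F₁ V₁)] [∀ x, AddCommGroup (V₁ x)]
  [∀ x, Module ℂ (V₁ x)] [∀ x, TopologicalSpace (V₁ x)] [FiberBundle F₁ V₁] [VectorBundle ℂ F₁ V₁]
  {F₀ : Type*} [NormedAddCommGroup F₀] [NormedSpace ℂ F₀]
  {V₀ : M → Type*} [TopologicalSpace (TotalSpace F₀ V₀)] [∀ x, AddCommGroup (V₀ x)]
  [∀ x, Module ℂ (V₀ x)] [∀ x, TopologicalSpace (V₀ x)] [FiberBundle F₀ V₀] [VectorBundle ℂ F₀ V₀]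
  {g : LorentzStructure n M} {h₀ : FiberForm V₀} {h₁ : FiberForm V₁}
  {P : SmoothSections n F₁ V₁ →ₗ[ℂ] SmoothSections n F₁ V₁}
  {K : SmoothSections n F₀ V₀ →ₗ[ℂ] SmoothSections n F₁ V₁} {α : ℝ}

/-- The algebraic part of the hypotheses on `P` and `K`, with the existence of `K*`. -/
structure GaugePair (g : LorentzStructure n M) (h₀ : FiberForm V₀) (h₁ : FiberForm V₁)
    (P : SmoothSections n F₁ V₁ →ₗ[ℂ] SmoothSections n F₁ V₁)
    (K : SmoothSections n F₀ V₀ →ₗ[ℂ] SmoothSections n F₁ V₁) : Prop where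
  hermitian₀ : IsHermitianStructure n F₀ h₀
  hermitian₁ : IsHermitianStructure n F₁ h₁
  P_diffOp : IsDiffOp P
  P_selfAdjoint : IsFormalAdjoint g h₁ h₁ P P
  K_diffOp : IsDiffOp K
  P_comp_K : P ∘ₗ K = 0
  adj_diffOp : IsDiffOp (formalAdjoint g h₀ h₁ K)
  adj : IsFormalAdjoint g h₀ h₁ K (formalAdjoint g h₀ h₁ K)

theorem exists_ne_zero_of_ne_zero (hK : K ≠ 0) : ∃ t ∈ CompactSections n F₀ V₀, t ≠ 0 := by
  obtain ⟨s, hs⟩ : ∃ s, K s ≠ 0 := by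
    by_contra! h
    exact hK (LinearMap.ext h)
  exact exists_compactSection_ne_zero (s := s) fun h ↦ hs (by rw [h, map_zero])

/-- `K*` cannot be the default value zero: the ghost row of `L` would then vanish, and `L` could not
reach a nonzero source in the ghost component. -/
theorem ModifiedSubsidiary.gaugePair (h : ModifiedSubsidiary g h₀ h₁ P K α) :
    GaugePair g h₀ h₁ P K := by
  have hne : formalAdjoint g h₀ h₁ K ≠ 0 := fun h0 ↦ by
    obtain ⟨t, ht, hne⟩ := exists_ne_zero_of_ne_zero h.K_ne_zero
    obtain ⟨G, hG⟩ := h.L_green.propagators.1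
    have := congrArg compC (hG.right_inv ⟨mkTotal 0 0 t 0, mem_compactSections_mkTotal
      (Submodule.zero_mem _) (Submodule.zero_mem _) ht (Submodule.zero_mem _)⟩)
    simp only [bigL, compC_ofRows, h0, LinearMap.zero_comp, LinearMap.zero_apply,
      compC_mkTotal] at this
    exact hne this.symm
  obtain ⟨h1, h2⟩ := formalAdjoint_spec hne
  exact ⟨h.hermitian₀, h.hermitian₁, h.P_diffOp, h.P_selfAdjoint, h.K_diffOp, h.P_comp_K, h1, h2⟩

/-- Same exclusion of the default adjoint, here because `K* K` has a right inverse on test sections.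
-/
theorem HackSchenkel.gaugePair (h : HackSchenkel g h₀ h₁ P K K) : GaugePair g h₀ h₁ P K := by
  have hne : formalAdjoint g h₀ h₁ K ≠ 0 := fun h0 ↦ by
    obtain ⟨t, ht, hne⟩ := exists_ne_zero_of_ne_zero h.K_ne_zero
    obtain ⟨G, hG⟩ := h.R_green.propagators.1
    have := hG.right_inv ⟨t, ht⟩
    simp only [h0, LinearMap.zero_comp, LinearMap.zero_apply] at this
    exact hne this.symm
  obtain ⟨h1, h2⟩ := formalAdjoint_spec hne
  exact ⟨h.hermitian₀, h.hermitian₁, h.P_diffOp, h.P_selfAdjoint, h.K_diffOp, h.P_comp_K, h1, h2⟩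

/-- The operator `γ*`. -/
def gammaAdj (g : LorentzStructure n M) (h₀ : FiberForm V₀) (h₁ : FiberForm V₁)
    (K : SmoothSections n F₀ V₀ →ₗ[ℂ] SmoothSections n F₁ V₁) :
    TotalSections n F₁ V₁ F₀ V₀ →ₗ[ℂ] TotalSections n F₁ V₁ F₀ V₀ :=
  ofRows 0 compD (formalAdjoint g h₀ h₁ K ∘ₗ compA) 0

namespace GaugePair

theorem isDiffOp_gammaOp (h : GaugePair g h₀ h₁ P K) :
    IsDiffOp (gammaOp K : TotalSections n F₁ V₁ F₀ V₀ →ₗ[ℂ] _) :=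
  (h.K_diffOp.comp isDiffOp_compC).ofRows isDiffOp_zero isDiffOp_zero isDiffOp_compB

theorem isDiffOp_gammaAdj (h : GaugePair g h₀ h₁ P K) :
    IsDiffOp (gammaAdj g h₀ h₁ K : TotalSections n F₁ V₁ F₀ V₀ →ₗ[ℂ] _) :=
  isDiffOp_zero.ofRows isDiffOp_compD (h.adj_diffOp.comp isDiffOp_compA) isDiffOp_zero

theorem isDiffOp_bigL (h : GaugePair g h₀ h₁ P K) : IsDiffOp (bigL g h₀ h₁ P K α) :=
  ((h.P_diffOp.comp isDiffOp_compA).add (h.K_diffOp.comp isDiffOp_compB)).ofRows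
    ((h.adj_diffOp.comp isDiffOp_compA).sub (isDiffOp_compB.smul _))
    (h.adj_diffOp.comp (h.K_diffOp.comp isDiffOp_compD))
    (h.adj_diffOp.comp (h.K_diffOp.comp isDiffOp_compC))

theorem isFormalAdjoint_gammaOp (h : GaugePair g h₀ h₁ P K) :
    IsFormalAdjoint g (totalForm h₁ h₀) (totalForm h₁ h₀) (gammaOp K) (gammaAdj g h₀ h₁ K) := by
  intro u hu v hv
  rw [pairing_total g h.hermitian₁ h.hermitian₀ (isCompact_inter_right _ hv),
    pairing_total g h.hermitian₁ h.hermitian₀ (isCompact_inter_left hu _)]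
  simp only [gammaOp, gammaAdj, compA_ofRows, compB_ofRows, compC_ofRows, compD_ofRows,
    LinearMap.comp_apply, LinearMap.zero_apply, pairing_zero_left, pairing_zero_right]
  rw [h.adj _ (isDiffOp_compC.mem_compactSections hu) _ (isDiffOp_compA.mem_compactSections hv)]
  ring

theorem isFormalAdjoint_KK (h : GaugePair g h₀ h₁ P K) :
    IsFormalAdjoint g h₀ h₀ (formalAdjoint g h₀ h₁ K ∘ₗ K) (formalAdjoint g h₀ h₁ K ∘ₗ K) :=
  (h.adj.symm h.hermitian₀ h.hermitian₁).comp h.adj h.K_diffOp h.K_diffOp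

theorem isDiffOp_KK (h : GaugePair g h₀ h₁ P K) : IsDiffOp (formalAdjoint g h₀ h₁ K ∘ₗ K) :=
  h.adj_diffOp.comp h.K_diffOp

theorem isFormalAdjoint_D (h : GaugePair g h₀ h₁ P K) :
    IsFormalAdjoint g h₁ h₁ (P + K ∘ₗ formalAdjoint g h₀ h₁ K)
      (P + K ∘ₗ formalAdjoint g h₀ h₁ K) :=
  h.P_selfAdjoint.add (h.adj.comp (h.adj.symm h.hermitian₀ h.hermitian₁) h.adj_diffOp h.adj_diffOp)
    h.hermitian₁ h.hermitian₁

theorem isDiffOp_D (h : GaugePair g h₀ h₁ P K) :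
    IsDiffOp (P + K ∘ₗ formalAdjoint g h₀ h₁ K) :=
  h.P_diffOp.add (h.K_diffOp.comp h.adj_diffOp)

theorem isFormalAdjoint_bigL (h : GaugePair g h₀ h₁ P K) :
    IsFormalAdjoint g (totalForm h₁ h₀) (totalForm h₁ h₀) (bigL g h₀ h₁ P K α)
      (bigL g h₀ h₁ P K α) := by
  intro u hu v hv
  have h0 := h.hermitian₀
  have h1 := h.hermitian₁
  have hua := isDiffOp_compA.mem_compactSections hu
  have hub := isDiffOp_compB.mem_compactSections hu
  have huc := isDiffOp_compC.mem_compactSections hu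
  have hud := isDiffOp_compD.mem_compactSections hu
  have hva := isDiffOp_compA.mem_compactSections hv
  have hvb := isDiffOp_compB.mem_compactSections hv
  have hvc := isDiffOp_compC.mem_compactSections hv
  have hvd := isDiffOp_compD.mem_compactSections hv
  rw [pairing_total g h1 h0 (isCompact_inter_right _ hv),
    pairing_total g h1 h0 (isCompact_inter_left hu _)]
  simp only [bigL, compA_ofRows, compB_ofRows, compC_ofRows, compD_ofRows, LinearMap.add_apply,
    LinearMap.sub_apply, LinearMap.smul_apply, LinearMap.comp_apply, sub_eq_add_neg]
  -- The term `-α b` is treated as a scalar multiple, so that additivity of the pairing applies; it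
  -- is symmetric because `α` is real.
  simp only [← neg_smul, LinearMap.smul_apply]
  have k1 := h.isFormalAdjoint_KK _ hud _ hvc
  have k2 := h.isFormalAdjoint_KK _ huc _ hvd
  simp only [LinearMap.comp_apply] at k1 k2
  rw [pairing_add_left h1 (isCompact_inter_right _ hva) (isCompact_inter_right _ hva),
    pairing_add_left h0 (isCompact_inter_right _ hvb) (isCompact_inter_right _ hvb),
    pairing_add_right h1 (isCompact_inter_left hua _) (isCompact_inter_left hua _),
    pairing_add_right h0 (isCompact_inter_left hub _) (isCompact_inter_left hub _),
    h.P_selfAdjoint _ hua _ hva, h.adj _ hub _ hva, h.adj.symm h0 h1 _ hua _ hvb,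
    k1, k2,
    pairing_smul_left, pairing_smul_right, map_neg, Complex.conj_ofReal]
  ring

section Bundles

variable [∀ x, Module ℝ (V₀ x)] [VectorBundle ℝ F₀ V₀] [ContMDiffVectorBundle ∞ F₀ V₀ (𝓡 n)]

/-- `K* P = 0`. -/
theorem adj_comp_P (h : GaugePair g h₀ h₁ P K) : formalAdjoint g h₀ h₁ K ∘ₗ P = 0 := by
  refine IsFormalAdjoint.unique (g := g) (hV := h₀) (hW := h₁) (A := 0) h.hermitian₀ ?_ ?_
    -- Both `K* P` and `0` are adjoints of `P K = 0`.
    (h.adj_diffOp.comp h.P_diffOp) isDiffOp_zero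
  · rw [← h.P_comp_K]
    exact h.P_selfAdjoint.comp h.adj h.K_diffOp h.P_diffOp
  · intro u _ v _
    simp

theorem adj_P (h : GaugePair g h₀ h₁ P K) (u : SmoothSections n F₁ V₁) :
    formalAdjoint g h₀ h₁ K (P u) = 0 := LinearMap.congr_fun h.adj_comp_P u

theorem P_K (h : GaugePair g h₀ h₁ P K) (u : SmoothSections n F₀ V₀) :
    P (K u) = 0 := LinearMap.congr_fun h.P_comp_K u

variable [∀ x, Module ℝ (V₁ x)] [VectorBundle ℝ F₁ V₁] [ContMDiffVectorBundle ∞ F₁ V₁ (𝓡 n)]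

theorem formalAdjoint_gammaOp (h : GaugePair g h₀ h₁ P K) :
    formalAdjoint g (totalForm h₁ h₀) (totalForm h₁ h₀) (gammaOp K) = gammaAdj g h₀ h₁ K :=
  h.isFormalAdjoint_gammaOp.formalAdjoint_eq
    (isHermitianStructure_totalForm h.hermitian₁ h.hermitian₀) h.isDiffOp_gammaAdj

theorem formalAdjoint_bigL (h : GaugePair g h₀ h₁ P K) :
    formalAdjoint g (totalForm h₁ h₀) (totalForm h₁ h₀) (bigL g h₀ h₁ P K α) =
      bigL g h₀ h₁ P K α :=
  h.isFormalAdjoint_bigL.formalAdjoint_eq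
    (isHermitianStructure_totalForm h.hermitian₁ h.hermitian₀) h.isDiffOp_bigL

theorem brstHypotheses [∀ x, IsScalarTower ℝ ℂ (V₀ x)] [∀ x, IsScalarTower ℝ ℂ (V₁ x)]
    (h : GaugePair g h₀ h₁ P K)
    (hL : GreenHyperbolic g (totalForm h₁ h₀) (bigL g h₀ h₁ P K α)) :
    BRSTHypotheses g (totalForm h₁ h₀) (ghostGrading V₁ V₀) (bigL g h₀ h₁ P K α) (gammaOp K) where
  hermitian := isHermitianStructure_totalForm h.hermitian₁ h.hermitian₀
  grading := isHermitianGrading_ghostGrading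
  γ_diffOp := h.isDiffOp_gammaOp
  γ_sq := by
    ext1 u
    refine totalSections_ext ?_ ?_ ?_ ?_ <;> simp [gammaOp]
  γ_grading i s hs := by
    rw [mem_gradedSections_iff] at hs ⊢
    obtain ⟨h1, h2, -⟩ := hs
    refine ⟨fun hi ↦ ⟨?_, rfl⟩, fun _ ↦ rfl, fun hi ↦ ?_⟩
    · simp only [gammaOp, compA_ofRows, LinearMap.comp_apply, h2 fun h ↦ hi (by omega), map_zero]
    · simp only [gammaOp, compD_ofRows, (h1 fun h ↦ hi (by omega)).2]
  homology := by
    rw [Submodule.Quotient.subsingleton_iff, eq_top_iff]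
    rintro ⟨u, ⟨huc, -⟩, hu⟩ -
    obtain ⟨h1, h2, -⟩ := mem_gradedSections_iff.1 hu
    obtain ⟨ha, hb⟩ := h1 (by norm_num)
    -- The entry `1` of `γ` makes every antighost section exact: move it to the multiplier slot.
    have hγ : gammaOp K (mkTotal 0 (compD u) 0 0) = u := by
      refine totalSections_ext ?_ ?_ ?_ ?_ <;> simp [gammaOp, ha, hb, h2 (by norm_num)]
    exact ⟨⟨mkTotal 0 (compD u) 0 0, mem_compactSections_mkTotal (Submodule.zero_mem _)
      (isDiffOp_compD.mem_compactSections huc) (Submodule.zero_mem _) (Submodule.zero_mem _),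
      hγ⟩, hu⟩
  L_green := hL
  L_selfAdjoint := h.isFormalAdjoint_bigL
  γ_L_comm := by
    rw [h.formalAdjoint_gammaOp]
    -- Both sides equal `(0, K* K c, K* K b, 0)`, after using `K* P = 0` on the left and `P K = 0`
    -- on the right.
    ext1 u
    refine totalSections_ext ?_ ?_ ?_ ?_ <;>
      simp [gammaOp, gammaAdj, bigL, h.adj_P, h.P_K]
  L_grading i hi s hs := by
    rw [mem_gradedSections_iff] at hs ⊢
    obtain ⟨h1, h2, h3⟩ := hs
    refine ⟨fun hi ↦ ?_, fun hi ↦ ?_, fun hi ↦ ?_⟩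
    · obtain ⟨ha, hb⟩ := h1 fun h ↦ hi (by omega)
      simp [bigL, ha, hb]
    · simp [bigL, h3 fun h ↦ hi (by omega)]
    · simp [bigL, h2 fun h ↦ hi (by omega)]

end Bundles

end GaugePair

end BRST

/-! ### Green hyperbolicity of `L` -/

section Green

open Filter Topology

variable {n : ℕ} {M : Type*} [TopologicalSpace M] [ChartedSpace (EuclideanSpace ℝ (Fin n)) M]
  [IsManifold (𝓡 n) ∞ M] [T2Space M] [SigmaCompactSpace M] [MeasurableSpace M] [BorelSpace M]
  {F₁ : Type*} [NormedAddCommGroup F₁] [NormedSpace ℂ F₁]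
  {V₁ : M → Type*} [TopologicalSpace (TotalSpace F₁ V₁)] [∀ x, AddCommGroup (V₁ x)]
  [∀ x, Module ℂ (V₁ x)] [∀ x, TopologicalSpace (V₁ x)] [FiberBundle F₁ V₁] [VectorBundle ℂ F₁ V₁]
  {F₀ : Type*} [NormedAddCommGroup F₀] [NormedSpace ℂ F₀]
  {V₀ : M → Type*} [TopologicalSpace (TotalSpace F₀ V₀)] [∀ x, AddCommGroup (V₀ x)]
  [∀ x, Module ℂ (V₀ x)] [∀ x, TopologicalSpace (V₀ x)] [FiberBundle F₀ V₀] [VectorBundle ℂ F₀ V₀]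
  {g : LorentzStructure n M} {h₀ : FiberForm V₀} {h₁ : FiberForm V₁}
  {P : SmoothSections n F₁ V₁ →ₗ[ℂ] SmoothSections n F₁ V₁}
  {K : SmoothSections n F₀ V₀ →ₗ[ℂ] SmoothSections n F₁ V₁} {α : ℝ}

/-- The action of a differential operator on compactly supported sections. -/
def IsDiffOp.onCompact {A : SmoothSections n F₁ V₁ →ₗ[ℂ] SmoothSections n F₀ V₀} (hA : IsDiffOp A)
    (f : CompactSections n F₁ V₁) : CompactSections n F₀ V₀ :=
  ⟨A f, hA.mem_compactSections f.2⟩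

variable (g h₀ h₁ P K) in
/-- The propagators of `D = P + K K*` and `Q = K* K` in one time direction, with uniqueness. -/
structure PropagatorPair (r : M → M → Prop)
    (GD : CompactSections n F₁ V₁ →ₗ[ℂ] SmoothSections n F₁ V₁)
    (GQ : CompactSections n F₀ V₀ →ₗ[ℂ] SmoothSections n F₀ V₀) : Prop where
  rel : IsCausalRelation r
  prop_D : IsPropagator (relFuture r) (P + K ∘ₗ formalAdjoint g h₀ h₁ K) GD
  prop_Q : IsPropagator (relFuture r) (formalAdjoint g h₀ h₁ K ∘ₗ K) GQ
  unique_D : UniquelySolvable r (P + K ∘ₗ formalAdjoint g h₀ h₁ K)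
  unique_Q : UniquelySolvable r (formalAdjoint g h₀ h₁ K ∘ₗ K)

namespace PropagatorPair

variable {r : M → M → Prop} {GD : CompactSections n F₁ V₁ →ₗ[ℂ] SmoothSections n F₁ V₁}
  {GQ : CompactSections n F₀ V₀ →ₗ[ℂ] SmoothSections n F₀ V₀}

theorem D_apply (p : PropagatorPair g h₀ h₁ P K r GD GQ) (f : CompactSections n F₁ V₁) :
    P (GD f) + K (formalAdjoint g h₀ h₁ K (GD f)) = f := p.prop_D.right_inv f

theorem Q_apply (p : PropagatorPair g h₀ h₁ P K r GD GQ) (f : CompactSections n F₀ V₀) :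
    formalAdjoint g h₀ h₁ K (K (GQ f)) = f := p.prop_Q.right_inv f

variable [∀ x, Module ℝ (V₀ x)] [VectorBundle ℝ F₀ V₀] [ContMDiffVectorBundle ∞ F₀ V₀ (𝓡 n)]

/-- `K* G_D = G_Q K*`. -/
theorem adj_GD (p : PropagatorPair g h₀ h₁ P K r GD GQ) (h : GaugePair g h₀ h₁ P K)
    (f : CompactSections n F₁ V₁) :
    formalAdjoint g h₀ h₁ K (GD f) = GQ (h.adj_diffOp.onCompact f) := by
  refine (p.unique_Q.eq_propagator p.prop_Q f.2
    ((h.adj_diffOp.secSupport_apply _).trans (p.prop_D.support f)) _ ?_).symm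
  -- Since `K* P = 0`, applying `K*` to `D (G_D f) = f` gives `Q (K* G_D f) = K* f`.
  have := congrArg (formalAdjoint g h₀ h₁ K) (p.D_apply f)
  rwa [map_add, h.adj_P, zero_add] at this

theorem P_GD (p : PropagatorPair g h₀ h₁ P K r GD GQ) (h : GaugePair g h₀ h₁ P K)
    (f : CompactSections n F₁ V₁) :
    P (GD f) = f - K (GQ (h.adj_diffOp.onCompact f)) := by
  rw [← p.adj_GD h, eq_sub_iff_add_eq, p.D_apply]

/-- The candidate `f - K G_Q K* f` solves the equation: `D` sends it to `P f + K K* f - K Q G_Q K* f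
= P f`. -/
theorem GD_P (p : PropagatorPair g h₀ h₁ P K r GD GQ) (h : GaugePair g h₀ h₁ P K)
    (f : CompactSections n F₁ V₁) :
    GD (h.P_diffOp.onCompact f) = f - K (GQ (h.adj_diffOp.onCompact f)) := by
  have hsub : secSupport (h.adj_diffOp.onCompact f).1 ⊆ secSupport f.1 :=
    h.adj_diffOp.secSupport_apply f.1
  refine p.unique_D.eq_propagator p.prop_D f.2
    ((secSupport_sub _ _).trans (Set.union_subset (p.rel.subset_relFuture _)
      ((h.K_diffOp.secSupport_apply _).trans ((p.prop_Q.support _).trans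
        (relFuture_mono hsub))))) _ ?_
  simp only [LinearMap.add_apply, LinearMap.comp_apply, map_sub, p.Q_apply, h.P_K]
  simp only [IsDiffOp.onCompact]
  abel

/-- Elimination: the ghost rows involve `Q` alone; `K*` of the first row gives `Q b = 0`; once `b =
0`, the first two rows combine to `D a = 0`. -/
theorem uniquelySolvable_bigL (p : PropagatorPair g h₀ h₁ P K r GD GQ)
    (h : GaugePair g h₀ h₁ P K) : UniquelySolvable r (bigL g h₀ h₁ P K α) := by
  intro C hC u hu hL
  have hA : P (compA u) + K (compB u) = 0 := congrArg compA hL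
  have hB : formalAdjoint g h₀ h₁ K (compA u) - (α : ℂ) • compB u = 0 := congrArg compB hL
  have hd : compD u = 0 := p.unique_Q C hC _ ((isDiffOp_compD.secSupport_apply u).trans hu)
    (congrArg compC hL)
  have hc : compC u = 0 := p.unique_Q C hC _ ((isDiffOp_compC.secSupport_apply u).trans hu)
    (congrArg compD hL)
  have hb : compB u = 0 := by
    refine p.unique_Q C hC _ ((isDiffOp_compB.secSupport_apply u).trans hu) ?_
    have := congrArg (formalAdjoint g h₀ h₁ K) hA
    rwa [map_add, h.adj_P, zero_add, map_zero] at this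
  rw [hb, map_zero, add_zero] at hA
  rw [hb, smul_zero, sub_zero] at hB
  have ha : compA u = 0 := by
    refine p.unique_D C hC _ ((isDiffOp_compA.secSupport_apply u).trans hu) ?_
    rw [LinearMap.add_apply, LinearMap.comp_apply, hA, hB, map_zero, add_zero]
  exact totalSections_ext ha hb hc hd

/-- The first row forces `b = G_Q K* f_a`. With `a = G_D f_a + K G_Q f_b` the second row yields `b +
f_b - α b`, and the defect `(1 - α) b` is repaired by adding `(α - 1) K e` with `Q e = b`. The first
row is undisturbed, as `P K = 0`. -/
theorem exists_isPropagator_bigL (p : PropagatorPair g h₀ h₁ P K r GD GQ)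
    (h : GaugePair g h₀ h₁ P K) : ∃ G, IsPropagator (relFuture r) (bigL g h₀ h₁ P K α) G := by
  refine exists_isPropagator p.rel h.isDiffOp_bigL (p.uniquelySolvable_bigL h) fun f hf ↦ ?_
  let fa : CompactSections n F₁ V₁ := ⟨compA f, isDiffOp_compA.mem_compactSections hf⟩
  let fb : CompactSections n F₀ V₀ := ⟨compB f, isDiffOp_compB.mem_compactSections hf⟩
  let fc : CompactSections n F₀ V₀ := ⟨compC f, isDiffOp_compC.mem_compactSections hf⟩
  let fd : CompactSections n F₀ V₀ := ⟨compD f, isDiffOp_compD.mem_compactSections hf⟩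
  have hfa : secSupport fa.1 ⊆ secSupport f := isDiffOp_compA.secSupport_apply f
  have hfb : secSupport fb.1 ⊆ secSupport f := isDiffOp_compB.secSupport_apply f
  have hfc : secSupport fc.1 ⊆ secSupport f := isDiffOp_compC.secSupport_apply f
  have hfd : secSupport fd.1 ⊆ secSupport f := isDiffOp_compD.secSupport_apply f
  have hka : secSupport (h.adj_diffOp.onCompact fa).1 ⊆ secSupport f :=
    (h.adj_diffOp.secSupport_apply fa.1).trans hfa
  set b := GQ (h.adj_diffOp.onCompact fa) with hb
  have hbs : secSupport b ⊆ relFuture r (secSupport f) :=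
    (p.prop_Q.support _).trans (relFuture_mono hka)
  -- `b` need not have compact support, so the extended solvability of `Q` is needed.
  obtain ⟨e, hes, he⟩ := p.prop_Q.exists_solution p.rel h.isDiffOp_KK hf hbs
  have hQe : formalAdjoint g h₀ h₁ K (K e) = b := he
  have has : secSupport (GD fa + K (GQ fb) + ((α - 1 : ℝ) : ℂ) • K e) ⊆
      relFuture r (secSupport f) := by
    refine (secSupport_add _ _).trans (Set.union_subset ((secSupport_add _ _).trans
      (Set.union_subset ?_ ?_)) ((secSupport_smul _ _).trans ?_))
    · exact (p.prop_D.support fa).trans (relFuture_mono hfa)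
    · exact (h.K_diffOp.secSupport_apply _).trans
        ((p.prop_Q.support fb).trans (relFuture_mono hfb))
    · exact (h.K_diffOp.secSupport_apply _).trans hes
  refine ⟨mkTotal (GD fa + K (GQ fb) + ((α - 1 : ℝ) : ℂ) • K e) b (GQ fd) (GQ fc),
    secSupport_mkTotal has hbs ((p.prop_Q.support fd).trans (relFuture_mono hfd))
      ((p.prop_Q.support fc).trans (relFuture_mono hfc)), ?_⟩
  refine totalSections_ext ?_ ?_ ?_ ?_
  · simp only [bigL, compA_ofRows, LinearMap.add_apply, LinearMap.comp_apply, compA_mkTotal,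
      compB_mkTotal, map_add, map_smul, h.P_K, p.P_GD h, ← hb]
    simp [fa]
  · simp only [bigL, compB_ofRows, LinearMap.sub_apply, LinearMap.smul_apply, LinearMap.comp_apply,
      compA_mkTotal, compB_mkTotal, map_add, map_smul, p.Q_apply, p.adj_GD h, ← hb, hQe]
    rw [Complex.ofReal_sub, Complex.ofReal_one]
    module
  · exact p.Q_apply fc
  · exact p.Q_apply fd

/-- The propagators of `L` on sections `(a, b, 0, 0)` with `K* a = 0`. -/
theorem bigL_propagator_apply (p : PropagatorPair g h₀ h₁ P K r GD GQ)
    (h : GaugePair g h₀ h₁ P K)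
    {G : CompactSections n (F₁ × (F₀ × (F₀ × F₀))) (TotalBundle V₁ V₀) →ₗ[ℂ]
      TotalSections n F₁ V₁ F₀ V₀}
    (hG : IsPropagator (relFuture r) (bigL g h₀ h₁ P K α) G)
    (f : CompactSections n (F₁ × (F₀ × (F₀ × F₀))) (TotalBundle V₁ V₀))
    (ha : formalAdjoint g h₀ h₁ K (compA f.1) = 0) (hc : compC f.1 = 0) (hd : compD f.1 = 0) :
    G f = mkTotal (GD (isDiffOp_compA.onCompact f) + K (GQ (isDiffOp_compB.onCompact f))) 0 0 0 := by
  have hfa : secSupport (isDiffOp_compA.onCompact f).1 ⊆ secSupport f.1 :=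
    isDiffOp_compA.secSupport_apply f.1
  have hfb : secSupport (isDiffOp_compB.onCompact f).1 ⊆ secSupport f.1 :=
    isDiffOp_compB.secSupport_apply f.1
  have hz : secSupport (0 : SmoothSections n F₀ V₀) ⊆ relFuture r (secSupport f.1) := by
    rw [secSupport_zero]
    exact Set.empty_subset _
  refine (p.uniquelySolvable_bigL h).eq_propagator hG f.2 (secSupport_mkTotal
    ((secSupport_add _ _).trans (Set.union_subset
      ((p.prop_D.support _).trans (relFuture_mono hfa))
      ((h.K_diffOp.secSupport_apply _).trans
        ((p.prop_Q.support _).trans (relFuture_mono hfb))))) hz hz hz) f ?_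
  -- With `K* a = 0` the multiplier component `G_Q K* a` vanishes, and with it the only dependence
  -- on `α`.
  have h0 : h.adj_diffOp.onCompact (isDiffOp_compA.onCompact f) = 0 := Subtype.ext ha
  refine totalSections_ext ?_ ?_ ?_ ?_
  · simp only [bigL, compA_ofRows, LinearMap.add_apply, LinearMap.comp_apply, compA_mkTotal,
      compB_mkTotal, map_add, h.P_K, p.P_GD h, h0, map_zero]
    simp [IsDiffOp.onCompact]
  · simp only [bigL, compB_ofRows, LinearMap.sub_apply, LinearMap.smul_apply, LinearMap.comp_apply,
      compA_mkTotal, compB_mkTotal, map_add, p.Q_apply, p.adj_GD h, h0, map_zero]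
    simp [IsDiffOp.onCompact]
  · simp [bigL, hc]
  · simp [bigL, hd]

end PropagatorPair

end Green

/-! ### The phase spaces -/

section PhaseSpace

open Filter Topology

/-- A sesquilinear form that vanishes if one argument lies in `p` descends to the quotient. -/
theorem exists_quotient_form {E : Type*} [AddCommGroup E] [Module ℂ E] (p : Submodule ℂ E)
    (B : E →ₗ⋆[ℂ] E →ₗ[ℂ] ℂ) (hl : ∀ u ∈ p, ∀ v, B u v = 0) (hr : ∀ u, ∀ v ∈ p, B u v = 0) :
    ∃ q : (E ⧸ p) →ₗ⋆[ℂ] (E ⧸ p) →ₗ[ℂ] ℂ,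
      ∀ u v, q (Submodule.Quotient.mk u) (Submodule.Quotient.mk v) = B u v := by
  let B' : E →ₗ⋆[ℂ] (E ⧸ p) →ₗ[ℂ] ℂ :=
    { toFun := fun u ↦ p.liftQ (B u) fun v hv ↦ hr u v hv
      map_add' := fun u u' ↦ by
        ext v
        change B (u + u') v = B u v + B u' v
        rw [map_add, LinearMap.add_apply]
      map_smul' := fun c u ↦ by
        ext v
        change B (c • u) v = conj c • B u v
        rw [map_smulₛₗ, LinearMap.smul_apply] }
  refine ⟨p.liftQ B' fun u hu ↦ LinearMap.mem_ker.2 ?_, fun u v ↦ rfl⟩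
  ext v
  exact hl u hu v

/-- A sesquilinear form pulls back along a linear map. -/
theorem exists_pullback_form {E E' : Type*} [AddCommGroup E] [Module ℂ E] [AddCommGroup E']
    [Module ℂ E'] (Φ : E →ₗ[ℂ] E') (q' : E' →ₗ⋆[ℂ] E' →ₗ[ℂ] ℂ) :
    ∃ q : E →ₗ⋆[ℂ] E →ₗ[ℂ] ℂ, ∀ a b, q' (Φ a) (Φ b) = q a b :=
  ⟨LinearMap.mk₂'ₛₗ (starRingEnd ℂ) (RingHom.id ℂ) (fun a b ↦ q' (Φ a) (Φ b))
    (fun a a' b ↦ by rw [map_add, map_add, LinearMap.add_apply])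
    (fun c a b ↦ by rw [map_smul, map_smulₛₗ, LinearMap.smul_apply])
    (fun a b b' ↦ by rw [map_add, map_add])
    (fun c a b ↦ by rw [map_smul, map_smul, RingHom.id_apply]), fun _ _ ↦ rfl⟩

variable {n : ℕ} {M : Type*} [TopologicalSpace M] [ChartedSpace (EuclideanSpace ℝ (Fin n)) M]
  [IsManifold (𝓡 n) ∞ M] [T2Space M] [SigmaCompactSpace M] [MeasurableSpace M] [BorelSpace M]
  {F₁ : Type*} [NormedAddCommGroup F₁] [NormedSpace ℂ F₁]
  {V₁ : M → Type*} [TopologicalSpace (TotalSpace F₁ V₁)] [∀ x, AddCommGroup (V₁ x)]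
  [∀ x, Module ℂ (V₁ x)] [∀ x, TopologicalSpace (V₁ x)] [FiberBundle F₁ V₁] [VectorBundle ℂ F₁ V₁]
  {F₀ : Type*} [NormedAddCommGroup F₀] [NormedSpace ℂ F₀]
  {V₀ : M → Type*} [TopologicalSpace (TotalSpace F₀ V₀)] [∀ x, AddCommGroup (V₀ x)]
  [∀ x, Module ℂ (V₀ x)] [∀ x, TopologicalSpace (V₀ x)] [FiberBundle F₀ V₀] [VectorBundle ℂ F₀ V₀]
  {g : LorentzStructure n M} {h₀ : FiberForm V₀} {h₁ : FiberForm V₁}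
  {P : SmoothSections n F₁ V₁ →ₗ[ℂ] SmoothSections n F₁ V₁}
  {K : SmoothSections n F₀ V₀ →ₗ[ℂ] SmoothSections n F₁ V₁} {α : ℝ}

/-- Exposes the two chosen propagators, the advanced one being retarded for the reversed relation.
One argument can thus treat both time directions. -/
theorem causalPropagator_spec {D : SmoothSections n F₁ V₁ →ₗ[ℂ] SmoothSections n F₁ V₁}
    (H : HasPropagators g D) : ∃ Gp Gm, IsPropagator (relFuture (CausalLE g)) D Gp ∧
      IsPropagator (relFuture (rev (CausalLE g))) D Gm ∧ causalPropagator g D = Gp - Gm :=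
  ⟨_, _, Classical.choose_spec H.1, Classical.choose_spec H.2, dif_pos H⟩

variable [∀ x, Module ℝ (V₀ x)] [VectorBundle ℝ F₀ V₀] [ContMDiffVectorBundle ∞ F₀ V₀ (𝓡 n)]
  [∀ x, Module ℝ (V₁ x)] [VectorBundle ℝ F₁ V₁] [ContMDiffVectorBundle ∞ F₁ V₁ (𝓡 n)]

namespace GaugePair

/-- Uniqueness in each time direction is obtained from the propagator of the opposite direction and
self-adjointness. -/
theorem exists_propagatorPairs (h : GaugePair g h₀ h₁ P K) (hg : GloballyHyperbolic g)
    (hD : HasPropagators g (P + K ∘ₗ formalAdjoint g h₀ h₁ K))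
    (hQ : HasPropagators g (formalAdjoint g h₀ h₁ K ∘ₗ K)) :
    ∃ Dp Dm Qp Qm, PropagatorPair g h₀ h₁ P K (CausalLE g) Dp Qp ∧
      PropagatorPair g h₀ h₁ P K (rev (CausalLE g)) Dm Qm ∧
      causalPropagator g (P + K ∘ₗ formalAdjoint g h₀ h₁ K) = Dp - Dm ∧
      causalPropagator g (formalAdjoint g h₀ h₁ K ∘ₗ K) = Qp - Qm := by
  obtain ⟨Dp, Dm, hDp, hDm, hDe⟩ := causalPropagator_spec hD
  obtain ⟨Qp, Qm, hQp, hQm, hQe⟩ := causalPropagator_spec hQ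
  have hr := hg.isCausalRelation
  refine ⟨Dp, Dm, Qp, Qm, ⟨hr, hDp, hQp, ?_, ?_⟩, ⟨hr.rev, hDm, hQm, ?_, ?_⟩, hDe, hQe⟩
  · exact hDm.uniquelySolvable_rev hr h.isDiffOp_D h.hermitian₁ h.isFormalAdjoint_D
  · exact hQm.uniquelySolvable_rev hr h.isDiffOp_KK h.hermitian₀ h.isFormalAdjoint_KK
  · exact hDp.uniquelySolvable_rev hr.rev h.isDiffOp_D h.hermitian₁ h.isFormalAdjoint_D
  · exact hQp.uniquelySolvable_rev hr.rev h.isDiffOp_KK h.hermitian₀ h.isFormalAdjoint_KK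

theorem greenHyperbolic_bigL (h : GaugePair g h₀ h₁ P K) (hg : GloballyHyperbolic g)
    (hD : HasPropagators g (P + K ∘ₗ formalAdjoint g h₀ h₁ K))
    (hQ : HasPropagators g (formalAdjoint g h₀ h₁ K ∘ₗ K)) :
    GreenHyperbolic g (totalForm h₁ h₀) (bigL g h₀ h₁ P K α) := by
  obtain ⟨Dp, Dm, Qp, Qm, hp, hm, -⟩ := h.exists_propagatorPairs hg hD hQ
  have hL : HasPropagators g (bigL g h₀ h₁ P K α) :=
    ⟨hp.exists_isPropagator_bigL h, hm.exists_isPropagator_bigL h⟩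
  exact ⟨h.isDiffOp_bigL, hL, by rwa [h.formalAdjoint_bigL]⟩

/-- The causal propagator of `L` on sections `(a, b, 0, 0)` with `K* a = 0`. -/
theorem causalPropagator_bigL (h : GaugePair g h₀ h₁ P K) (hg : GloballyHyperbolic g)
    (hD : HasPropagators g (P + K ∘ₗ formalAdjoint g h₀ h₁ K))
    (hQ : HasPropagators g (formalAdjoint g h₀ h₁ K ∘ₗ K))
    (f : CompactSections n (F₁ × (F₀ × (F₀ × F₀))) (TotalBundle V₁ V₀))
    (ha : formalAdjoint g h₀ h₁ K (compA f.1) = 0) (hc : compC f.1 = 0) (hd : compD f.1 = 0) :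
    causalPropagator g (bigL g h₀ h₁ P K α) f = mkTotal
      (causalPropagator g (P + K ∘ₗ formalAdjoint g h₀ h₁ K) (isDiffOp_compA.onCompact f) +
        K (causalPropagator g (formalAdjoint g h₀ h₁ K ∘ₗ K) (isDiffOp_compB.onCompact f)))
      0 0 0 := by
  obtain ⟨Dp, Dm, Qp, Qm, hp, hm, hDe, hQe⟩ := h.exists_propagatorPairs hg hD hQ
  obtain ⟨Lp, Lm, hLp, hLm, hLe⟩ := causalPropagator_spec
    (h.greenHyperbolic_bigL (α := α) hg hD hQ).propagators
  rw [hLe, hDe, hQe, LinearMap.sub_apply, hp.bigL_propagator_apply h hLp f ha hc hd,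
    hm.bigL_propagator_apply h hLm f ha hc hd]
  refine totalSections_ext ?_ ?_ ?_ ?_ <;> simp
  abel

/-- Move `K` across as `K*`, which annihilates `u`; compactness of the support of `u` alone permits
this. -/
theorem pairing_K (h : GaugePair g h₀ h₁ P K) {u : SmoothSections n F₁ V₁}
    (hu : u ∈ subsidiaryKer g h₀ h₁ K) (w : SmoothSections n F₀ V₀) :
    pairing g h₁ u (K w) = 0 := by
  rw [← (h.adj.symm h.hermitian₀ h.hermitian₁).pairing_eq h.adj_diffOp h.K_diffOp
    (isCompact_inter_left hu.1 w), LinearMap.mem_ker.1 hu.2, pairing_zero_left]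

/-- The form `q_P` is well defined. -/
theorem exists_inducedForm_P (h : GaugePair g h₀ h₁ P K) (hg : GloballyHyperbolic g)
    (hD : HasPropagators g (P + K ∘ₗ formalAdjoint g h₀ h₁ K))
    (hQ : HasPropagators g (formalAdjoint g h₀ h₁ K ∘ₗ K)) :
    ∃ q : SubsidiaryPhaseSpace g h₀ h₁ P K →ₗ⋆[ℂ] SubsidiaryPhaseSpace g h₀ h₁ P K →ₗ[ℂ] ℂ,
      IsInducedForm g h₁ (P + K ∘ₗ formalAdjoint g h₀ h₁ K) (subsidiaryKer_le g h₀ h₁ K) q := by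
  obtain ⟨Dp, Dm, Qp, Qm, hp, hm, hDe, hQe⟩ := h.exists_propagatorPairs hg hD hQ
  set E := causalPropagator g (P + K ∘ₗ formalAdjoint g h₀ h₁ K)
  let ι := Submodule.inclusion (subsidiaryKer_le g h₀ h₁ K)
  have hc : ∀ (u : subsidiaryKer g h₀ h₁ K) (v : SmoothSections n F₁ V₁),
      IsCompact (secSupport u.1 ∩ secSupport v) := fun u v ↦ isCompact_inter_left u.2.1 v
  let B : subsidiaryKer g h₀ h₁ K →ₗ⋆[ℂ] subsidiaryKer g h₀ h₁ K →ₗ[ℂ] ℂ :=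
    LinearMap.mk₂'ₛₗ (starRingEnd ℂ) (RingHom.id ℂ)
      (fun u v ↦ Complex.I⁻¹ * pairing g h₁ u.1 (E (ι v)))
      (fun u u' v ↦ by
        rw [← mul_add, ← pairing_add_left h.hermitian₁ (hc u _) (hc u' _)]
        rfl)
      (fun c u v ↦ by
        rw [smul_eq_mul, mul_left_comm, ← pairing_smul_left]
        rfl)
      (fun u v v' ↦ by
        rw [map_add, map_add, pairing_add_right h.hermitian₁ (hc u _) (hc u _), mul_add])
      (fun c u v ↦ by
        rw [map_smul, map_smul, pairing_smul_right, RingHom.id_apply, smul_eq_mul, mul_left_comm])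
  refine exists_quotient_form _ B ?_ ?_
  · rintro u ⟨w, hw, hwu⟩ v
    have hv : h.adj_diffOp.onCompact (ι v) = 0 := Subtype.ext v.2.2
    -- `P G_D^± v = v - K G_Q^± K* v = v` when `K* v = 0`, so the difference of propagators is
    -- annihilated by `P`.
    have hPE : P (E (ι v)) = 0 := by
      simp only [hDe, LinearMap.sub_apply, map_sub, hp.P_GD h, hm.P_GD h, hv, map_zero, sub_self]
    have hwu' : P w = u.1 := hwu
    change Complex.I⁻¹ * pairing g h₁ u.1 (E (ι v)) = 0
    rw [← hwu', h.P_selfAdjoint.pairing_eq h.P_diffOp h.P_diffOp (isCompact_inter_left hw _), hPE,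
      pairing_zero_right, mul_zero]
  · rintro u v ⟨w, hw, hwv⟩
    have hv : ι v = h.P_diffOp.onCompact ⟨w, hw⟩ := Subtype.ext hwv.symm
    -- In `G_D^± P w = w - K G_Q^± K* w` the term `w` cancels, leaving an element of `Ran K`,
    -- orthogonal to `Ker K*`.
    have hE : E (ι v) = K (-(causalPropagator g (formalAdjoint g h₀ h₁ K ∘ₗ K)
        (h.adj_diffOp.onCompact ⟨w, hw⟩))) := by
      rw [hv, hDe, LinearMap.sub_apply, hp.GD_P h, hm.GD_P h, hQe, LinearMap.sub_apply, map_neg,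
        map_sub]
      abel
    change Complex.I⁻¹ * pairing g h₁ u.1 (E (ι v)) = 0
    rw [hE, h.pairing_K u.2, mul_zero]

theorem mem_brstKer_iff (h : GaugePair g h₀ h₁ P K) {f : TotalSections n F₁ V₁ F₀ V₀} :
    f ∈ brstKer g (totalForm h₁ h₀) (gammaOp K) ⊓
        GradedSections n (F₁ × (F₀ × (F₀ × F₀))) (ghostGrading V₁ V₀) 0 ↔
      f ∈ CompactSections n (F₁ × (F₀ × (F₀ × F₀))) (TotalBundle V₁ V₀) ∧
        formalAdjoint g h₀ h₁ K (compA f) = 0 ∧ compC f = 0 ∧ compD f = 0 := by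
  rw [Submodule.mem_inf, brstKer, Submodule.mem_inf, mem_gradedSections_zero, LinearMap.mem_ker,
    h.formalAdjoint_gammaOp, and_assoc]
  refine and_congr_right fun _ ↦ ⟨fun hf ↦ ⟨congrArg compC hf.1, hf.2⟩, fun hf ↦ ⟨?_, hf.2⟩⟩
  refine totalSections_ext ?_ ?_ ?_ ?_ <;> simp [gammaAdj, hf]

/-- In degree zero, the subspace of trivial observables consists of the `(P w, b, 0, 0)`. -/
theorem mem_brstRan_iff (h : GaugePair g h₀ h₁ P K)
    (hQ : HasPropagators g (formalAdjoint g h₀ h₁ K ∘ₗ K)) {f : TotalSections n F₁ V₁ F₀ V₀}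
    (hf : f ∈ brstKer g (totalForm h₁ h₀) (gammaOp K) ⊓
        GradedSections n (F₁ × (F₀ × (F₀ × F₀))) (ghostGrading V₁ V₀) 0) :
    f ∈ brstRan g (totalForm h₁ h₀) (bigL g h₀ h₁ P K α) (gammaOp K) ↔
      compA f ∈ (CompactSections n F₁ V₁).map P := by
  have hker : ∀ {f : TotalSections n F₁ V₁ F₀ V₀},
      f ∈ brstKer g (totalForm h₁ h₀) (gammaOp K) →
      formalAdjoint g h₀ h₁ K (compA f) = 0 := fun {f} hf ↦ by
    have := hf.2
    rw [h.formalAdjoint_gammaOp] at this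
    exact congrArg compC this
  rw [brstRan, h.formalAdjoint_gammaOp, Submodule.mem_sup]
  constructor
  · rintro ⟨_, ⟨u, hu, rfl⟩, _, ⟨⟨v, hv, rfl⟩, hLv⟩, rfl⟩
    -- `K*` of the first row of `L v` is `Q v_b`, because `K* P = 0`; a propagator of `Q` is also a
    -- left inverse on test sections, so `v_b = 0`.
    have hb : compB v = 0 := by
      obtain ⟨G, hG⟩ := hQ.1
      have h1 : formalAdjoint g h₀ h₁ K (K (compB v)) = 0 := by
        have := hker hLv
        simpa [bigL, h.adj_P] using this
      have h2 := hG.left_inv ⟨compB v, isDiffOp_compB.mem_compactSections hv⟩ 0 h1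
      rw [map_zero] at h2
      exact h2.symm
    refine ⟨compA v, isDiffOp_compA.mem_compactSections hv, ?_⟩
    simp [gammaAdj, bigL, hb]
  · rintro ⟨w, hw, hwf⟩
    obtain ⟨hfc, hfa, hfC, hfD⟩ := h.mem_brstKer_iff.1 hf
    have hz₀ := Submodule.zero_mem (CompactSections n F₀ V₀)
    have hz₁ := Submodule.zero_mem (CompactSections n F₁ V₁)
    have hL : bigL g h₀ h₁ P K α (mkTotal w 0 0 0) ∈
        brstKer g (totalForm h₁ h₀) (gammaOp K) := by
      refine (h.mem_brstKer_iff.2 ⟨h.isDiffOp_bigL.mem_compactSections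
        (mem_compactSections_mkTotal hw hz₀ hz₀ hz₀), ?_, ?_, ?_⟩).1 <;>
      simp [bigL, h.adj_P]
    -- `L (w, 0, 0, 0) = (P w, K* w, 0, 0)`, and the remaining multiplier part `f_b - K* w` is `γ*`
    -- of an antighost section.
    refine ⟨_, ⟨mkTotal 0 0 0 (compB f - formalAdjoint g h₀ h₁ K w),
      mem_compactSections_mkTotal hz₁ hz₀ hz₀ (Submodule.sub_mem _
        (isDiffOp_compB.mem_compactSections hfc) (h.adj_diffOp.mem_compactSections hw)), rfl⟩,
      _, ⟨⟨mkTotal w 0 0 0, mem_compactSections_mkTotal hw hz₀ hz₀ hz₀, rfl⟩, hL⟩, ?_⟩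
    refine totalSections_ext ?_ ?_ ?_ ?_ <;> simp [gammaAdj, bigL, hwf, hfC, hfD]

/-- The isomorphism of phase spaces induced by `f ↦ f_a`. -/
theorem exists_phaseSpace_equiv (h : GaugePair g h₀ h₁ P K)
    (hQ : HasPropagators g (formalAdjoint g h₀ h₁ K ∘ₗ K)) :
    ∃ Φ : BRSTPhaseSpace g (totalForm h₁ h₀) (ghostGrading V₁ V₀) (bigL g h₀ h₁ P K α)
        (gammaOp K) ≃ₗ[ℂ] SubsidiaryPhaseSpace g h₀ h₁ P K,
      ∀ (f : ↥(brstKer g (totalForm h₁ h₀) (gammaOp K) ⊓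
          GradedSections n (F₁ × (F₀ × (F₀ × F₀))) (ghostGrading V₁ V₀) 0))
        (u : ↥(subsidiaryKer g h₀ h₁ K)), compA f.1 = u.1 →
        Φ (Submodule.Quotient.mk f) = Submodule.Quotient.mk u := by
  let φ : ↥(brstKer g (totalForm h₁ h₀) (gammaOp K) ⊓
      GradedSections n (F₁ × (F₀ × (F₀ × F₀))) (ghostGrading V₁ V₀) 0) →ₗ[ℂ]
        ↥(subsidiaryKer g h₀ h₁ K) :=
    (compA ∘ₗ Submodule.subtype _).codRestrict _ fun f ↦
      ⟨isDiffOp_compA.mem_compactSections f.2.1.1, (h.mem_brstKer_iff.1 f.2).2.1⟩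
  have hφ : ∀ f, f ∈ (brstRan g (totalForm h₁ h₀) (bigL g h₀ h₁ P K α) (gammaOp K) ⊓
        GradedSections n (F₁ × (F₀ × (F₀ × F₀))) (ghostGrading V₁ V₀) 0).submoduleOf
          (brstKer g (totalForm h₁ h₀) (gammaOp K) ⊓
            GradedSections n (F₁ × (F₀ × (F₀ × F₀))) (ghostGrading V₁ V₀) 0) ↔
      φ f ∈ ((CompactSections n F₁ V₁).map P).submoduleOf (subsidiaryKer g h₀ h₁ K) := fun f ↦
    ⟨fun hf ↦ (h.mem_brstRan_iff hQ f.2).1 hf.1,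
      fun hf ↦ ⟨(h.mem_brstRan_iff hQ f.2).2 hf, f.2.2⟩⟩
  let Φ : BRSTPhaseSpace g (totalForm h₁ h₀) (ghostGrading V₁ V₀) (bigL g h₀ h₁ P K α)
      (gammaOp K) →ₗ[ℂ] SubsidiaryPhaseSpace g h₀ h₁ P K :=
    Submodule.mapQ _ _ φ fun f hf ↦ (hφ f).1 hf
  have hΦ : Function.Bijective Φ := by
    constructor
    · refine (injective_iff_map_eq_zero Φ).2 fun a ↦ ?_
      obtain ⟨f, rfl⟩ := Submodule.Quotient.mk_surjective _ a
      intro hf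
      exact (Submodule.Quotient.mk_eq_zero _).2
        ((hφ f).2 ((Submodule.Quotient.mk_eq_zero _).1 hf))
    · intro a
      obtain ⟨u, rfl⟩ := Submodule.Quotient.mk_surjective _ a
      have hz := Submodule.zero_mem (CompactSections n F₀ V₀)
      -- Every `u` in `Ker K*` lifts to `(u, 0, 0, 0)`.
      exact ⟨Submodule.Quotient.mk ⟨mkTotal u.1 0 0 0, h.mem_brstKer_iff.2
        ⟨mem_compactSections_mkTotal u.2.1 hz hz hz, u.2.2, rfl, rfl⟩⟩, rfl⟩
  refine ⟨LinearEquiv.ofBijective Φ hΦ, fun f u hfu ↦ ?_⟩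
  have : φ f = u := Subtype.ext hfu
  rw [← this]
  rfl

end GaugePair

end PhaseSpace
end

end GaugeBRST

/-! ### Comparison of the BRST and subsidiary-condition phase spaces. -/

theorem mainTheorem4 {n : ℕ} {M : Type*} [TopologicalSpace M]
    [ChartedSpace (EuclideanSpace ℝ (Fin n)) M] [IsManifold (𝓡 n) ∞ M] [T2Space M]
    [SigmaCompactSpace M] [MeasurableSpace M] [BorelSpace M]
    {F₀ : Type*} [NormedAddCommGroup F₀] [NormedSpace ℂ F₀] [FiniteDimensional ℂ F₀]
    {V₀ : M → Type*} [TopologicalSpace (TotalSpace F₀ V₀)] [∀ x, AddCommGroup (V₀ x)]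
    [∀ x, Module ℂ (V₀ x)] [∀ x, TopologicalSpace (V₀ x)] [FiberBundle F₀ V₀]
    [VectorBundle ℂ F₀ V₀] [VectorBundle ℝ F₀ V₀] [ContMDiffVectorBundle ∞ F₀ V₀ (𝓡 n)]
    {F₁ : Type*} [NormedAddCommGroup F₁] [NormedSpace ℂ F₁] [FiniteDimensional ℂ F₁]
    {V₁ : M → Type*} [TopologicalSpace (TotalSpace F₁ V₁)] [∀ x, AddCommGroup (V₁ x)]
    [∀ x, Module ℂ (V₁ x)] [∀ x, TopologicalSpace (V₁ x)] [FiberBundle F₁ V₁]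
    [VectorBundle ℂ F₁ V₁] [VectorBundle ℝ F₁ V₁] [ContMDiffVectorBundle ∞ F₁ V₁ (𝓡 n)]
    (g : LorentzStructure n M) (hg : GloballyHyperbolic g)
    (h₀ : FiberForm V₀) (h₁ : FiberForm V₁)
    (P : SmoothSections n F₁ V₁ →ₗ[ℂ] SmoothSections n F₁ V₁)
    (K : SmoothSections n F₀ V₀ →ₗ[ℂ] SmoothSections n F₁ V₁) (α : ℝ) :
    (ModifiedSubsidiary g h₀ h₁ P K α →
      BRSTHypotheses g (totalForm h₁ h₀) (ghostGrading V₁ V₀) (bigL g h₀ h₁ P K α) (gammaOp K)) ∧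
    (HackSchenkel g h₀ h₁ P K K →
      BRSTHypotheses g (totalForm h₁ h₀) (ghostGrading V₁ V₀) (bigL g h₀ h₁ P K α) (gammaOp K) ∧
      ∃ (q : BRSTPhaseSpace g (totalForm h₁ h₀) (ghostGrading V₁ V₀)
              (bigL g h₀ h₁ P K α) (gammaOp K) →ₗ⋆[ℂ]
            BRSTPhaseSpace g (totalForm h₁ h₀) (ghostGrading V₁ V₀)
              (bigL g h₀ h₁ P K α) (gammaOp K) →ₗ[ℂ] ℂ)
        (qP : SubsidiaryPhaseSpace g h₀ h₁ P K →ₗ⋆[ℂ] SubsidiaryPhaseSpace g h₀ h₁ P K →ₗ[ℂ] ℂ)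
        (Φ : BRSTPhaseSpace g (totalForm h₁ h₀) (ghostGrading V₁ V₀)
              (bigL g h₀ h₁ P K α) (gammaOp K) ≃ₗ[ℂ] SubsidiaryPhaseSpace g h₀ h₁ P K),
        IsInducedForm g (totalForm h₁ h₀) (bigL g h₀ h₁ P K α)
          (brstKer_graded_le g (totalForm h₁ h₀) (ghostGrading V₁ V₀) (gammaOp K) 0) q ∧
        IsInducedForm g h₁ (P + K ∘ₗ formalAdjoint g h₀ h₁ K) (subsidiaryKer_le g h₀ h₁ K) qP ∧
        (∀ (f : ↥(brstKer g (totalForm h₁ h₀) (gammaOp K) ⊓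
              GradedSections n (F₁ × (F₀ × (F₀ × F₀))) (ghostGrading V₁ V₀) 0))
            (u : ↥(subsidiaryKer g h₀ h₁ K)), compA f.1 = u.1 →
          Φ (Submodule.Quotient.mk f) = Submodule.Quotient.mk u) ∧
        ∀ a b, qP (Φ a) (Φ b) = q a b) := by
  refine ⟨fun H ↦ H.gaugePair.brstHypotheses H.L_green, fun H ↦ ?_⟩
  have h := H.gaugePair
  have hD := H.D_green.propagators
  have hQ := H.R_green.propagators
  have hL := h.greenHyperbolic_bigL (α := α) hg hD hQ
  obtain ⟨qP, hqP⟩ := h.exists_inducedForm_P hg hD hQ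
  obtain ⟨Φ, hΦ⟩ := h.exists_phaseSpace_equiv (α := α) hQ
  -- `q` is defined by transporting `q_P` along the isomorphism, so compatibility is automatic. What
  -- remains is that it is the form induced by `G_L`, which also shows independence of
  -- representatives.
  obtain ⟨q, hq⟩ := exists_pullback_form Φ.toLinearMap qP
  refine ⟨h.brstHypotheses hL, q, qP, Φ, fun u v ↦ ?_, hqP, hΦ, hq⟩
  obtain ⟨huc, hua, -, -⟩ := h.mem_brstKer_iff.1 u.2
  obtain ⟨hvc, hva, hvC, hvD⟩ := h.mem_brstKer_iff.1 v.2
  have hu' : compA u.1 ∈ subsidiaryKer g h₀ h₁ K := ⟨isDiffOp_compA.mem_compactSections huc, hua⟩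
  have hv' : compA v.1 ∈ subsidiaryKer g h₀ h₁ K := ⟨isDiffOp_compA.mem_compactSections hvc, hva⟩
  refine (hq _ _).symm.trans ?_
  rw [LinearEquiv.coe_coe, hΦ u ⟨_, hu'⟩ rfl, hΦ v ⟨_, hv'⟩ rfl, hqP,
    pairing_total g h.hermitian₁ h.hermitian₀ (isCompact_inter_left huc _),
    h.causalPropagator_bigL hg hD hQ _ hva hvC hvD]
  simp only [compA_mkTotal, compB_mkTotal, compC_mkTotal, compD_mkTotal, pairing_zero_right,
    add_zero]
  -- Of `G_D v_a + K G_Q v_b` the second summand drops out, being orthogonal to `u_a` in `Ker K*`.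
  rw [pairing_add_right h.hermitian₁ (isCompact_inter_left hu'.1 _)
    (isCompact_inter_left hu'.1 _), h.pairing_K hu', add_zero]
  rfl
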